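/- Let $M$ be a closed (compact, without boundary) smooth manifold of dimension $n\ge 3$ with a smooth Riemannian metric $g$, and put $2^*=\frac{2n}{n-2}$. For a smooth positive function $w$ on $M$ write $g_w=w^{4/(n-2)}g$, and let $[g]=\{g_w\}$ be the conformal class of $g$. For $h\in[g]$, let $H^1_+(M,h)$ be the set of $u\in H^1(M,h)$ with $u>0$ almost everywhere (functions equal almost everywhere being identified), let $dV_h$ and $R_h$ be the Riemannian measure and the scalar curvature of $h$, and put $$\langle u,v\rangle_h=4\tfrac{n-1}{n-2}\int_M h(\nabla_h u,\nabla_h v)\,dV_h+\int_M R_h\,uv\,dV_h ,\qquad \mathcal Y(M,[h])=\inf_{u\in H^1_+(M,h)}\frac{\langle u,u\rangle_h}{\|u\|^2_{L^{2^*}(M,h)}} .$$ Assume $\mathcal Y(M,[g])>0$. Then the following hold. 1. For every $h\in[g]$ and $u\in H^1_+(M,h)$ the problem of minimizing $\langle v,v\rangle_h$ over all $v\in H^1_+(M,h)$ with $v\ge u$ almost everywhere has a unique solution $T_h(u)$, and $\|T_h(u)\|_{L^{2^*}(M,h)}>0$. So $$I^h(u)=\frac{\langle u,u\rangle_h}{\|T_h(u)\|^2_{L^{2^*}(M,h)}}$$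 is well defined on $H^1_+(M,h)$. 2. For every smooth positive function $w$ on $M$ and every $u\in H^1_+(M,g_w)$ one has $wu\in H^1_+(M,g)$, $$T_{g_w}(u)=w^{-1}T_g(wu)\qquad\text{and}\qquad I^{g_w}(u)=I^g(wu).$$ 3. For every $h\in[g]$ the functional $I^h$ is bounded below on the non-empty set $H^1_+(M,h)$, and its infimum $\mathcal Y_{oc}(M,[h])=\inf_{u\in H^1_+(M,h)}I^h(u)$ satisfies $$\inf_{u\in H^1_+(M,h)}I^h(u)=\inf_{u\in H^1_+(M,g)}I^g(u).$$ -/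

import Mathlib

open scoped Manifold ContDiff ENNReal
open MeasureTheory Bundle

noncomputable section

namespace Yamabe

/-- A smooth Riemannian metric on an `n`-dimensional smooth manifold without boundary. -/
abbrev Metric (n : ℕ) (M : Type*) [TopologicalSpace M] [ChartedSpace (EuclideanSpace ℝ (Fin n)) M]
    [IsManifold (𝓡 n) ∞ M] :=
  ContMDiffRiemannianMetric (𝓡 n) ∞ (EuclideanSpace ℝ (Fin n))
    (fun x : M => TangentSpace (𝓡 n) x)

variable {n : ℕ} {M : Type*} [TopologicalSpace M] [ChartedSpace (EuclideanSpace ℝ (Fin n)) M]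

/-- The `i`-th partial derivative of a function on `ℝⁿ`. -/
def pderiv (i : Fin n) (f : EuclideanSpace ℝ (Fin n) → ℝ) (y : EuclideanSpace ℝ (Fin n)) : ℝ :=
  fderiv ℝ f y (EuclideanSpace.single i 1)

/-- The inverse of the preferred chart at `c`; on the (open) target of the chart it is the local
parametrization of `M`. -/
def param (c : M) : EuclideanSpace ℝ (Fin n) → M := (extChartAt (𝓡 n) c).symm

/-- The coordinate vector field `∂ᵢ` of the chart at `c`, at the point with coordinates `y`. -/
def coordVec (c : M) (i : Fin n) (y : EuclideanSpace ℝ (Fin n)) :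
    TangentSpace (𝓡 n) (param c y) :=
  mfderiv (𝓡 n) (𝓡 n) (param c) y
    (EuclideanSpace.single i (1 : ℝ) : EuclideanSpace ℝ (Fin n))

variable [IsManifold (𝓡 n) ∞ M]

/-! ### Curvature and volume, in the charts of the manifold -/

/-- The matrix `(gᵢⱼ)` of the metric in the chart at `c`. -/
def coeff (g : Metric n M) (c : M) (y : EuclideanSpace ℝ (Fin n)) : Matrix (Fin n) (Fin n) ℝ :=
  Matrix.of fun i j => g.inner (param c y) (coordVec c i y) (coordVec c j y)

/-- The Christoffel symbol `Γᵏᵢⱼ = ½ gᵏˡ (∂ᵢ gⱼₗ + ∂ⱼ gᵢₗ - ∂ₗ gᵢⱼ)` in the chart at `c`. -/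
def christoffel (g : Metric n M) (c : M) (k i j : Fin n) (y : EuclideanSpace ℝ (Fin n)) : ℝ :=
  (1 / 2) * ∑ l, (coeff g c y)⁻¹ k l *
    (pderiv i (fun z => coeff g c z j l) y + pderiv j (fun z => coeff g c z i l) y
      - pderiv l (fun z => coeff g c z i j) y)

/-- The Ricci tensor `Rⱼₖ = ∂ᵢ Γⁱⱼₖ - ∂ⱼ Γⁱᵢₖ + Γⁱᵢₚ Γᵖⱼₖ - Γⁱⱼₚ Γᵖᵢₖ` in the chart at `c`. -/
def ricci (g : Metric n M) (c : M) (j k : Fin n) (y : EuclideanSpace ℝ (Fin n)) : ℝ :=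
  ∑ i, (pderiv i (christoffel g c i j k) y - pderiv j (christoffel g c i i k) y
    + ∑ p, (christoffel g c i i p y * christoffel g c p j k y
      - christoffel g c i j p y * christoffel g c p i k y))

/-- The scalar curvature `R_g = gʲᵏ Rⱼₖ`, computed at `x` in the preferred chart at `x`. -/
def scalarCurvature (g : Metric n M) (x : M) : ℝ :=
  ∑ j, ∑ k, (coeff g x (extChartAt (𝓡 n) x x))⁻¹ j k * ricci g x j k (extChartAt (𝓡 n) x x)

/-- The measure `√(det gᵢⱼ) dy` of the chart at `c`, carried to the domain of that chart in `M`. -/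
def chartVolume [MeasurableSpace M] (g : Metric n M) (c : M) : Measure M :=
  ((volume.restrict (extChartAt (𝓡 n) c).target).withDensity
    (fun y => ENNReal.ofReal (Real.sqrt (coeff g c y).det))).map (param c)

/-- The Riemannian measure `dV_g`. The measures `chartVolume g c` agree on the overlaps of their
domains, and `dV_g`, the measure that restricts to `chartVolume g c` on the domain of every chart,
is their supremum in the lattice of measures. -/
def vol [MeasurableSpace M] (g : Metric n M) : Measure M := ⨆ c : M, chartVolume g c

/-! ### The Sobolev space `H¹` and the energy -/

/-- `X` is a weak gradient of `u` with respect to `g`: in every chart, the function `g(X, ∂ᵢ)` is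
locally integrable and is the `i`-th weak partial derivative of `u`, for every `i`. -/
def IsWeakGradient (g : Metric n M) (u : M → ℝ) (X : ∀ x : M, TangentSpace (𝓡 n) x) : Prop :=
  ∀ (c : M) (i : Fin n),
    LocallyIntegrableOn (fun y => g.inner (param c y) (X (param c y)) (coordVec c i y))
      (extChartAt (𝓡 n) c).target ∧
    ∀ ψ : EuclideanSpace ℝ (Fin n) → ℝ, ContDiff ℝ ∞ ψ → HasCompactSupport ψ →
      tsupport ψ ⊆ (extChartAt (𝓡 n) c).target →
      ∫ y, u (param c y) * pderiv i ψ y =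
        -∫ y, g.inner (param c y) (X (param c y)) (coordVec c i y) * ψ y

/-- The weak gradient `∇_g u` (it is unique up to null sets, if it exists). -/
def weakGradient (g : Metric n M) (u : M → ℝ) : ∀ x : M, TangentSpace (𝓡 n) x :=
  Classical.epsilon (h := ⟨fun _ => 0⟩) (IsWeakGradient g u)

variable [MeasurableSpace M]

/-- `H¹(M, g)`: the functions of class `L²` with a weak gradient of class `L²`. (Functions that
agree almost everywhere are not identified.) -/
def H1 (g : Metric n M) : Set (M → ℝ) :=
  {u | MemLp u 2 (vol g) ∧ ∃ X : ∀ x : M, TangentSpace (𝓡 n) x,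
    IsWeakGradient g u X ∧ Integrable (fun x => g.inner x (X x) (X x)) (vol g)}

/-- `H¹₊(M, g)`: the functions of `H¹(M, g)` that are positive almost everywhere. -/
def H1pos (g : Metric n M) : Set (M → ℝ) :=
  {u | u ∈ H1 g ∧ ∀ᵐ x ∂(vol g), 0 < u x}

/-- The form `⟨u, v⟩_g` of the conformal Laplacian `-4 (n-1)/(n-2) Δ_g + R_g`. -/
def form (g : Metric n M) (u v : M → ℝ) : ℝ :=
  4 * ((n : ℝ) - 1) / ((n : ℝ) - 2) *
      ∫ x, g.inner x (weakGradient g u x) (weakGradient g v x) ∂(vol g)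
    + ∫ x, scalarCurvature g x * u x * v x ∂(vol g)

/-- The norm of `L^{2*}(M, g)`, where `2* = 2n/(n-2)`. -/
def critNorm (g : Metric n M) (u : M → ℝ) : ℝ :=
  (eLpNorm u (ENNReal.ofReal (2 * (n : ℝ) / ((n : ℝ) - 2))) (vol g)).toReal

/-- The Yamabe functional `J^g`. -/
def J (g : Metric n M) (u : M → ℝ) : ℝ := form g u u / critNorm g u ^ 2

/-- The Yamabe invariant `𝒴(M, [g])`. -/
def yamabeInvariant (g : Metric n M) : ℝ := sInf (J g '' H1pos g)

/-! ### The obstacle problem and the optimal control problem -/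

/-- `v` minimizes `⟨v, v⟩_g` among the functions of `H¹₊(M, g)` that lie above `u`. -/
def IsObstacleSolution (g : Metric n M) (u v : M → ℝ) : Prop :=
  v ∈ H1pos g ∧ u ≤ᵐ[vol g] v ∧
    ∀ v' ∈ H1pos g, u ≤ᵐ[vol g] v' → form g v v ≤ form g v' v'

/-- The obstacle map: `T_g(u)` is the solution of the obstacle problem with obstacle `u`. -/
def T (g : Metric n M) (u : M → ℝ) : M → ℝ := Classical.epsilon (IsObstacleSolution g u)

/-- The Yamabe optimal obstacle functional `I^g`. -/
def I (g : Metric n M) (u : M → ℝ) : ℝ := form g u u / critNorm g (T g u) ^ 2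

/-- The infimum `𝒴_oc` of `I^g` over `H¹₊(M, g)`. -/
def Yoc (g : Metric n M) : ℝ := sInf (I g '' H1pos g)

/-! ### Conformal metrics -/

set_option synthInstance.maxHeartbeats 400000 in
/-- The conformal metric `g_w = w^{4/(n-2)} g`, for a smooth positive function `w`. -/
def conformal {n : ℕ} {M : Type*} [TopologicalSpace M] [ChartedSpace (EuclideanSpace ℝ (Fin n)) M]
    [IsManifold (𝓡 n) ∞ M] (g : Metric n M) (w : M → ℝ)
    (hw : ContMDiff (𝓡 n) 𝓘(ℝ, ℝ) ∞ w) (hpos : ∀ x, 0 < w x) : Metric n M where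
  inner x := (w x ^ (4 / ((n : ℝ) - 2))) • g.inner x
  symm x v v' := by
    simp only [_root_.smul_apply, g.symm x v v']
  pos x v hv := by
    simp only [_root_.smul_apply, smul_eq_mul]
    exact mul_pos (Real.rpow_pos_of_pos (hpos x) _) (g.pos x v hv)
  isVonNBounded x := by
    have ha : 0 < w x ^ (4 / ((n : ℝ) - 2)) := Real.rpow_pos_of_pos (hpos x) _
    have hs := Real.sqrt_pos.2 ha
    refine ((g.isVonNBounded x).image
      ((Real.sqrt (w x ^ (4 / ((n : ℝ) - 2))))⁻¹ •
        ContinuousLinearMap.id ℝ (TangentSpace (𝓡 n) x))).subset ?_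
    intro v hv
    refine ⟨Real.sqrt (w x ^ (4 / ((n : ℝ) - 2))) • v, ?_, ?_⟩
    · simp only [Set.mem_ofPred_eq, _root_.smul_apply, smul_eq_mul, map_smul] at hv ⊢
      rwa [← mul_assoc, Real.mul_self_sqrt ha.le]
    · simp [smul_smul, hs.ne']
  contMDiff := by
    have h : ContMDiff (𝓡 n) 𝓘(ℝ, ℝ) ∞ (fun x => w x ^ (4 / ((n : ℝ) - 2))) := by
      intro x
      exact (Real.contDiffAt_rpow_const_of_ne (hpos x).ne').contMDiffAt.comp x (hw x)
    exact ContMDiff.smul_section (V := fun x : M => TangentSpace (𝓡 n) x →L[ℝ] TangentSpace (𝓡 n) x →L[ℝ] ℝ) h g.contMDiff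

/-- The conformal class `[g]`. -/
def conformalClass {n : ℕ} {M : Type*} [TopologicalSpace M]
    [ChartedSpace (EuclideanSpace ℝ (Fin n)) M] [IsManifold (𝓡 n) ∞ M] (g : Metric n M) :
    Set (Metric n M) :=
  {h | ∃ (w : M → ℝ) (hw : ContMDiff (𝓡 n) 𝓘(ℝ, ℝ) ∞ w) (hpos : ∀ x, 0 < w x),
    h = conformal g w hw hpos}

end Yamabe

end

set_option linter.unusedSectionVars false

noncomputable section

namespace Yamabe

/-! ### Christoffel symbols and curvature of matrix fields on open subsets of ℝⁿ. -/

section Euclidean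

variable {n : ℕ}

/-! ### Partial derivatives -/

/-! Everything rests on one map, multiplication by `w`. It carries `H¹₊(M, g_w)` bijectively and
monotonically onto `H¹₊(M, g)`, and it preserves both the critical norm (`critNorm_conformal`) and
the energy (`form_conformal`). It therefore matches the two obstacle problems, their solutions, the
functionals `I` and their sets of values. So the obstacle problem has to be solved only for `g`
itself, where the Yamabe invariant is assumed positive.

For `g`, positivity of the invariant makes the energy coercive (`exists_coercive`). On positive
functions the critical norm is bounded by the energy, and Hölder's inequality on the finite measure
bounds the L² norm. Replacing `u` by `√(u² + δ)` and letting `δ → 0` extends the L² bound to all of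
H¹, and boundedness of the scalar curvature then controls the gradient as well. The direct method
applies: by the parallelogram identity and convexity of the admissible set, a minimizing sequence is
Cauchy in H¹ (`form_sub_self_le`). H¹ is complete (`exists_limit`), almost everywhere limits stay
above the obstacle, and the same inequality gives uniqueness. The Sobolev embedding is never used: a
function of `H¹₊` outside `L^{2*}` would have `critNorm` zero by convention, hence a zero Yamabe
quotient, which positivity of the invariant forbids (`critNorm_pos`).

Invariance of the energy combines two facts. Pointwise, `|∇(wu)|² = w²|∇u|² + ⟨∇w, ∇(wu²)⟩`. The
curvature law (`MetricField.yamabe_equation`), with `a = 4(n-1)/(n-2)`, reads `w^{4/(n-2)} R_{g_w} w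
= R_g w - a Δ_g w`. Hence the two energy densities differ by `a` times the divergence of `w u² ∇w`,
whose integral vanishes (`integral_divergence`). As `u` is only in H¹, this needs a chain rule for
weak derivatives, obtained by mollification, and an extension of it to squares.

The curvature law is proved in coordinates, where the Levi-Civita connection is characterized as the
unique symmetric connection compatible with the metric. That characterization yields its behaviour
under a change of chart, so that the scalar curvature is a well-defined continuous function, as well
as under a conformal change. -/

theorem pderiv_congr {i : Fin n} {f g : EuclideanSpace ℝ (Fin n) → ℝ}
    {y : EuclideanSpace ℝ (Fin n)} (h : f =ᶠ[nhds y] g) : pderiv i f y = pderiv i g y := by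
  rw [pderiv, pderiv, h.fderiv_eq]

theorem pderiv_add {i : Fin n} {f g : EuclideanSpace ℝ (Fin n) → ℝ}
    {y : EuclideanSpace ℝ (Fin n)} (hf : DifferentiableAt ℝ f y) (hg : DifferentiableAt ℝ g y) :
    pderiv i (fun z => f z + g z) y = pderiv i f y + pderiv i g y := by
  simp [pderiv, fderiv_fun_add hf hg]

theorem pderiv_sub {i : Fin n} {f g : EuclideanSpace ℝ (Fin n) → ℝ}
    {y : EuclideanSpace ℝ (Fin n)} (hf : DifferentiableAt ℝ f y) (hg : DifferentiableAt ℝ g y) :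
    pderiv i (fun z => f z - g z) y = pderiv i f y - pderiv i g y := by
  simp [pderiv, fderiv_fun_sub hf hg]

theorem pderiv_mul {i : Fin n} {f g : EuclideanSpace ℝ (Fin n) → ℝ}
    {y : EuclideanSpace ℝ (Fin n)} (hf : DifferentiableAt ℝ f y) (hg : DifferentiableAt ℝ g y) :
    pderiv i (fun z => f z * g z) y = pderiv i f y * g y + f y * pderiv i g y := by
  simp [pderiv, fderiv_fun_mul hf hg]; ring

theorem pderiv_sum {ι : Type*} {s : Finset ι} {i : Fin n} {f : ι → EuclideanSpace ℝ (Fin n) → ℝ}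
    {y : EuclideanSpace ℝ (Fin n)} (hf : ∀ a ∈ s, DifferentiableAt ℝ (f a) y) :
    pderiv i (fun z => ∑ a ∈ s, f a z) y = ∑ a ∈ s, pderiv i (f a) y := by
  simp [pderiv, fderiv_fun_sum hf]

theorem pderiv_const (i : Fin n) (r : ℝ) (y : EuclideanSpace ℝ (Fin n)) :
    pderiv i (fun _ => r) y = 0 := by
  simp [pderiv]

theorem pderiv_scalar_comp {i : Fin n} {F : ℝ → ℝ} {F' : ℝ} {f : EuclideanSpace ℝ (Fin n) → ℝ}
    {y : EuclideanSpace ℝ (Fin n)} (hF : HasDerivAt F F' (f y)) (hf : DifferentiableAt ℝ f y) :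
    pderiv i (fun z => F (f z)) y = F' * pderiv i f y := by
  have := hF.comp_hasFDerivAt y hf.hasFDerivAt
  rw [pderiv, show (fun z => F (f z)) = F ∘ f from rfl, this.fderiv]
  simp [pderiv]

theorem fderiv_apply_eq_sum_pderiv (f : EuclideanSpace ℝ (Fin n) → ℝ)
    (y v : EuclideanSpace ℝ (Fin n)) : fderiv ℝ f y v = ∑ p, v p * pderiv p f y := by
  conv_lhs => rw [← (EuclideanSpace.basisFun (Fin n) ℝ).sum_repr v]
  simp [pderiv]

theorem pderiv_comp {i : Fin n} {f : EuclideanSpace ℝ (Fin n) → ℝ}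
    {φ : EuclideanSpace ℝ (Fin n) → EuclideanSpace ℝ (Fin n)}
    {y : EuclideanSpace ℝ (Fin n)} (hf : DifferentiableAt ℝ f (φ y)) (hφ : DifferentiableAt ℝ φ y) :
    pderiv i (fun z => f (φ z)) y = ∑ p, pderiv i (fun z => φ z p) y * pderiv p f (φ y) := by
  rw [pderiv, show (fun z => f (φ z)) = f ∘ φ from rfl, fderiv_comp y hf hφ]
  simp only [ContinuousLinearMap.comp_apply, fderiv_apply_eq_sum_pderiv f]
  refine Finset.sum_congr rfl fun p _ => ?_
  congr 1
  have : HasFDerivAt (fun z => φ z p) ((EuclideanSpace.proj p).comp (fderiv ℝ φ y)) y :=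
    (EuclideanSpace.proj (𝕜 := ℝ) p).hasFDerivAt.comp y hφ.hasFDerivAt
  rw [pderiv, this.fderiv]
  rfl

theorem contDiffOn_pderiv {i : Fin n} {f : EuclideanSpace ℝ (Fin n) → ℝ}
    {U : Set (EuclideanSpace ℝ (Fin n))} (hU : IsOpen U) (hf : ContDiffOn ℝ ∞ f U) :
    ContDiffOn ℝ ∞ (pderiv i f) U :=
  (hf.fderiv_of_isOpen hU (by simp)).clm_apply contDiffOn_const

theorem pderiv_comm {i j : Fin n} {f : EuclideanSpace ℝ (Fin n) → ℝ}
    {y : EuclideanSpace ℝ (Fin n)} (hf : ContDiffAt ℝ ∞ f y) :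
    pderiv i (pderiv j f) y = pderiv j (pderiv i f) y := by
  have h1 : DifferentiableAt ℝ (fderiv ℝ f) y :=
    (hf.fderiv_right (m := ∞) (by simp)).differentiableAt (by simp)
  have h2 : IsSymmSndFDerivAt ℝ f y := hf.isSymmSndFDerivAt (by
    rw [minSmoothness_of_isRCLikeNormedField]; exact WithTop.coe_le_coe.2 le_top)
  have key : ∀ a b : Fin n, pderiv a (pderiv b f) y =
      fderiv ℝ (fderiv ℝ f) y (EuclideanSpace.single a 1) (EuclideanSpace.single b 1) := by
    intro a b
    have := (h1.hasFDerivAt.clm_apply (hasFDerivAt_const (EuclideanSpace.single b (1 : ℝ)) y))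
    rw [pderiv, show pderiv b f = fun z => fderiv ℝ f z (EuclideanSpace.single b 1) from rfl,
      this.fderiv]
    simp
  rw [key, key, h2.eq]

/-! ### Smooth fields of matrices -/

/-- The partial derivative of a field of matrices. -/
def mderiv (i : Fin n) (A : EuclideanSpace ℝ (Fin n) → Matrix (Fin n) (Fin n) ℝ)
    (y : EuclideanSpace ℝ (Fin n)) : Matrix (Fin n) (Fin n) ℝ :=
  Matrix.of fun a b => pderiv i (fun z => A z a b) y

/-- A field of matrices with smooth entries. -/
def SmoothMat (A : EuclideanSpace ℝ (Fin n) → Matrix (Fin n) (Fin n) ℝ)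
    (U : Set (EuclideanSpace ℝ (Fin n))) : Prop :=
  ∀ a b, ContDiffOn ℝ ∞ (fun z => A z a b) U

variable {A B : EuclideanSpace ℝ (Fin n) → Matrix (Fin n) (Fin n) ℝ}
  {U : Set (EuclideanSpace ℝ (Fin n))} {y : EuclideanSpace ℝ (Fin n)}

theorem _root_.ContDiffOn.differentiableAt_of_isOpen {f : EuclideanSpace ℝ (Fin n) → ℝ}
    (hf : ContDiffOn ℝ ∞ f U) (hU : IsOpen U) (hy : y ∈ U) : DifferentiableAt ℝ f y :=
  (hf.contDiffAt (hU.mem_nhds hy)).differentiableAt (by simp)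

theorem SmoothMat.mul (hA : SmoothMat A U) (hB : SmoothMat B U) :
    SmoothMat (fun z => A z * B z) U := fun a b => by
  simp only [Matrix.mul_apply]
  exact ContDiffOn.sum fun k _ => (hA a k).mul (hB k b)

theorem SmoothMat.mderiv (hA : SmoothMat A U) (hU : IsOpen U) (i : Fin n) :
    SmoothMat (mderiv i A) U := fun a b => contDiffOn_pderiv hU (hA a b)

theorem SmoothMat.det (hA : SmoothMat A U) : ContDiffOn ℝ ∞ (fun z => (A z).det) U := by
  simp only [Matrix.det_apply]
  exact ContDiffOn.sum fun σ _ => (contDiffOn_prod fun i _ => hA _ _).const_smul _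

/-- Cramer's rule: each entry of the adjugate is the determinant of a matrix with one row replaced
by a constant, hence smooth. -/
theorem SmoothMat.inv (hA : SmoothMat A U) (hdet : ∀ z ∈ U, (A z).det ≠ 0) :
    SmoothMat (fun z => (A z)⁻¹) U := fun a b => by
  have h : SmoothMat (fun z => (A z).updateRow b (Pi.single a 1)) U := fun i j => by
    by_cases hi : i = b
    · subst hi; simpa using contDiffOn_const
    · simpa [Matrix.updateRow_ne hi] using hA i j
  refine (((hA.det).inv hdet).mul h.det).congr fun z hz => ?_
  change (A z)⁻¹ a b = (A z).det⁻¹ * _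
  rw [Matrix.inv_def, Matrix.smul_apply, Matrix.adjugate_apply, Ring.inverse_eq_inv', smul_eq_mul]

theorem mderiv_mul (hA : SmoothMat A U) (hB : SmoothMat B U) (hU : IsOpen U) (hy : y ∈ U)
    (i : Fin n) : mderiv i (fun z => A z * B z) y = mderiv i A y * B y + A y * mderiv i B y := by
  ext a b
  simp only [mderiv, Matrix.mul_apply, Matrix.add_apply, Matrix.of_apply]
  rw [pderiv_sum fun k _ => ((hA a k).differentiableAt_of_isOpen hU hy).fun_mul
    ((hB k b).differentiableAt_of_isOpen hU hy), ← Finset.sum_add_distrib]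
  exact Finset.sum_congr rfl fun k _ => pderiv_mul ((hA a k).differentiableAt_of_isOpen hU hy)
    ((hB k b).differentiableAt_of_isOpen hU hy)

theorem mderiv_add (hA : SmoothMat A U) (hB : SmoothMat B U) (hU : IsOpen U) (hy : y ∈ U)
    (i : Fin n) : mderiv i (fun z => A z + B z) y = mderiv i A y + mderiv i B y := by
  ext a b
  exact pderiv_add ((hA a b).differentiableAt_of_isOpen hU hy)
    ((hB a b).differentiableAt_of_isOpen hU hy)

theorem mderiv_congr {i : Fin n} (hU : IsOpen U) (hy : y ∈ U) (h : ∀ z ∈ U, A z = B z) :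
    mderiv i A y = mderiv i B y := by
  ext a b
  refine pderiv_congr ?_
  filter_upwards [hU.mem_nhds hy] with z hz
  rw [h z hz]

theorem mderiv_transpose (i : Fin n) : mderiv i (fun z => (A z).transpose) y
    = (mderiv i A y).transpose := rfl

/-! ### The curvature of a smooth field of symmetric matrices -/

/-- The Christoffel symbols of a field of matrices. -/
def chr (G : EuclideanSpace ℝ (Fin n) → Matrix (Fin n) (Fin n) ℝ) (k i j : Fin n)
    (y : EuclideanSpace ℝ (Fin n)) : ℝ :=
  (1 / 2) * ∑ l, (G y)⁻¹ k l *
    (pderiv i (fun z => G z j l) y + pderiv j (fun z => G z i l) y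
      - pderiv l (fun z => G z i j) y)

/-- The Ricci tensor of a field of matrices. -/
def ric (G : EuclideanSpace ℝ (Fin n) → Matrix (Fin n) (Fin n) ℝ) (j k : Fin n)
    (y : EuclideanSpace ℝ (Fin n)) : ℝ :=
  ∑ i, (pderiv i (chr G i j k) y - pderiv j (chr G i i k) y
    + ∑ p, (chr G i i p y * chr G p j k y - chr G i j p y * chr G p i k y))

/-- The scalar curvature of a field of matrices. -/
def scal (G : EuclideanSpace ℝ (Fin n) → Matrix (Fin n) (Fin n) ℝ)
    (y : EuclideanSpace ℝ (Fin n)) : ℝ := ∑ j, ∑ k, (G y)⁻¹ j k * ric G j k y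

/-- The connection matrices `(Γᵢ)ₖⱼ = Γᵏᵢⱼ`. -/
def conn (G : EuclideanSpace ℝ (Fin n) → Matrix (Fin n) (Fin n) ℝ) (i : Fin n)
    (y : EuclideanSpace ℝ (Fin n)) : Matrix (Fin n) (Fin n) ℝ :=
  Matrix.of fun k j => chr G k i j y

/-- The curvature matrices of a family of connection matrices. -/
def curv (C : Fin n → EuclideanSpace ℝ (Fin n) → Matrix (Fin n) (Fin n) ℝ) (i j : Fin n)
    (y : EuclideanSpace ℝ (Fin n)) : Matrix (Fin n) (Fin n) ℝ :=
  mderiv i (C j) y - mderiv j (C i) y + (C i y * C j y - C j y * C i y)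

/-- A smooth field of invertible symmetric matrices on an open set. -/
structure MetricField (G : EuclideanSpace ℝ (Fin n) → Matrix (Fin n) (Fin n) ℝ)
    (U : Set (EuclideanSpace ℝ (Fin n))) : Prop where
  isOpen : IsOpen U
  smooth : SmoothMat G U
  symm : ∀ z ∈ U, (G z).IsSymm
  det_ne : ∀ z ∈ U, (G z).det ≠ 0

variable {G : EuclideanSpace ℝ (Fin n) → Matrix (Fin n) (Fin n) ℝ}

/-- Writing Ricci as a contraction of commutator-type curvature matrices lets the change of
coordinates be treated as a gauge transformation of matrices. -/
theorem ric_eq_sum_curv (j k : Fin n) : ric G j k y = ∑ i, curv (conn G) i j y i k := by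
  simp [ric, curv, conn, mderiv, Matrix.mul_apply, Finset.sum_sub_distrib]

theorem MetricField.isUnit_det (hG : MetricField G U) (hy : y ∈ U) : IsUnit (G y).det :=
  isUnit_iff_ne_zero.2 (hG.det_ne y hy)

theorem MetricField.mderiv_symm (hG : MetricField G U) (hy : y ∈ U) (l a b : Fin n) :
    mderiv l G y a b = mderiv l G y b a := by
  refine pderiv_congr ?_
  filter_upwards [hG.isOpen.mem_nhds hy] with z hz
  exact (hG.symm z hz).apply b a

theorem MetricField.conn_comm (hG : MetricField G U) (hy : y ∈ U) (k i j : Fin n) :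
    conn G i y k j = conn G j y k i := by
  simp only [conn, chr, Matrix.of_apply]
  congr 1
  refine Finset.sum_congr rfl fun l _ => ?_
  have := hG.mderiv_symm hy l i j
  simp only [mderiv, Matrix.of_apply] at this
  rw [this]; ring

theorem conn_eq_inv_mul (i : Fin n) : conn G i y = (G y)⁻¹ * Matrix.of fun l j =>
    (1 / 2) * (mderiv i G y j l + mderiv j G y i l - mderiv l G y i j) := by
  ext k j
  simp only [conn, chr, Matrix.of_apply, Matrix.mul_apply, mderiv, Finset.mul_sum]
  exact Finset.sum_congr rfl fun l _ => by ring

theorem MetricField.mul_conn (hG : MetricField G U) (hy : y ∈ U) (i l j : Fin n) :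
    (G y * conn G i y) l j =
      (1 / 2) * (mderiv i G y j l + mderiv j G y i l - mderiv l G y i j) := by
  rw [conn_eq_inv_mul, ← mul_assoc, Matrix.mul_nonsing_inv _ (hG.isUnit_det hy), one_mul]
  rfl

/-- The Levi-Civita connection is compatible with the metric. -/
theorem MetricField.mderiv_eq (hG : MetricField G U) (hy : y ∈ U) (i : Fin n) :
    mderiv i G y = (conn G i y).transpose * G y + G y * conn G i y := by
  have h : (conn G i y).transpose * G y = (G y * conn G i y).transpose := by
    rw [Matrix.transpose_mul, (hG.symm y hy).eq]
  rw [h]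
  ext a b
  rw [Matrix.add_apply, Matrix.transpose_apply, hG.mul_conn hy, hG.mul_conn hy,
    hG.mderiv_symm hy i b a]
  ring

/-- The Levi-Civita connection is the only one that is symmetric and compatible with the metric. -/
theorem MetricField.conn_unique (hG : MetricField G U) (hy : y ∈ U)
    (C : Fin n → Matrix (Fin n) (Fin n) ℝ) (hC : ∀ k i j, C i k j = C j k i)
    (hD : ∀ i, mderiv i G y = (C i).transpose * G y + G y * C i) (i : Fin n) : conn G i y = C i := by
  have hs : ∀ i l j, (G y * C i) l j = (G y * C j) l i := fun i l j => by
    simp only [Matrix.mul_apply, hC _ i j]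
  have hD' : ∀ i a b, mderiv i G y a b = (G y * C i) b a + (G y * C i) a b := fun i a b => by
    have h : (C i).transpose * G y = (G y * C i).transpose := by
      rw [Matrix.transpose_mul, (hG.symm y hy).eq]
    rw [hD, h]; rfl
  -- Koszul's argument: in the alternating combination of the three derivatives of the metric, the
  -- symmetry `hs` cancels every term except `(G * C i) l j`.
  have : G y * conn G i y = G y * C i := by
    ext l j
    rw [hG.mul_conn hy, hD', hD', hD', hs j l i, hs l i j, hs i j l, hs l j i]
    ring
  calc conn G i y = (G y)⁻¹ * (G y * conn G i y) := by
        rw [← mul_assoc, Matrix.nonsing_inv_mul _ (hG.isUnit_det hy), one_mul]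
    _ = C i := by rw [this, ← mul_assoc, Matrix.nonsing_inv_mul _ (hG.isUnit_det hy), one_mul]

theorem MetricField.smooth_inv (hG : MetricField G U) : SmoothMat (fun z => (G z)⁻¹) U :=
  hG.smooth.inv hG.det_ne

theorem MetricField.smooth_conn (hG : MetricField G U) (i : Fin n) : SmoothMat (conn G i) U := by
  have : conn G i = fun y => (G y)⁻¹ * Matrix.of fun l j =>
      (1 / 2) * (mderiv i G y j l + mderiv j G y i l - mderiv l G y i j) := by
    ext1 y; exact conn_eq_inv_mul i
  rw [this]
  refine hG.smooth_inv.mul fun l j => ?_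
  exact contDiffOn_const.mul (((hG.smooth.mderiv hG.isOpen i j l).add
    (hG.smooth.mderiv hG.isOpen j i l)).sub (hG.smooth.mderiv hG.isOpen l i j))

theorem MetricField.contDiffOn_ric (hG : MetricField G U) (j k : Fin n) :
    ContDiffOn ℝ ∞ (ric G j k) U := by
  have h := fun i => hG.smooth_conn i
  unfold ric
  refine ContDiffOn.sum fun i _ => ((contDiffOn_pderiv hG.isOpen (h j i k)).sub
    (contDiffOn_pderiv hG.isOpen (h i i k))).add (ContDiffOn.sum fun p _ => ?_)
  exact ((h i i p).mul (h j p k)).sub ((h j i p).mul (h i p k))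

theorem MetricField.contDiffOn_scal (hG : MetricField G U) : ContDiffOn ℝ ∞ (scal G) U := by
  unfold scal
  exact ContDiffOn.sum fun j _ => ContDiffOn.sum fun k _ =>
    (hG.smooth_inv j k).mul (hG.contDiffOn_ric j k)

end Euclidean

/-! ### Invariance of the scalar curvature under changes of coordinates. -/

section ChangeOfCoordinates

variable {n : ℕ} {G G' : EuclideanSpace ℝ (Fin n) → Matrix (Fin n) (Fin n) ℝ}
  {U W : Set (EuclideanSpace ℝ (Fin n))} {y : EuclideanSpace ℝ (Fin n)}

/-- The Jacobian matrix. -/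
def jac (φ : EuclideanSpace ℝ (Fin n) → EuclideanSpace ℝ (Fin n)) (y : EuclideanSpace ℝ (Fin n)) :
    Matrix (Fin n) (Fin n) ℝ := Matrix.of fun p i => pderiv i (fun z => φ z p) y

/-- The field of matrices `G'` is the pullback of `G` under the smooth map `φ`. -/
structure IsPullback (φ : EuclideanSpace ℝ (Fin n) → EuclideanSpace ℝ (Fin n))
    (G' G : EuclideanSpace ℝ (Fin n) → Matrix (Fin n) (Fin n) ℝ)
    (W U : Set (EuclideanSpace ℝ (Fin n))) : Prop where
  source : MetricField G' W
  target : MetricField G U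
  contDiffOn : ContDiffOn ℝ ∞ φ W
  mapsTo : Set.MapsTo φ W U
  eq : ∀ z ∈ W, G' z = (jac φ z).transpose * G (φ z) * jac φ z

variable {φ : EuclideanSpace ℝ (Fin n) → EuclideanSpace ℝ (Fin n)}

namespace IsPullback

theorem contDiffOn_apply (h : IsPullback φ G' G W U) (p : Fin n) :
    ContDiffOn ℝ ∞ (fun z => φ z p) W :=
  (EuclideanSpace.proj (𝕜 := ℝ) p).contDiff.comp_contDiffOn h.contDiffOn

theorem smooth_jac (h : IsPullback φ G' G W U) : SmoothMat (jac φ) W := fun p _ =>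
  contDiffOn_pderiv h.source.isOpen (h.contDiffOn_apply p)

theorem smooth_comp (h : IsPullback φ G' G W U)
    {A : EuclideanSpace ℝ (Fin n) → Matrix (Fin n) (Fin n) ℝ} (hA : SmoothMat A U) :
    SmoothMat (fun z => A (φ z)) W := fun a b => (hA a b).comp h.contDiffOn h.mapsTo

theorem isUnit_det_jac (h : IsPullback φ G' G W U) (hy : y ∈ W) : IsUnit (jac φ y).det := by
  have := h.source.det_ne y hy
  rw [h.eq y hy, Matrix.det_mul] at this
  exact isUnit_iff_ne_zero.2 (right_ne_zero_of_mul this)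

theorem mderiv_comp (h : IsPullback φ G' G W U) (hy : y ∈ W)
    {A : EuclideanSpace ℝ (Fin n) → Matrix (Fin n) (Fin n) ℝ} (hA : SmoothMat A U) (i : Fin n) :
    mderiv i (fun z => A (φ z)) y = ∑ p, jac φ y p i • mderiv p A (φ y) := by
  ext a b
  simp only [mderiv, Matrix.of_apply, Matrix.sum_apply, Matrix.smul_apply, smul_eq_mul, jac]
  exact pderiv_comp ((hA a b).differentiableAt_of_isOpen h.target.isOpen (h.mapsTo hy))
    ((h.contDiffOn.contDiffAt (h.source.isOpen.mem_nhds hy)).differentiableAt (by simp))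

theorem mderiv_jac_comm (h : IsPullback φ G' G W U) (hy : y ∈ W) (i j p : Fin n) :
    mderiv i (jac φ) y p j = mderiv j (jac φ) y p i :=
  pderiv_comm ((h.contDiffOn_apply p).contDiffAt (h.source.isOpen.mem_nhds hy))

/-- The pullback of the connection matrices of `G`. -/
def pullConn (φ : EuclideanSpace ℝ (Fin n) → EuclideanSpace ℝ (Fin n))
    (G : EuclideanSpace ℝ (Fin n) → Matrix (Fin n) (Fin n) ℝ) (i : Fin n)
    (y : EuclideanSpace ℝ (Fin n)) : Matrix (Fin n) (Fin n) ℝ :=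
  ∑ p, jac φ y p i • conn G p (φ y)

theorem smooth_pullConn (h : IsPullback φ G' G W U) (i : Fin n) :
    SmoothMat (pullConn φ G i) W := fun a b => by
  simp only [pullConn, Matrix.sum_apply, Matrix.smul_apply, smul_eq_mul]
  exact ContDiffOn.sum fun p _ => (h.smooth_jac p i).mul
    (h.smooth_comp (h.target.smooth_conn p) a b)

/-- The gauge law of the connection. Solved for `conn G'`, the right side is symmetric, because
second derivatives of `φ` commute and `G` has a symmetric connection. It is compatible with `G'`, by
differentiating `G' = Aᵀ G A`. Uniqueness of the Levi-Civita connection concludes. -/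
theorem mul_conn (h : IsPullback φ G' G W U) (hy : y ∈ W) (i : Fin n) :
    jac φ y * conn G' i y = pullConn φ G i y * jac φ y + mderiv i (jac φ) y := by
  have hA := h.isUnit_det_jac hy
  have key : conn G' i y =
      (jac φ y)⁻¹ * (pullConn φ G i y * jac φ y + mderiv i (jac φ) y) := by
    refine h.source.conn_unique hy
      (fun i => (jac φ y)⁻¹ * (pullConn φ G i y * jac φ y + mderiv i (jac φ) y)) ?_ ?_ i
    · intro k i j
      simp only [Matrix.mul_apply (M := (jac φ y)⁻¹)]
      refine Finset.sum_congr rfl fun p _ => ?_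
      congr 1
      rw [Matrix.add_apply, Matrix.add_apply, h.mderiv_jac_comm hy i j p]
      congr 1
      simp only [pullConn, Matrix.mul_apply, Matrix.sum_apply, Matrix.smul_apply, smul_eq_mul,
        Finset.sum_mul]
      rw [Finset.sum_comm]
      refine Finset.sum_congr rfl fun a _ => Finset.sum_congr rfl fun b _ => ?_
      rw [h.target.conn_comm (h.mapsTo hy) p b a]
      ring
    · intro i
      have hsym := (h.target.symm _ (h.mapsTo hy)).eq
      have hG' : G' y * ((jac φ y)⁻¹ * (pullConn φ G i y * jac φ y + mderiv i (jac φ) y)) =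
          (jac φ y).transpose * G (φ y) * (pullConn φ G i y * jac φ y + mderiv i (jac φ) y) := by
        rw [h.eq y hy, mul_assoc, ← mul_assoc (jac φ y), Matrix.mul_nonsing_inv _ hA, one_mul]
      have hT : ((jac φ y)⁻¹ * (pullConn φ G i y * jac φ y + mderiv i (jac φ) y)).transpose * G' y
          = (G' y * ((jac φ y)⁻¹ * (pullConn φ G i y * jac φ y
              + mderiv i (jac φ) y))).transpose := by
        rw [Matrix.transpose_mul (G' y), (h.source.symm y hy).eq]
      have hpull : mderiv i (fun z => G (φ z)) y =
          (pullConn φ G i y).transpose * G (φ y) + G (φ y) * pullConn φ G i y := by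
        rw [h.mderiv_comp hy h.target.smooth]
        simp only [pullConn, Matrix.transpose_sum, Finset.sum_mul, Finset.mul_sum,
          Matrix.transpose_smul, ← Finset.sum_add_distrib]
        refine Finset.sum_congr rfl fun p _ => ?_
        rw [h.target.mderiv_eq (h.mapsTo hy), smul_add, Matrix.smul_mul, Matrix.mul_smul]
      have hjT : SmoothMat (fun z => (jac φ z).transpose) W := fun a b => h.smooth_jac b a
      rw [hT, hG', mderiv_congr h.source.isOpen hy h.eq,
        mderiv_mul (hjT.mul (h.smooth_comp h.target.smooth)) h.smooth_jac h.source.isOpen hy,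
        mderiv_mul hjT (h.smooth_comp h.target.smooth) h.source.isOpen hy, hpull,
        mderiv_transpose]
      simp only [Matrix.transpose_mul, Matrix.transpose_add, Matrix.transpose_transpose, hsym]
      noncomm_ring
  rw [key, ← mul_assoc, Matrix.mul_nonsing_inv _ hA, one_mul]

theorem mderiv_pullConn (h : IsPullback φ G' G W U) (hy : y ∈ W) (i j : Fin n) :
    mderiv i (pullConn φ G j) y = ∑ q, mderiv i (jac φ) y q j • conn G q (φ y) +
      ∑ q, ∑ p, (jac φ y p i * jac φ y q j) • mderiv p (conn G q) (φ y) := by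
  ext a b
  have hd := fun q => (h.smooth_jac q j).differentiableAt_of_isOpen h.source.isOpen hy
  have hd' := fun q => (h.smooth_comp (h.target.smooth_conn q) a b).differentiableAt_of_isOpen
    h.source.isOpen hy
  have h1 : mderiv i (pullConn φ G j) y a b =
      ∑ q, pderiv i (fun z => jac φ z q j * conn G q (φ z) a b) y := by
    simp only [mderiv, Matrix.of_apply, pullConn, Matrix.sum_apply, Matrix.smul_apply, smul_eq_mul]
    exact pderiv_sum fun q _ => (hd q).fun_mul (hd' q)
  rw [h1, Matrix.add_apply, Matrix.sum_apply, Matrix.sum_apply, ← Finset.sum_add_distrib]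
  refine Finset.sum_congr rfl fun q _ => ?_
  rw [pderiv_mul (hd q) (hd' q)]
  have h2 : pderiv i (fun z => conn G q (φ z) a b) y =
      mderiv i (fun z => conn G q (φ z)) y a b := rfl
  rw [h2, h.mderiv_comp hy (h.target.smooth_conn q)]
  simp only [Matrix.sum_apply, Matrix.smul_apply, smul_eq_mul, Finset.mul_sum]
  congr 1
  exact Finset.sum_congr rfl fun p _ => by ring

/-- The terms in which a derivative falls on the Jacobian are symmetric in `i` and `j`, since they
are second derivatives of `φ`, and they cancel in the curvature. -/
theorem curv_pullConn (h : IsPullback φ G' G W U) (hy : y ∈ W) (i j : Fin n) :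
    curv (pullConn φ G) i j y =
      ∑ q, ∑ p, (jac φ y p i * jac φ y q j) • curv (conn G) p q (φ y) := by
  have h1 : ∑ q, ∑ p, (jac φ y p j * jac φ y q i) • mderiv p (conn G q) (φ y) =
      ∑ q, ∑ p, (jac φ y p i * jac φ y q j) • mderiv q (conn G p) (φ y) := by
    rw [Finset.sum_comm]
    exact Finset.sum_congr rfl fun p _ => Finset.sum_congr rfl fun q _ => by rw [mul_comm]
  have h2 : pullConn φ G i y * pullConn φ G j y =
      ∑ q, ∑ p, (jac φ y p i * jac φ y q j) • (conn G p (φ y) * conn G q (φ y)) := by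
    simp only [pullConn, Finset.sum_mul, Finset.mul_sum, Matrix.smul_mul, Matrix.mul_smul,
      smul_smul]
    exact Finset.sum_congr rfl fun p _ => Finset.sum_congr rfl fun q _ => by rw [mul_comm]
  have h3 : pullConn φ G j y * pullConn φ G i y =
      ∑ q, ∑ p, (jac φ y p i * jac φ y q j) • (conn G q (φ y) * conn G p (φ y)) := by
    simp only [pullConn, Finset.sum_mul, Finset.mul_sum, Matrix.smul_mul, Matrix.mul_smul,
      smul_smul]
    rw [Finset.sum_comm]
  have h4 : ∑ q, mderiv j (jac φ) y q i • conn G q (φ y) =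
      ∑ q, mderiv i (jac φ) y q j • conn G q (φ y) :=
    Finset.sum_congr rfl fun q _ => by rw [h.mderiv_jac_comm hy]
  rw [curv, h.mderiv_pullConn hy, h.mderiv_pullConn hy, h1, h2, h3, h4]
  simp only [curv, smul_add, smul_sub, Finset.sum_add_distrib, Finset.sum_sub_distrib]
  abel

/-- The gauge law `mul_conn` is differentiated and antisymmetrized. The second derivatives of the
Jacobian drop out, and its first derivatives are eliminated by the gauge law itself. -/
theorem mul_curv (h : IsPullback φ G' G W U) (hy : y ∈ W) (i j : Fin n) :
    jac φ y * curv (conn G') i j y = curv (pullConn φ G) i j y * jac φ y := by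
  have hW := h.source.isOpen
  have hd : ∀ i j, mderiv i (jac φ) y * conn G' j y + jac φ y * mderiv i (conn G' j) y =
      mderiv i (pullConn φ G j) y * jac φ y + pullConn φ G j y * mderiv i (jac φ) y
        + mderiv i (mderiv j (jac φ)) y := fun i j => by
    rw [← mderiv_mul h.smooth_jac (h.source.smooth_conn j) hW hy,
      ← mderiv_mul (h.smooth_pullConn j) h.smooth_jac hW hy,
      ← mderiv_add ((h.smooth_pullConn j).mul h.smooth_jac) (h.smooth_jac.mderiv hW j) hW hy]
    exact mderiv_congr hW hy fun z hz => h.mul_conn hz j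
  have hcomm : mderiv j (mderiv i (jac φ)) y = mderiv i (mderiv j (jac φ)) y := by
    ext a b
    exact pderiv_comm ((h.smooth_jac a b).contDiffAt (hW.mem_nhds hy))
  have hji := hd j i
  rw [hcomm] at hji
  have hij := hd i j
  have e1 : ∀ i, mderiv i (jac φ) y = jac φ y * conn G' i y - pullConn φ G i y * jac φ y :=
    fun i => by rw [h.mul_conn hy]; abel
  have hsub := congrArg₂ (fun X Y => X - Y) hij hji
  simp only [e1] at hsub
  rw [curv, curv]
  rw [← sub_eq_zero] at hsub ⊢
  rw [← hsub]
  noncomm_ring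

/-- The inverse Jacobian coming from the conjugation in `mul_curv` is contracted, by the trace over
`i`, with the factor `jac φ y p i` of `curv_pullConn`; only the tensorial factors in `j` and `k`
survive. -/
theorem ric_eq (h : IsPullback φ G' G W U) (hy : y ∈ W) :
    (Matrix.of fun j k => ric G' j k y) =
      (jac φ y).transpose * (Matrix.of fun j k => ric G j k (φ y)) * jac φ y := by
  have hA := h.isUnit_det_jac hy
  ext j k
  have hc : ∀ i, curv (conn G') i j y = (jac φ y)⁻¹ * (∑ q, ∑ p,
      (jac φ y p i * jac φ y q j) • curv (conn G) p q (φ y)) * jac φ y := fun i => by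
    rw [← h.curv_pullConn hy, mul_assoc, ← h.mul_curv hy, ← mul_assoc,
      Matrix.nonsing_inv_mul _ hA, one_mul]
  have hone : ∀ p m, ∑ i, jac φ y p i * (jac φ y)⁻¹ i m = if p = m then 1 else 0 := fun p m => by
    rw [← Matrix.mul_apply, Matrix.mul_nonsing_inv _ hA, Matrix.one_apply]
  rw [Matrix.of_apply, ric_eq_sum_curv]
  simp only [hc, Matrix.mul_apply, Matrix.sum_apply, Matrix.smul_apply, smul_eq_mul,
    Matrix.transpose_apply, Matrix.of_apply, ric_eq_sum_curv, Finset.sum_mul, Finset.mul_sum]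
  rw [Finset.sum_comm]
  refine Finset.sum_congr rfl fun l _ => ?_
  have : ∀ i m q p : Fin n, (jac φ y)⁻¹ i m * (jac φ y p i * jac φ y q j
      * curv (conn G) p q (φ y) m l) * jac φ y l k = (jac φ y p i * (jac φ y)⁻¹ i m) *
        (jac φ y q j * curv (conn G) p q (φ y) m l * jac φ y l k) := fun i m q p => by ring
  simp only [this]
  calc _ = ∑ q, ∑ p, ∑ m, ∑ i, (jac φ y p i * (jac φ y)⁻¹ i m) *
        (jac φ y q j * curv (conn G) p q (φ y) m l * jac φ y l k) := by
        rw [Finset.sum_comm]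
        refine Finset.sum_congr rfl fun q _ => ?_
        rw [Finset.sum_comm]
        exact Finset.sum_congr rfl fun p _ => Finset.sum_comm
    _ = _ := by
        simp only [← Finset.sum_mul, hone, ite_mul, one_mul, zero_mul, Finset.sum_ite_eq,
          Finset.mem_univ, if_true]

theorem scal_eq (h : IsPullback φ G' G W U) (hy : y ∈ W) : scal G' y = scal G (φ y) := by
  have hA := h.isUnit_det_jac hy
  have htr : ∀ (H : EuclideanSpace ℝ (Fin n) → Matrix (Fin n) (Fin n) ℝ) (z),
      scal H z = ((H z)⁻¹.transpose * Matrix.of fun j k => ric H j k z).trace := fun H z => by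
    simp only [scal, Matrix.trace, Matrix.diag, Matrix.mul_apply, Matrix.transpose_apply,
      Matrix.of_apply]
    exact Finset.sum_comm
  have hAT : IsUnit (jac φ y).transpose.det := by rwa [Matrix.det_transpose]
  rw [htr, htr, h.ric_eq hy, h.eq y hy, Matrix.mul_inv_rev, Matrix.mul_inv_rev]
  simp only [Matrix.transpose_mul, Matrix.transpose_nonsing_inv, Matrix.transpose_transpose]
  rw [Matrix.trace_mul_comm]
  have : (jac φ y).transpose * (Matrix.of fun j k => ric G j k (φ y)) * jac φ y *
      ((jac φ y)⁻¹ * (G (φ y)).transpose⁻¹ * (jac φ y).transpose⁻¹) =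
      (jac φ y).transpose * ((Matrix.of fun j k => ric G j k (φ y)) *
        (G (φ y)).transpose⁻¹ * (jac φ y).transpose⁻¹) := by
    simp only [mul_assoc]
    rw [← mul_assoc (jac φ y), Matrix.mul_nonsing_inv _ hA, one_mul]
  rw [this, Matrix.trace_mul_comm, mul_assoc, Matrix.nonsing_inv_mul _ hAT, mul_one,
    Matrix.trace_mul_comm]

end IsPullback

end ChangeOfCoordinates

/-! ### Scalar curvature of conformal metrics in coordinates. -/

section ConformalChange

variable {n : ℕ}

/-- The second factor has the shape of the difference of two conformal Levi-Civita connections; most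
contractions in `ricci_conformal_algebra` reduce to this one. -/
theorem sum_delta_conn_mul (Γ : Fin n → Fin n → ℝ) (f F : Fin n → ℝ)
    (g : Fin n → Fin n → ℝ) (j k : Fin n) (i : Fin n) :
    ∑ p, Γ i p * ((if p = j then f k else 0) + (if p = k then f j else 0) - g j k * F p) =
      Γ i j * f k + Γ i k * f j - g j k * ∑ p, Γ i p * F p := by
  simp only [mul_sub, mul_add, Finset.sum_sub_distrib, Finset.sum_add_distrib, mul_ite, mul_zero,
    Finset.sum_ite_eq', Finset.mem_univ, if_true, Finset.mul_sum]
  congr 1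
  exact Finset.sum_congr rfl fun p _ => by ring

/-- The algebra behind the conformal change of the Ricci tensor at a point: `Γ i k j = Γᵏᵢⱼ`,
`f` is a covector with derivative `df`, `F` is the vector dual to `f`, with derivative `dF`, and `dg`
is the derivative of the metric. -/
theorem ricci_conformal_algebra (Γ dg : Fin n → Fin n → Fin n → ℝ) (g df dF : Fin n → Fin n → ℝ)
    (f F : Fin n → ℝ) (hΓ : ∀ k i j, Γ i k j = Γ j k i) (hg : ∀ i j, g i j = g j i)
    (hdf : ∀ i j, df i j = df j i)
    (hdg : ∀ i j k, dg i j k = ∑ p, (Γ i p j * g p k + g j p * Γ i p k))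
    (hfF : ∀ k, f k = ∑ i, g i k * F i)
    (hdfF : ∀ j k, df j k = ∑ i, (dg j i k * F i + g i k * dF j i))
    (S : Fin n → Fin n → Fin n → ℝ) (dS : Fin n → Fin n → Fin n → Fin n → ℝ)
    (hS : ∀ i k j, S i k j = (if k = i then f j else 0) + (if k = j then f i else 0) - g i j * F k)
    (hdS : ∀ l i k j, dS l i k j = (if k = i then df l j else 0) + (if k = j then df l i else 0)
      - (dg l i j * F k + g i j * dF l k)) (j k : Fin n) :
    ∑ i, (dS i j i k - dS j i i k + ∑ p, (Γ i i p * S j p k + S i i p * Γ j p k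
      + S i i p * S j p k - Γ j i p * S i p k - S j i p * Γ i p k - S j i p * S i p k)) =
    (2 - (n : ℝ)) * df j k - g j k * (∑ i, dF i i + ∑ i, ∑ p, Γ i i p * F p)
      + ((n : ℝ) - 2) * ∑ p, f p * Γ j p k + ((n : ℝ) - 2) * (f j * f k)
      - ((n : ℝ) - 2) * (g j k * ∑ p, f p * F p) := by
  have ha : ∑ i, dS i j i k = 2 * df j k - ∑ i, dg i j k * F i - g j k * ∑ i, dF i i := by
    simp only [hdS, Finset.sum_sub_distrib, Finset.sum_add_distrib, Finset.sum_ite_eq',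
      Finset.mem_univ, if_true, Finset.mul_sum]
    rw [hdf k j]; ring
  have hb : ∑ i, dS j i i k = n * df j k := by
    simp only [hdS, Finset.sum_sub_distrib, if_true, ← hdfF]
    simp [Finset.sum_add_distrib]
  have hc : ∑ i, ∑ p, Γ i i p * S j p k = (∑ i, Γ i i j) * f k + (∑ i, Γ i i k) * f j
      - g j k * ∑ i, ∑ p, Γ i i p * F p := by
    simp only [hS, sum_delta_conn_mul, Finset.sum_sub_distrib, Finset.sum_add_distrib,
      Finset.sum_mul, Finset.mul_sum]
  have htr : ∀ p, ∑ i, S i i p = n * f p := fun p => by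
    simp only [hS, if_true, Finset.sum_sub_distrib, Finset.sum_add_distrib, ← hfF]
    simp
  have hd : ∑ i, ∑ p, S i i p * Γ j p k = n * ∑ p, f p * Γ j p k := by
    rw [Finset.sum_comm]
    simp only [← Finset.sum_mul, htr, Finset.mul_sum, mul_assoc]
  have hfS : ∑ p, f p * S j p k = 2 * (f j * f k) - g j k * ∑ p, f p * F p := by
    simp only [hS]
    rw [sum_delta_conn_mul (fun _ p => f p) f F g j k j]
    ring
  have he : ∑ i, ∑ p, S i i p * S j p k = n * (2 * (f j * f k) - g j k * ∑ p, f p * F p) := by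
    rw [Finset.sum_comm, ← hfS]
    simp only [← Finset.sum_mul, htr, Finset.mul_sum, mul_assoc]
  have hf : ∑ i, ∑ p, Γ j i p * S i p k = (∑ i, Γ i i j) * f k + ∑ p, f p * Γ j p k
      - ∑ i, ∑ p, Γ j i p * g i k * F p := by
    simp only [hS, sum_delta_conn_mul, Finset.sum_sub_distrib, Finset.sum_add_distrib,
      Finset.sum_mul, Finset.mul_sum]
    congr 1
    · congr 1
      · exact Finset.sum_congr rfl fun i _ => by rw [hΓ i j i]
      · exact Finset.sum_congr rfl fun i _ => by ring
    · exact Finset.sum_congr rfl fun i _ => Finset.sum_congr rfl fun p _ => by ring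
  -- `X` is left free because the identity serves twice, with `Γ` and with `S` in this place.
  have hSΓ : ∀ X : Fin n → Fin n → ℝ, ∑ i, ∑ p, S j i p * X i p =
      ∑ p, f p * X j p + f j * ∑ i, X i i - ∑ i, ∑ p, g j p * F i * X i p := fun X => by
    simp only [hS, sub_mul, add_mul, Finset.sum_sub_distrib, Finset.sum_add_distrib, ite_mul,
      zero_mul, Finset.sum_ite_eq, Finset.mem_univ, if_true, Finset.mul_sum]
    congr 2
    rw [Finset.sum_comm]
    simp
  have hg' : ∑ i, ∑ p, S j i p * Γ i p k = ∑ p, f p * Γ j p k + f j * ∑ i, Γ i i k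
      - ∑ i, ∑ p, g j p * F i * Γ i p k := hSΓ fun i p => Γ i p k
  have hgF : ∀ k, ∑ p, g k p * F p = f k := fun k => by
    rw [hfF]; exact Finset.sum_congr rfl fun i _ => by rw [hg k i]
  have hh : ∑ i, ∑ p, S j i p * S i p k = ((n : ℝ) + 2) * (f j * f k)
      - 2 * (g j k * ∑ p, f p * F p) := by
    rw [hSΓ fun i p => S i p k, hfS, htr k]
    have : ∑ i, ∑ p, g j p * F i * S i p k =
        g j k * ∑ p, f p * F p := by
      have h1 : ∀ i, ∑ p, g j p * F i * S i p k =
          g j i * F i * f k + g j k * (F i * f i) - g i k * F i * ∑ p, g j p * F p := fun i => by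
        simp only [hS]
        rw [sum_delta_conn_mul (fun _ p => g j p * F i) f F g i k i]
        simp only [Finset.mul_sum]
        congr 1
        · ring
        · exact Finset.sum_congr rfl fun p _ => by ring
      simp only [h1, Finset.sum_sub_distrib, Finset.sum_add_distrib, ← Finset.sum_mul, hgF,
        ← Finset.mul_sum, ← hfF]
      have : ∑ i, F i * f i = ∑ p, f p * F p := Finset.sum_congr rfl fun i _ => by ring
      rw [this]; ring
    rw [this]; ring
  -- The derivative of the metric left in `ha` is expanded by compatibility; the two resulting sums
  -- cancel those left in `hf` and `hg'`.
  have hD : ∑ i, dg i j k * F i = ∑ i, ∑ p, Γ j i p * g i k * F p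
      + ∑ i, ∑ p, g j p * F i * Γ i p k := by
    rw [Finset.sum_comm (f := fun i p => Γ j i p * g i k * F p), ← Finset.sum_add_distrib]
    refine Finset.sum_congr rfl fun i _ => ?_
    rw [hdg, Finset.sum_mul, ← Finset.sum_add_distrib]
    refine Finset.sum_congr rfl fun p _ => ?_
    rw [hΓ p j i]; ring
  simp only [Finset.sum_add_distrib, Finset.sum_sub_distrib]
  rw [ha, hb, hc, hd, he, hf, hg', hh, hD]
  ring

variable {G : EuclideanSpace ℝ (Fin n) → Matrix (Fin n) (Fin n) ℝ}
  {U : Set (EuclideanSpace ℝ (Fin n))} {y : EuclideanSpace ℝ (Fin n)}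
  {f lam : EuclideanSpace ℝ (Fin n) → ℝ}

/-- The components of the gradient of `f` with respect to `G`. -/
def gradComp (G : EuclideanSpace ℝ (Fin n) → Matrix (Fin n) (Fin n) ℝ)
    (f : EuclideanSpace ℝ (Fin n) → ℝ) (k : Fin n) (y : EuclideanSpace ℝ (Fin n)) : ℝ :=
  ∑ l, (G y)⁻¹ k l * pderiv l f y

/-- The Laplacian of `f` with respect to `G`. -/
def lap (G : EuclideanSpace ℝ (Fin n) → Matrix (Fin n) (Fin n) ℝ)
    (f : EuclideanSpace ℝ (Fin n) → ℝ) (y : EuclideanSpace ℝ (Fin n)) : ℝ :=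
  ∑ k, pderiv k (gradComp G f k) y + ∑ i, ∑ p, conn G i y i p * gradComp G f p y

/-- The square of the length of the gradient of `f` with respect to `G`. -/
def gradSq (G : EuclideanSpace ℝ (Fin n) → Matrix (Fin n) (Fin n) ℝ)
    (f : EuclideanSpace ℝ (Fin n) → ℝ) (y : EuclideanSpace ℝ (Fin n)) : ℝ :=
  ∑ p, pderiv p f y * gradComp G f p y

namespace MetricField

theorem contDiffOn_gradComp (hG : MetricField G U) (hf : ContDiffOn ℝ ∞ f U) (k : Fin n) :
    ContDiffOn ℝ ∞ (gradComp G f k) U :=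
  ContDiffOn.sum fun l _ => (hG.smooth_inv k l).mul (contDiffOn_pderiv hG.isOpen hf)

theorem sum_mul_gradComp (hG : MetricField G U) (hy : y ∈ U) (k : Fin n) :
    ∑ i, G y i k * gradComp G f i y = pderiv k f y := by
  simp only [gradComp, Finset.mul_sum]
  rw [Finset.sum_comm]
  have h : ∀ l, ∑ i, G y i k * (G y)⁻¹ i l = if k = l then 1 else 0 := fun l => by
    rw [← Matrix.one_apply, ← Matrix.mul_nonsing_inv _ (hG.isUnit_det hy), Matrix.mul_apply]
    exact Finset.sum_congr rfl fun i _ => by rw [(hG.symm y hy).apply i k]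
  simp only [← mul_assoc, ← Finset.sum_mul, h, ite_mul, one_mul, zero_mul, Finset.sum_ite_eq,
    Finset.mem_univ, if_true]

/-- This is the derivative of `df = G · grad f`; it supplies the hypothesis `hdfF` of
`ricci_conformal_algebra`. -/
theorem pderiv_pderiv_eq (hG : MetricField G U) (hf : ContDiffOn ℝ ∞ f U) (hy : y ∈ U)
    (j k : Fin n) : pderiv j (pderiv k f) y =
      ∑ i, (mderiv j G y i k * gradComp G f i y + G y i k * pderiv j (gradComp G f i) y) := by
  have h : pderiv k f =ᶠ[nhds y] fun z => ∑ i, G z i k * gradComp G f i z := by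
    filter_upwards [hG.isOpen.mem_nhds hy] with z hz
    exact (hG.sum_mul_gradComp hz k).symm
  have hd := fun i => (hG.smooth i k).differentiableAt_of_isOpen hG.isOpen hy
  have hd' := fun i => (hG.contDiffOn_gradComp hf i).differentiableAt_of_isOpen hG.isOpen hy
  rw [pderiv_congr h, pderiv_sum fun i _ => (hd i).fun_mul (hd' i)]
  exact Finset.sum_congr rfl fun i _ => pderiv_mul (hd i) (hd' i)

theorem mderiv_apply_eq (hG : MetricField G U) (hy : y ∈ U) (i j k : Fin n) :
    mderiv i G y j k = ∑ p, (conn G i y p j * G y p k + G y j p * conn G i y p k) := by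
  rw [hG.mderiv_eq hy, Matrix.add_apply, Matrix.mul_apply, Matrix.mul_apply,
    ← Finset.sum_add_distrib]
  rfl

theorem smul (hG : MetricField G U) (hlam : ContDiffOn ℝ ∞ lam U) (hpos : ∀ z ∈ U, 0 < lam z) :
    MetricField (fun z => lam z • G z) U where
  isOpen := hG.isOpen
  smooth a b := hlam.mul (hG.smooth a b)
  symm z hz := by rw [Matrix.IsSymm, Matrix.transpose_smul, (hG.symm z hz).eq]
  det_ne z hz := by
    rw [Matrix.det_smul]
    exact mul_ne_zero (pow_ne_zero _ (hpos z hz).ne') (hG.det_ne z hz)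

/-- The difference between the connection matrices of conformal metrics. -/
def connDiff (G : EuclideanSpace ℝ (Fin n) → Matrix (Fin n) (Fin n) ℝ)
    (f : EuclideanSpace ℝ (Fin n) → ℝ) (i : Fin n) (y : EuclideanSpace ℝ (Fin n)) :
    Matrix (Fin n) (Fin n) ℝ :=
  Matrix.of fun k j => (if k = i then pderiv j f y else 0) + (if k = j then pderiv i f y else 0)
    - G y i j * gradComp G f k y

theorem smooth_connDiff (hG : MetricField G U) (hf : ContDiffOn ℝ ∞ f U) (i : Fin n) :
    SmoothMat (connDiff G f i) U := fun k j => by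
  have h : ∀ j, ContDiffOn ℝ ∞ (pderiv j f) U := fun j => contDiffOn_pderiv hG.isOpen hf
  refine ContDiffOn.sub (ContDiffOn.add ?_ ?_) ((hG.smooth i j).mul (hG.contDiffOn_gradComp hf k))
  · split_ifs
    · exact h j
    · exact contDiffOn_const
  · split_ifs
    · exact h i
    · exact contDiffOn_const

theorem mderiv_connDiff (hG : MetricField G U) (hf : ContDiffOn ℝ ∞ f U) (hy : y ∈ U)
    (l i k j : Fin n) : mderiv l (connDiff G f i) y k j =
      (if k = i then pderiv l (pderiv j f) y else 0) + (if k = j then pderiv l (pderiv i f) y else 0)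
        - (mderiv l G y i j * gradComp G f k y + G y i j * pderiv l (gradComp G f k) y) := by
  have h : ∀ (P : Prop) [Decidable P] (j : Fin n),
      DifferentiableAt ℝ (fun z => if P then pderiv j f z else 0) y := fun P _ j => by
    split_ifs
    · exact (contDiffOn_pderiv hG.isOpen hf).differentiableAt_of_isOpen hG.isOpen hy
    · exact differentiableAt_const _
  have h' : ∀ (P : Prop) [Decidable P] (j : Fin n),
      pderiv l (fun z => if P then pderiv j f z else 0) y =
        if P then pderiv l (pderiv j f) y else 0 := fun P _ j => by
    split_ifs
    · rfl
    · exact pderiv_const _ _ _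
  have hd := (hG.smooth i j).differentiableAt_of_isOpen hG.isOpen hy
  have hd' := (hG.contDiffOn_gradComp hf k).differentiableAt_of_isOpen hG.isOpen hy
  simp only [mderiv, connDiff, Matrix.of_apply]
  rw [pderiv_sub ((h _ j).fun_add (h _ i)) (hd.fun_mul hd'), pderiv_add (h _ j) (h _ i), h', h',
    pderiv_mul hd hd']

/-- The hypothesis `hd` expresses `lam = e^{2f}` up to a locally constant factor, which does not
affect the connection. The proof is again by uniqueness: `connDiff` is symmetric, and its
symmetrization against `G` is `2 ∂ᵢf · G`, exactly the extra term produced by differentiating `lam •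
G`. -/
theorem conn_smul (hG : MetricField G U) (hlam : ContDiffOn ℝ ∞ lam U) (hpos : ∀ z ∈ U, 0 < lam z)
    (hd : ∀ z ∈ U, ∀ i, pderiv i lam z = 2 * lam z * pderiv i f z) (hy : y ∈ U) (i : Fin n) :
    conn (fun z => lam z • G z) i y = conn G i y + connDiff G f i y := by
  refine (hG.smul hlam hpos).conn_unique hy (fun i => conn G i y + connDiff G f i y) ?_ ?_ i
  · intro k i j
    simp only [Matrix.add_apply, hG.conn_comm hy k i j, connDiff, Matrix.of_apply,
      (hG.symm y hy).apply i j]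
    ring
  · intro i
    have h1 : mderiv i (fun z => lam z • G z) y =
        pderiv i lam y • G y + lam y • mderiv i G y := by
      ext a b
      exact pderiv_mul (hlam.differentiableAt_of_isOpen hG.isOpen hy)
        ((hG.smooth a b).differentiableAt_of_isOpen hG.isOpen hy)
    have h2 : G y * connDiff G f i y = Matrix.of fun a b =>
        G y a i * pderiv b f y + G y a b * pderiv i f y - G y i b * pderiv a f y := by
      ext a b
      simp only [Matrix.mul_apply, connDiff, Matrix.of_apply, mul_sub, mul_add, mul_ite, mul_zero,
        Finset.sum_sub_distrib, Finset.sum_add_distrib, Finset.sum_ite_eq', Finset.mem_univ,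
        if_true]
      rw [← hG.sum_mul_gradComp hy a, Finset.mul_sum]
      congr 1
      refine Finset.sum_congr rfl fun p _ => ?_
      rw [(hG.symm y hy).apply a p]; ring
    have h3 : (connDiff G f i y).transpose * G y + G y * connDiff G f i y =
        (2 * pderiv i f y) • G y := by
      have : (connDiff G f i y).transpose * G y = (G y * connDiff G f i y).transpose := by
        rw [Matrix.transpose_mul, (hG.symm y hy).eq]
      rw [this, h2]
      ext a b
      simp only [Matrix.add_apply, Matrix.transpose_apply, Matrix.of_apply, Matrix.smul_apply,
        smul_eq_mul, (hG.symm y hy).apply a b, (hG.symm y hy).apply i b,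
        (hG.symm y hy).apply i a]
      ring
    rw [h1, hd y hy, hG.mderiv_eq hy, Matrix.transpose_add, Matrix.mul_smul, Matrix.smul_mul]
    rw [show (2 * lam y * pderiv i f y) = lam y * (2 * pderiv i f y) by ring, mul_smul, ← h3]
    simp only [add_mul, mul_add, smul_add]
    abel

theorem ric_smul (hG : MetricField G U) (hlam : ContDiffOn ℝ ∞ lam U)
    (hpos : ∀ z ∈ U, 0 < lam z) (hf : ContDiffOn ℝ ∞ f U)
    (hd : ∀ z ∈ U, ∀ i, pderiv i lam z = 2 * lam z * pderiv i f z) (hy : y ∈ U) (j k : Fin n) :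
    ric (fun z => lam z • G z) j k y = ric G j k y + ((2 - (n : ℝ)) * pderiv j (pderiv k f) y
      - G y j k * lap G f y + ((n : ℝ) - 2) * ∑ p, pderiv p f y * conn G j y p k
      + ((n : ℝ) - 2) * (pderiv j f y * pderiv k f y)
      - ((n : ℝ) - 2) * (G y j k * gradSq G f y)) := by
  have hm : ∀ i j, mderiv i (conn (fun z => lam z • G z) j) y =
      mderiv i (conn G j) y + mderiv i (connDiff G f j) y := fun i j => by
    rw [← mderiv_add (hG.smooth_conn j) (hG.smooth_connDiff hf j) hG.isOpen hy]
    exact mderiv_congr hG.isOpen hy fun z hz => hG.conn_smul hlam hpos hd hz j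
  have halg := ricci_conformal_algebra (fun i k j => conn G i y k j) (fun i => mderiv i G y) (G y)
    (fun i j => pderiv i (pderiv j f) y) (fun i k => pderiv i (gradComp G f k) y)
    (fun i => pderiv i f y) (fun i => gradComp G f i y) (hG.conn_comm hy)
    (fun i j => (hG.symm y hy).apply j i)
    (fun i j => pderiv_comm (hf.contDiffAt (hG.isOpen.mem_nhds hy))) (hG.mderiv_apply_eq hy)
    (fun k => (hG.sum_mul_gradComp hy k).symm) (hG.pderiv_pderiv_eq hf hy)
    (fun i k j => connDiff G f i y k j) (fun l i k j => mderiv l (connDiff G f i) y k j)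
    (fun _ _ _ => rfl) (hG.mderiv_connDiff hf hy) j k
  rw [lap, gradSq, ← halg, ric_eq_sum_curv, ric_eq_sum_curv, ← Finset.sum_add_distrib]
  refine Finset.sum_congr rfl fun i _ => ?_
  simp only [curv, hm, hG.conn_smul hlam hpos hd hy, Matrix.add_apply, Matrix.sub_apply,
    Matrix.mul_apply, add_mul, mul_add, Finset.sum_add_distrib, Finset.sum_sub_distrib]
  ring

/-- The trace of `ric_smul`. The Laplacian collects `2 - n` from the traced Hessian and `-n` from
the trace of the metric; the squared gradient collects `n - 2` and `-n(n - 2)`. -/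
theorem scal_smul (hG : MetricField G U) (hlam : ContDiffOn ℝ ∞ lam U)
    (hpos : ∀ z ∈ U, 0 < lam z) (hf : ContDiffOn ℝ ∞ f U)
    (hd : ∀ z ∈ U, ∀ i, pderiv i lam z = 2 * lam z * pderiv i f z) (hy : y ∈ U) :
    lam y * scal (fun z => lam z • G z) y = scal G y - 2 * ((n : ℝ) - 1) * lap G f y
      - ((n : ℝ) - 1) * ((n : ℝ) - 2) * gradSq G f y := by
  have hinv : (lam y • G y)⁻¹ = (lam y)⁻¹ • (G y)⁻¹ := by
    refine Matrix.inv_eq_right_inv ?_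
    rw [Matrix.smul_mul, Matrix.mul_smul, smul_smul, Matrix.mul_nonsing_inv _ (hG.isUnit_det hy),
      mul_inv_cancel₀ (hpos y hy).ne', one_smul]
  have h1 : lam y * scal (fun z => lam z • G z) y =
      ∑ j, ∑ k, (G y)⁻¹ j k * ric (fun z => lam z • G z) j k y := by
    simp only [scal, hinv, Finset.mul_sum, Matrix.smul_apply, smul_eq_mul]
    refine Finset.sum_congr rfl fun j _ => Finset.sum_congr rfl fun k _ => ?_
    rw [← mul_assoc, ← mul_assoc, mul_inv_cancel₀ (hpos y hy).ne', one_mul]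
  have hgi : ∀ j l, ∑ k, (G y)⁻¹ j k * G y l k = if j = l then 1 else 0 := fun j l => by
    rw [← Matrix.one_apply, ← Matrix.nonsing_inv_mul _ (hG.isUnit_det hy), Matrix.mul_apply]
    exact Finset.sum_congr rfl fun k _ => by rw [(hG.symm y hy).apply k l]
  have htr : ∑ j, ∑ k, (G y)⁻¹ j k * G y j k = n := by simp [hgi]
  have hff : ∑ j, ∑ k, (G y)⁻¹ j k * (pderiv j f y * pderiv k f y) = gradSq G f y := by
    simp only [gradSq, gradComp, Finset.mul_sum]
    exact Finset.sum_congr rfl fun j _ => Finset.sum_congr rfl fun k _ => by ring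
  -- The trace of the covariant Hessian is the divergence of the gradient, which is how `lap` is
  -- defined, because the metric is parallel.
  have hlap : ∑ j, ∑ k, (G y)⁻¹ j k * (pderiv j (pderiv k f) y
      - ∑ p, pderiv p f y * conn G j y p k) = lap G f y := by
    have hjk : ∀ j, ∑ k, (G y)⁻¹ j k * (pderiv j (pderiv k f) y
        - ∑ p, pderiv p f y * conn G j y p k) =
        pderiv j (gradComp G f j) y + ∑ l, conn G j y j l * gradComp G f l y := fun j => by
      have h2 : ∀ k, pderiv j (pderiv k f) y - ∑ p, pderiv p f y * conn G j y p k =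
          ∑ i, G y i k * (pderiv j (gradComp G f i) y + ∑ l, conn G j y i l * gradComp G f l y) :=
        fun k => by
        rw [hG.pderiv_pderiv_eq hf hy]
        have h3 : ∀ p, pderiv p f y = ∑ i, G y p i * gradComp G f i y := fun p => by
          rw [← hG.sum_mul_gradComp hy p]
          exact Finset.sum_congr rfl fun i _ => by rw [(hG.symm y hy).apply i p]
        simp only [hG.mderiv_apply_eq hy, h3, Finset.sum_add_distrib, mul_add, Finset.sum_mul,
          Finset.mul_sum, add_mul]
        have e1 : ∑ i, ∑ p, conn G j y p i * G y p k * gradComp G f i y =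
            ∑ i, ∑ p, G y i k * (conn G j y i p * gradComp G f p y) := by
          rw [Finset.sum_comm]
          exact Finset.sum_congr rfl fun i _ => Finset.sum_congr rfl fun p _ => by ring
        have e2 : ∑ i, ∑ p, G y i p * conn G j y p k * gradComp G f i y =
            ∑ p, ∑ i, G y p i * gradComp G f i y * conn G j y p k := by
          rw [Finset.sum_comm]
          refine Finset.sum_congr rfl fun i _ => Finset.sum_congr rfl fun p _ => ?_
          rw [(hG.symm y hy).apply i p]; ring
        rw [e1, e2]; ring
      obtain ⟨v, hv⟩ : ∃ v : Fin n → ℝ, ∀ i, v i = pderiv j (gradComp G f i) y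
          + ∑ l, conn G j y i l * gradComp G f l y := ⟨_, fun _ => rfl⟩
      simp only [h2, ← hv, Finset.mul_sum]
      rw [Finset.sum_comm]
      simp only [← mul_assoc, ← Finset.sum_mul, hgi, ite_mul, one_mul, zero_mul,
        Finset.sum_ite_eq, Finset.mem_univ, if_true]
    simp only [hjk, Finset.sum_add_distrib, lap]
  have hexp : ∀ j k, (G y)⁻¹ j k * ric (fun z => lam z • G z) j k y =
      (G y)⁻¹ j k * ric G j k y + (2 - (n : ℝ)) * ((G y)⁻¹ j k * (pderiv j (pderiv k f) y
        - ∑ p, pderiv p f y * conn G j y p k))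
      + ((n : ℝ) - 2) * ((G y)⁻¹ j k * (pderiv j f y * pderiv k f y))
      - (lap G f y + ((n : ℝ) - 2) * gradSq G f y) * ((G y)⁻¹ j k * G y j k) := fun j k => by
    rw [hG.ric_smul hlam hpos hf hd hy]; ring
  rw [h1]
  simp only [hexp, Finset.sum_add_distrib, Finset.sum_sub_distrib, ← Finset.mul_sum]
  rw [hlap, hff, htr, scal]
  ring

end MetricField

end ConformalChange

/-! ### Coordinate fields, transition maps and scalar curvature on the manifold. -/

section
variable {n : ℕ} {M : Type*} [TopologicalSpace M] [ChartedSpace (EuclideanSpace ℝ (Fin n)) M]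

theorem isOpen_target (c : M) : IsOpen (extChartAt (𝓡 n) c).target := isOpen_extChartAt_target c

/-- The change of coordinates from the chart at `c` to the chart at `c'`. -/
def transition (c c' : M) : EuclideanSpace ℝ (Fin n) → EuclideanSpace ℝ (Fin n) :=
  extChartAt (𝓡 n) c' ∘ param c

/-- The coordinates in the chart at `c` of the points that are in the domain of the chart at `c'`. -/
def overlap (c c' : M) : Set (EuclideanSpace ℝ (Fin n)) :=
  (extChartAt (𝓡 n) c).target ∩ param c ⁻¹' (extChartAt (𝓡 n) c').source

theorem isOpen_overlap (c c' : M) : IsOpen (overlap (n := n) c c') :=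
  (continuousOn_extChartAt_symm c).isOpen_inter_preimage (isOpen_target c)
    (isOpen_extChartAt_source c')

theorem transition_mem (c c' : M) {y : EuclideanSpace ℝ (Fin n)} (hy : y ∈ overlap c c') :
    transition c c' y ∈ (extChartAt (𝓡 n) c').target := (extChartAt (𝓡 n) c').map_source hy.2

theorem param_transition (c c' : M) {y : EuclideanSpace ℝ (Fin n)} (hy : y ∈ overlap c c') :
    param c' (transition c c' y) = param c y := (extChartAt (𝓡 n) c').left_inv hy.2

theorem mfderiv_param_eq_sum (c : M) (y v : EuclideanSpace ℝ (Fin n)) :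
    (mfderiv (𝓡 n) (𝓡 n) (param c) y v : TangentSpace (𝓡 n) (param c y)) =
      ∑ i, v i • coordVec c i y := by
  have h : v = ∑ i, v i • EuclideanSpace.single i (1 : ℝ) := by
    simpa using ((EuclideanSpace.basisFun (Fin n) ℝ).sum_repr v).symm
  have h2 := congrArg (mfderiv (𝓡 n) (𝓡 n) (param c) y) h
  refine h2.trans ?_
  refine (map_sum (mfderiv (𝓡 n) (𝓡 n) (param c) y) _ _).trans ?_
  exact Finset.sum_congr rfl fun i _ => map_smul (mfderiv (𝓡 n) (𝓡 n) (param c) y) _ _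

variable [IsManifold (𝓡 n) ∞ M]

theorem contMDiffAt_param {c : M} {y : EuclideanSpace ℝ (Fin n)}
    (hy : y ∈ (extChartAt (𝓡 n) c).target) : ContMDiffAt (𝓡 n) (𝓡 n) ∞ (param c) y :=
  (contMDiffOn_extChartAt_symm c).contMDiffAt ((isOpen_target c).mem_nhds hy)

/-- The field `∂ᵢ` is the tangent map of the smooth parametrization evaluated along a constant
section of `Tℝⁿ`. -/
theorem contMDiffAt_coordVec {c : M} (i : Fin n) {y : EuclideanSpace ℝ (Fin n)}
    (hy : y ∈ (extChartAt (𝓡 n) c).target) :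
    ContMDiffAt (𝓡 n) ((𝓡 n).prod (𝓡 n)) ∞
      (fun z => (⟨param c z, coordVec c i z⟩ : TangentBundle (𝓡 n) M)) y := by
  have h := (contMDiffOn_extChartAt_symm (I := 𝓡 n) (n := ∞) c).contMDiffOn_tangentMapWithin
    (m := ∞) (by simp) (isOpen_target c).uniqueMDiffOn
  let V : ∀ z : EuclideanSpace ℝ (Fin n), TangentSpace (𝓡 n) z :=
    fun z => (EuclideanSpace.single i (1 : ℝ) : EuclideanSpace ℝ (Fin n))
  have h2 : ContMDiffAt (𝓡 n) ((𝓡 n).prod (𝓡 n)) ∞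
      (fun z => (⟨z, V z⟩ : TangentBundle (𝓡 n) (EuclideanSpace ℝ (Fin n)))) y := by
    refine (contMDiffAt_section (F := EuclideanSpace ℝ (Fin n)) y).2 ?_
    have : (fun x => (trivializationAt (EuclideanSpace ℝ (Fin n)) (TangentSpace (𝓡 n)) y
        ⟨x, V x⟩).2) = fun _ => EuclideanSpace.single i (1 : ℝ) := by
      ext1 x; simp [V]
    rw [this]
    exact contMDiffAt_const
  have h3 := h.contMDiffAt (x := ⟨y, V y⟩)
    (((isOpen_target c).preimage (FiberBundle.continuous_proj _ _)).mem_nhds hy) 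
  have h4 := ContMDiffAt.comp y h3 h2
  refine h4.congr_of_eventuallyEq ?_
  filter_upwards [(isOpen_target c).mem_nhds hy] with z hz
  simp only [tangentMapWithin, Function.comp, mfderivWithin_of_isOpen (isOpen_target c) hz]
  rfl

set_option synthInstance.maxHeartbeats 400000 in
theorem contMDiffAt_inner (g : Metric n M) {c : M} {y : EuclideanSpace ℝ (Fin n)}
    {V W : ∀ z : EuclideanSpace ℝ (Fin n), TangentSpace (𝓡 n) (param c z)}
    (hy : y ∈ (extChartAt (𝓡 n) c).target)
    (hV : ContMDiffAt (𝓡 n) ((𝓡 n).prod (𝓡 n)) ∞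
      (fun z => (⟨param c z, V z⟩ : TangentBundle (𝓡 n) M)) y)
    (hW : ContMDiffAt (𝓡 n) ((𝓡 n).prod (𝓡 n)) ∞
      (fun z => (⟨param c z, W z⟩ : TangentBundle (𝓡 n) M)) y) :
    ContDiffAt ℝ ∞ (fun z => g.inner (param c z) (V z) (W z)) y := by
  have : ContMDiffAt (𝓡 n) ((𝓡 n).prod 𝓘(ℝ)) ∞
      (fun m ↦ TotalSpace.mk' ℝ (E := Bundle.Trivial M ℝ) (param c m)
        (g.inner (param c m) (V m) (W m))) y := by
    apply ContMDiffAt.clm_bundle_apply₂ (F₁ := EuclideanSpace ℝ (Fin n))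
      (F₂ := EuclideanSpace ℝ (Fin n))
    · exact ContMDiffAt.comp y g.contMDiff.contMDiffAt (contMDiffAt_param hy)
    · exact hV
    · exact hW
  rw [contMDiffAt_totalSpace] at this
  exact this.2.contDiffAt

theorem contDiffOn_coeff (g : Metric n M) (c : M) (i j : Fin n) :
    ContDiffOn ℝ ∞ (fun y => coeff g c y i j) (extChartAt (𝓡 n) c).target := fun _ hy =>
  (contMDiffAt_inner g hy (contMDiffAt_coordVec i hy) (contMDiffAt_coordVec j hy)).contDiffWithinAt

theorem contDiffOn_transition (c c' : M) :
    ContDiffOn ℝ ∞ (transition c c') (overlap (n := n) c c') := by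
  have := contDiffOn_ext_coord_change (I := 𝓡 n) (n := ∞) c' c
  refine this.mono ?_
  intro y hy
  simpa [overlap, param] using hy

theorem mfderiv_param_transition (c c' : M) {y : EuclideanSpace ℝ (Fin n)} (hy : y ∈ overlap c c')
    (v : EuclideanSpace ℝ (Fin n)) :
    (mfderiv (𝓡 n) (𝓡 n) (param c) y v : EuclideanSpace ℝ (Fin n)) =
      mfderiv (𝓡 n) (𝓡 n) (param c') (transition c c' y) (fderiv ℝ (transition c c') y v) := by
  have h1 : param c =ᶠ[nhds y] param c' ∘ transition c c' := by
    filter_upwards [(isOpen_overlap c c').mem_nhds hy] with z hz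
    exact (param_transition c c' hz).symm
  have hd : MDifferentiableAt (𝓡 n) (𝓡 n) (transition c c') y :=
    (((contDiffOn_transition c c').contDiffAt ((isOpen_overlap c c').mem_nhds hy)).differentiableAt (by simp)).mdifferentiableAt
  rw [h1.mfderiv_eq, mfderiv_comp y ((contMDiffAt_param (transition_mem c c' hy)).mdifferentiableAt (by simp)) hd, mfderiv_eq_fderiv]
  rfl

theorem exists_eq_mfderiv_param {c : M} {y : EuclideanSpace ℝ (Fin n)}
    (hy : y ∈ (extChartAt (𝓡 n) c).target) (X : TangentSpace (𝓡 n) (param c y)) :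
    ∃ v : EuclideanSpace ℝ (Fin n), mfderiv (𝓡 n) (𝓡 n) (param c) y v = X := by
  have h := isInvertible_mfderivWithin_extChartAt_symm (I := 𝓡 n) hy
  rw [ModelWithCorners.range_eq_univ, mfderivWithin_univ] at h
  obtain ⟨e, he⟩ := h
  exact ⟨e.symm X, (DFunLike.congr_fun he (e.symm X)).symm.trans (e.apply_symm_apply X)⟩

theorem mfderiv_param_injective {c : M} {y : EuclideanSpace ℝ (Fin n)}
    (hy : y ∈ (extChartAt (𝓡 n) c).target) {v : EuclideanSpace ℝ (Fin n)}
    (hv : mfderiv (𝓡 n) (𝓡 n) (param c) y v = 0) : v = 0 := by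
  have h := isInvertible_mfderivWithin_extChartAt_symm (I := 𝓡 n) hy
  rw [ModelWithCorners.range_eq_univ, mfderivWithin_univ] at h
  obtain ⟨e, he⟩ := h
  have h1 : e v = 0 := by
    have := DFunLike.congr_fun he v
    exact this.trans hv
  exact e.map_eq_zero_iff.1 h1

theorem exists_eq_sum_coordVec {c : M} {y : EuclideanSpace ℝ (Fin n)}
    (hy : y ∈ (extChartAt (𝓡 n) c).target) (X : TangentSpace (𝓡 n) (param c y)) :
    ∃ a : Fin n → ℝ, X = ∑ i, a i • coordVec c i y := by
  obtain ⟨v, rfl⟩ := exists_eq_mfderiv_param hy X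
  exact ⟨v, mfderiv_param_eq_sum c y v⟩

theorem sum_smul_coordVec_eq_zero {c : M} {y : EuclideanSpace ℝ (Fin n)}
    (hy : y ∈ (extChartAt (𝓡 n) c).target) {a : Fin n → ℝ}
    (ha : ∑ i, a i • coordVec c i y = 0) : a = 0 := by
  have := mfderiv_param_injective hy (v := WithLp.toLp 2 a)
    ((mfderiv_param_eq_sum c y (WithLp.toLp 2 a)).trans ha)
  simpa using this

theorem inner_sum_sum (g : Metric n M) (x : M) (a b : Fin n → ℝ)
    (V W : Fin n → TangentSpace (𝓡 n) x) :
    g.inner x (∑ i, a i • V i) (∑ j, b j • W j) = ∑ i, ∑ j, a i * b j * g.inner x (V i) (W j) := by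
  simp only [map_sum, map_smul, _root_.sum_apply, _root_.smul_apply,
    smul_eq_mul, Finset.mul_sum]
  rw [Finset.sum_comm]
  exact Finset.sum_congr rfl fun i _ => Finset.sum_congr rfl fun j _ => by ring

theorem coeff_apply (g : Metric n M) (c : M) (y : EuclideanSpace ℝ (Fin n)) (i j : Fin n) :
    coeff g c y i j = g.inner (param c y) (coordVec c i y) (coordVec c j y) := rfl

theorem coeff_symm (g : Metric n M) (c : M) (y : EuclideanSpace ℝ (Fin n)) :
    (coeff g c y).IsSymm := by
  ext i j
  exact g.symm _ _ _

theorem coeff_posDef (g : Metric n M) {c : M} {y : EuclideanSpace ℝ (Fin n)}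
    (hy : y ∈ (extChartAt (𝓡 n) c).target) : (coeff g c y).PosDef := by
  refine Matrix.PosDef.of_dotProduct_mulVec_pos ?_ fun {a} ha => ?_
  · rw [Matrix.IsHermitian, Matrix.conjTranspose_eq_transpose_of_trivial]
    exact (coeff_symm g c y).eq
  · have h0 : ∑ i, a i • coordVec c i y ≠ 0 := fun h => ha (sum_smul_coordVec_eq_zero hy h)
    have h := g.pos _ _ h0
    rw [inner_sum_sum] at h
    simp only [star_trivial, dotProduct, Matrix.mulVec, Finset.mul_sum]
    refine h.trans_eq ?_
    exact Finset.sum_congr rfl fun i _ => Finset.sum_congr rfl fun j _ => by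
      rw [coeff_apply]; ring

theorem metricField_coeff (g : Metric n M) (c : M) :
    MetricField (coeff g c) (extChartAt (𝓡 n) c).target where
  isOpen := isOpen_target c
  smooth := contDiffOn_coeff g c
  symm z _ := coeff_symm g c z
  det_ne _ hz := (coeff_posDef g hz).det_pos.ne'

/-- The components of a vector in terms of its products with the coordinate vector fields. -/
theorem eq_sum_inner_smul_coordVec (g : Metric n M) {c : M} {y : EuclideanSpace ℝ (Fin n)}
    (hy : y ∈ (extChartAt (𝓡 n) c).target) (X : TangentSpace (𝓡 n) (param c y)) :
    X = ∑ i, (∑ j, (coeff g c y)⁻¹ i j * g.inner (param c y) X (coordVec c j y)) •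
      coordVec c i y := by
  obtain ⟨a, rfl⟩ := exists_eq_sum_coordVec hy X
  refine Finset.sum_congr rfl fun i _ => ?_
  congr 1
  have h : ∀ j, g.inner (param c y) (∑ k, a k • coordVec c k y) (coordVec c j y) =
      (coeff g c y).mulVec a j := fun j => by
    simp only [map_sum, map_smul, _root_.sum_apply, _root_.smul_apply,
      smul_eq_mul, Matrix.mulVec, dotProduct]
    exact Finset.sum_congr rfl fun k _ => by
      rw [mul_comm, ← coeff_apply, (coeff_symm g c y).apply j k]
  simp only [h]
  change a i = (coeff g c y)⁻¹.mulVec ((coeff g c y).mulVec a) i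
  rw [Matrix.mulVec_mulVec, Matrix.nonsing_inv_mul _ ((metricField_coeff g c).isUnit_det hy),
    Matrix.one_mulVec]

/-- A weak gradient is known only through its products with the coordinate fields, so inner products
have to be recovered from these with the inverse matrix. -/
theorem inner_eq_sum (g : Metric n M) {c : M} {y : EuclideanSpace ℝ (Fin n)}
    (hy : y ∈ (extChartAt (𝓡 n) c).target) (X Y : TangentSpace (𝓡 n) (param c y)) :
    g.inner (param c y) X Y = ∑ i, ∑ j, (coeff g c y)⁻¹ i j *
      g.inner (param c y) X (coordVec c j y) * g.inner (param c y) Y (coordVec c i y) := by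
  conv_lhs => rw [eq_sum_inner_smul_coordVec g hy X]
  simp only [map_sum, map_smul, _root_.sum_apply, _root_.smul_apply,
    smul_eq_mul, Finset.sum_mul]
  exact Finset.sum_congr rfl fun i _ => Finset.sum_congr rfl fun j _ => by
    rw [g.symm _ (coordVec c i y) Y]

theorem tangent_ext (g : Metric n M) {c : M} {y : EuclideanSpace ℝ (Fin n)}
    (hy : y ∈ (extChartAt (𝓡 n) c).target) {X Y : TangentSpace (𝓡 n) (param c y)}
    (h : ∀ i, g.inner (param c y) X (coordVec c i y) = g.inner (param c y) Y (coordVec c i y)) :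
    X = Y := by
  rw [eq_sum_inner_smul_coordVec g hy X, eq_sum_inner_smul_coordVec g hy Y]
  simp only [h]

theorem exists_inner_eq (g : Metric n M) {c : M} {y : EuclideanSpace ℝ (Fin n)}
    (hy : y ∈ (extChartAt (𝓡 n) c).target) (l : Fin n → ℝ) :
    ∃ X : TangentSpace (𝓡 n) (param c y), ∀ i, g.inner (param c y) X (coordVec c i y) = l i := by
  refine ⟨∑ k, ((coeff g c y)⁻¹.mulVec l) k • coordVec c k y, fun i => ?_⟩
  have h : g.inner (param c y) (∑ k, ((coeff g c y)⁻¹.mulVec l) k • coordVec c k y)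
      (coordVec c i y) = (coeff g c y).mulVec ((coeff g c y)⁻¹.mulVec l) i := by
    simp only [map_sum, map_smul, _root_.sum_apply, _root_.smul_apply,
      smul_eq_mul]
    simp only [Matrix.mulVec, dotProduct]
    exact Finset.sum_congr rfl fun k _ => by
      rw [mul_comm, ← coeff_apply, (coeff_symm g c y).apply i k]
  rw [h, Matrix.mulVec_mulVec, Matrix.mul_nonsing_inv _ ((metricField_coeff g c).isUnit_det hy),
    Matrix.one_mulVec]

theorem coordVec_transition (c c' : M) {y : EuclideanSpace ℝ (Fin n)} (hy : y ∈ overlap c c')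
    (i : Fin n) : (coordVec c i y : EuclideanSpace ℝ (Fin n)) =
      ∑ p, jac (transition c c') y p i • (coordVec c' p (transition c c' y) :
        EuclideanSpace ℝ (Fin n)) := by
  refine (mfderiv_param_transition c c' hy (EuclideanSpace.single i 1)).trans ?_
  refine (mfderiv_param_eq_sum c' (transition c c' y) _).trans ?_
  refine Finset.sum_congr rfl fun p _ => ?_
  congr 1
  have hd : DifferentiableAt ℝ (transition c c') y :=
    ((contDiffOn_transition c c').contDiffAt
      ((isOpen_overlap c c').mem_nhds hy)).differentiableAt (by simp)
  have : HasFDerivAt (fun z => transition c c' z p)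
      ((EuclideanSpace.proj p).comp (fderiv ℝ (transition c c') y)) y :=
    (EuclideanSpace.proj (𝕜 := ℝ) p).hasFDerivAt.comp y hd.hasFDerivAt
  rw [jac, Matrix.of_apply, pderiv, this.fderiv]
  rfl

/-- `param c y` and `param c' (transition c c' y)` are equal without being the same term, so their
tangent spaces are different types. Vectors are compared through the model space, to which all
tangent spaces unfold. -/
theorem inner_congr (g : Metric n M) {x x' : M} (h : x = x')
    {X Y : TangentSpace (𝓡 n) x} {X' Y' : TangentSpace (𝓡 n) x'}
    (hX : (X : EuclideanSpace ℝ (Fin n)) = (X' : EuclideanSpace ℝ (Fin n)))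
    (hY : (Y : EuclideanSpace ℝ (Fin n)) = (Y' : EuclideanSpace ℝ (Fin n))) :
    g.inner x X Y = g.inner x' X' Y' := by
  subst h
  have h1 : X = X' := hX
  have h2 : Y = Y' := hY
  rw [h1, h2]

theorem coeff_transition (g : Metric n M) (c c' : M) {y : EuclideanSpace ℝ (Fin n)}
    (hy : y ∈ overlap c c') : coeff g c y = (jac (transition c c') y).transpose *
      coeff g c' (transition c c' y) * jac (transition c c') y := by
  ext i j
  rw [coeff_apply, inner_congr g (param_transition c c' hy).symm (coordVec_transition c c' hy i)
    (coordVec_transition c c' hy j)]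
  refine (inner_sum_sum g _ _ _ (fun p => coordVec c' p (transition c c' y))
    (fun p => coordVec c' p (transition c c' y))).trans ?_
  simp only [Matrix.mul_apply, Matrix.transpose_apply, Finset.sum_mul, coeff_apply]
  rw [Finset.sum_comm]
  exact Finset.sum_congr rfl fun i _ => Finset.sum_congr rfl fun j _ => by ring

theorem isPullback_transition (g : Metric n M) (c c' : M) :
    IsPullback (transition c c') (coeff g c) (coeff g c') (overlap c c')
      (extChartAt (𝓡 n) c').target where
  source :=
    { isOpen := isOpen_overlap c c'
      smooth := fun i j => (contDiffOn_coeff g c i j).mono fun _ hy => hy.1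
      symm := fun z _ => coeff_symm g c z
      det_ne := fun _ hz => (coeff_posDef g hz.1).det_pos.ne' }
  target := metricField_coeff g c'
  contDiffOn := contDiffOn_transition c c'
  mapsTo := fun _ hy => transition_mem c c' hy
  eq := fun _ hy => coeff_transition g c c' hy

/-- The scalar curvature does not depend on the chart. -/
theorem scalarCurvature_param (g : Metric n M) {c : M} {y : EuclideanSpace ℝ (Fin n)}
    (hy : y ∈ (extChartAt (𝓡 n) c).target) :
    scalarCurvature g (param c y) = scal (coeff g c) y := by
  have hov : y ∈ overlap c (param c y) := ⟨hy, mem_extChartAt_source (I := 𝓡 n) (param c y)⟩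
  exact ((isPullback_transition g c (param c y)).scal_eq hov).symm

/-- The preferred chart may jump from point to point. By `scalarCurvature_param` the chart at `x`
computes the curvature at every nearby point, and there it is smooth. -/
theorem continuous_scalarCurvature (g : Metric n M) : Continuous (scalarCurvature g) := by
  rw [continuous_iff_continuousAt]
  intro x
  have h1 : ContinuousAt (fun z => scal (coeff g x) (extChartAt (𝓡 n) x z)) x :=
    ContinuousAt.comp (g := scal (coeff g x)) ((metricField_coeff g x).contDiffOn_scal.continuousOn.continuousAt
      ((isOpen_target x).mem_nhds (mem_extChartAt_target (I := 𝓡 n) x)))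
      (continuousAt_extChartAt (I := 𝓡 n) x)
  refine h1.congr ?_
  filter_upwards [extChartAt_source_mem_nhds (I := 𝓡 n) x] with z hz
  rw [← scalarCurvature_param g ((extChartAt (𝓡 n) x).map_source hz)]
  exact congrArg _ ((extChartAt (𝓡 n) x).left_inv hz)

end

/-! ### The Riemannian measure in charts. -/

section Volume

variable {n : ℕ} {M : Type*} [TopologicalSpace M] [ChartedSpace (EuclideanSpace ℝ (Fin n)) M]

theorem measurableSet_target (c : M) : MeasurableSet (extChartAt (𝓡 n) c).target :=
  (isOpen_target c).measurableSet

theorem continuousOn_param (c : M) : ContinuousOn (param c) (extChartAt (𝓡 n) c).target :=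
  continuousOn_extChartAt_symm c

theorem param_mem_source {c : M} {y : EuclideanSpace ℝ (Fin n)}
    (hy : y ∈ (extChartAt (𝓡 n) c).target) : param c y ∈ (extChartAt (𝓡 n) c).source :=
  (extChartAt (𝓡 n) c).map_target hy

variable [MeasurableSpace M] [BorelSpace M]

theorem measurableSet_source (c : M) : MeasurableSet (extChartAt (𝓡 n) c).source :=
  (isOpen_extChartAt_source c).measurableSet

theorem aemeasurable_param (c : M) :
    AEMeasurable (param c) (volume.restrict (extChartAt (𝓡 n) c).target) :=
  (continuousOn_param c).aemeasurable (measurableSet_target c)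

variable [IsManifold (𝓡 n) ∞ M]

/-- The density `√(det gᵢⱼ)` of the Riemannian measure in the chart at `c`. -/
def dens (g : Metric n M) (c : M) (y : EuclideanSpace ℝ (Fin n)) : ℝ := Real.sqrt (coeff g c y).det

theorem dens_pos (g : Metric n M) {c : M} {y : EuclideanSpace ℝ (Fin n)}
    (hy : y ∈ (extChartAt (𝓡 n) c).target) : 0 < dens g c y :=
  Real.sqrt_pos.2 (coeff_posDef g hy).det_pos

theorem contDiffOn_dens (g : Metric n M) (c : M) :
    ContDiffOn ℝ ∞ (dens g c) (extChartAt (𝓡 n) c).target := fun y hy =>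
  ((metricField_coeff g c).smooth.det y hy).sqrt (coeff_posDef g hy).det_pos.ne'

theorem aemeasurable_dens (g : Metric n M) (c : M) :
    AEMeasurable (dens g c) (volume.restrict (extChartAt (𝓡 n) c).target) :=
  (contDiffOn_dens g c).continuousOn.aemeasurable (measurableSet_target c)

theorem aemeasurable_param_withDensity (g : Metric n M) (c : M) :
    AEMeasurable (param c) ((volume.restrict (extChartAt (𝓡 n) c).target).withDensity
      (fun y => ENNReal.ofReal (dens g c y))) :=
  (aemeasurable_param c).mono_ac (withDensity_absolutelyContinuous _ _)

theorem lintegral_chartVolume (g : Metric n M) (c : M) {f : M → ℝ≥0∞} (hf : Measurable f) :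
    ∫⁻ x, f x ∂(chartVolume g c) =
      ∫⁻ y in (extChartAt (𝓡 n) c).target, ENNReal.ofReal (dens g c y) * f (param c y) := by
  have h : chartVolume g c = ((volume.restrict (extChartAt (𝓡 n) c).target).withDensity
    (fun y => ENNReal.ofReal (dens g c y))).map (param c) := rfl
  rw [h, lintegral_map' hf.aemeasurable (aemeasurable_param_withDensity g c),
    lintegral_withDensity_eq_lintegral_mul₀ (aemeasurable_dens g c).ennreal_ofReal
      (show AEMeasurable (fun y => f (param c y)) _ from
        hf.comp_aemeasurable (aemeasurable_param c))]
  rfl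

theorem chartVolume_compl_source (g : Metric n M) (c : M) :
    chartVolume g c (extChartAt (𝓡 n) c).sourceᶜ = 0 := by
  rw [← lintegral_indicator_one (measurableSet_source c).compl,
    lintegral_chartVolume g c (measurable_one.indicator (measurableSet_source c).compl)]
  rw [setLIntegral_congr_fun (g := fun _ => 0) (measurableSet_target c) (fun y hy => ?_)]
  · simp
  · have : param c y ∉ (extChartAt (𝓡 n) c).sourceᶜ := fun h => h (param_mem_source hy)
    simp only [Set.indicator_of_notMem this, mul_zero]

theorem det_fderiv_eq_det_jac {φ : EuclideanSpace ℝ (Fin n) → EuclideanSpace ℝ (Fin n)}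
    {y : EuclideanSpace ℝ (Fin n)} (hφ : DifferentiableAt ℝ φ y) :
    (fderiv ℝ φ y).det = (jac φ y).det := by
  have h : jac φ y = LinearMap.toMatrix (EuclideanSpace.basisFun (Fin n) ℝ).toBasis
      (EuclideanSpace.basisFun (Fin n) ℝ).toBasis (fderiv ℝ φ y : _ →ₗ[ℝ] _) := by
    ext p i
    have : HasFDerivAt (fun z => φ z p) ((EuclideanSpace.proj p).comp (fderiv ℝ φ y)) y :=
      (EuclideanSpace.proj (𝕜 := ℝ) p).hasFDerivAt.comp y hφ.hasFDerivAt
    rw [jac, Matrix.of_apply, pderiv, this.fderiv, LinearMap.toMatrix_apply]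
    simp
  rw [h, LinearMap.det_toMatrix]

theorem image_transition_overlap (c c' : M) :
    transition c c' '' overlap (n := n) c c' = overlap c' c := by
  have hmap : ∀ c c' : M, ∀ y ∈ overlap (n := n) c c', transition c c' y ∈ overlap (n := n) c' c :=
    fun c c' y hy => ⟨transition_mem c c' hy, by
      change param c' (transition c c' y) ∈ (extChartAt (𝓡 n) c).source
      rw [param_transition c c' hy]; exact param_mem_source hy.1⟩
  apply Set.Subset.antisymm
  · rintro _ ⟨y, hy, rfl⟩
    exact hmap c c' y hy
  · intro z hz
    refine ⟨transition c' c z, hmap c' c z hz, ?_⟩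
    rw [transition, Function.comp_apply, param_transition c' c hz]
    exact (extChartAt (𝓡 n) c').right_inv hz.1

theorem injOn_transition (c c' : M) : Set.InjOn (transition c c') (overlap (n := n) c c') := by
  intro y hy z hz h
  have h1 : param c y = param c z := by
    rw [← param_transition c c' hy, ← param_transition c c' hz, h]
  have h2 := congrArg (extChartAt (𝓡 n) c) h1
  rwa [param, (extChartAt (𝓡 n) c).right_inv hy.1, (extChartAt (𝓡 n) c).right_inv hz.1] at h2

theorem dens_transition (g : Metric n M) (c c' : M) {y : EuclideanSpace ℝ (Fin n)}
    (hy : y ∈ overlap c c') :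
    dens g c y = |(fderiv ℝ (transition c c') y).det| * dens g c' (transition c c' y) := by
  have hd : DifferentiableAt ℝ (transition c c') y :=
    ((contDiffOn_transition c c').contDiffAt
      ((isOpen_overlap c c').mem_nhds hy)).differentiableAt (by simp)
  rw [det_fderiv_eq_det_jac hd, dens, dens, coeff_transition g c c' hy, Matrix.det_mul,
    Matrix.det_mul, Matrix.det_transpose, mul_right_comm, Real.sqrt_mul (mul_self_nonneg _),
    Real.sqrt_mul_self_eq_abs]

/-- The measures of two charts agree on the intersection of their domains. -/
theorem chartVolume_eq_of_subset (g : Metric n M) (c c' : M) {A : Set M} (hA : MeasurableSet A)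
    (hc : A ⊆ (extChartAt (𝓡 n) c).source) (hc' : A ⊆ (extChartAt (𝓡 n) c').source) :
    chartVolume g c A = chartVolume g c' A := by
  have key : ∀ c c' : M, A ⊆ (extChartAt (𝓡 n) c').source → chartVolume g c A =
      ∫⁻ y in overlap c c', ENNReal.ofReal (dens g c y) * A.indicator 1 (param c y) := by
    intro c c' hc'
    rw [← lintegral_indicator_one hA, lintegral_chartVolume g c (measurable_one.indicator hA),
      ← lintegral_indicator (measurableSet_target c),
      ← lintegral_indicator (isOpen_overlap c c').measurableSet]
    refine lintegral_congr fun y => ?_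
    by_cases hy : y ∈ overlap c c'
    · rw [Set.indicator_of_mem hy, Set.indicator_of_mem hy.1]
    · rw [Set.indicator_of_notMem hy]
      by_cases hy1 : y ∈ (extChartAt (𝓡 n) c).target
      · have : param c y ∉ A := fun h => hy ⟨hy1, hc' h⟩
        rw [Set.indicator_of_mem hy1, Set.indicator_of_notMem this, mul_zero]
      · rw [Set.indicator_of_notMem hy1]
  -- Change of variables along the transition map: the absolute Jacobian determinant is exactly the
  -- factor relating the densities in `dens_transition`.
  rw [key c c' hc', key c' c hc, ← image_transition_overlap c c',
    lintegral_image_eq_lintegral_abs_det_fderiv_mul volume (isOpen_overlap c c').measurableSet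
      (f' := fderiv ℝ (transition c c'))
      (fun y hy => (((contDiffOn_transition c c').contDiffAt
        ((isOpen_overlap c c').mem_nhds hy)).differentiableAt
          (by simp)).hasFDerivAt.hasFDerivWithinAt) (injOn_transition c c')]
  refine setLIntegral_congr_fun (isOpen_overlap c c').measurableSet fun y hy => ?_
  simp only [dens_transition g c c' hy, param_transition c c' hy]
  rw [ENNReal.ofReal_mul (abs_nonneg _), mul_assoc]

/-- The Riemannian measure restricts to the measure of every chart. -/
theorem vol_restrict_source (g : Metric n M) (c : M) :
    (vol g).restrict (extChartAt (𝓡 n) c).source = chartVolume g c := by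
  have hself : (chartVolume g c).restrict (extChartAt (𝓡 n) c).source = chartVolume g c :=
    Measure.restrict_eq_self_of_ae_mem (by
      rw [ae_iff]; exact chartVolume_compl_source g c)
  have hS := measurableSet_source (n := n) c
  apply le_antisymm
  · have hle : vol g ≤ chartVolume g c +
        (⊤ : Measure M).restrict (extChartAt (𝓡 n) c).sourceᶜ := by
      refine iSup_le fun c' => Measure.le_iff.2 fun A hA => ?_
      have hsub : A ⊆ (A ∩ (extChartAt (𝓡 n) c).source ∩ (extChartAt (𝓡 n) c').source) ∪
          ((A ∩ (extChartAt (𝓡 n) c).sourceᶜ) ∪ (extChartAt (𝓡 n) c').sourceᶜ) := fun x hx => by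
        by_cases h : x ∈ (extChartAt (𝓡 n) c').source
        · by_cases h' : x ∈ (extChartAt (𝓡 n) c).source
          · exact Or.inl ⟨⟨hx, h'⟩, h⟩
          · exact Or.inr (Or.inl ⟨hx, h'⟩)
        · exact Or.inr (Or.inr h)
      refine (measure_mono hsub).trans ((measure_union_le _ _).trans ?_)
      rw [Measure.add_apply, Measure.restrict_apply hA]
      refine add_le_add ?_ ((measure_union_le _ _).trans ?_)
      · rw [chartVolume_eq_of_subset g c' c ((hA.inter hS).inter (measurableSet_source c'))
          Set.inter_subset_right (Set.inter_subset_left.trans Set.inter_subset_right)]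
        exact measure_mono (Set.inter_subset_left.trans Set.inter_subset_left)
      · rw [chartVolume_compl_source, add_zero]
        exact (le_top : chartVolume g c' ≤ ⊤) _
    refine (Measure.restrict_mono le_rfl hle).trans ?_
    rw [Measure.restrict_add, Measure.restrict_restrict hS, Set.inter_compl_self,
      Measure.restrict_empty, add_zero]
    exact Measure.restrict_le_self
  · refine (le_of_eq hself.symm).trans ?_
    exact Measure.restrict_mono le_rfl (le_iSup (fun c : M => chartVolume g c) c)

theorem exists_finset_sources (n : ℕ) (M : Type*) [TopologicalSpace M] [CompactSpace M]
    [ChartedSpace (EuclideanSpace ℝ (Fin n)) M] :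
    ∃ t : Finset M, ⋃ c ∈ t, (extChartAt (𝓡 n) c).source = Set.univ := by
  obtain ⟨t, ht⟩ := isCompact_univ.elim_finite_subcover
    (fun c : M => (extChartAt (𝓡 n) c).source) (fun c => isOpen_extChartAt_source c)
    (fun x _ => Set.mem_iUnion.2 ⟨x, mem_extChartAt_source (I := 𝓡 n) x⟩)
  exact ⟨t, Set.eq_univ_of_univ_subset ht⟩

/-- A finite family of chart domains covers `M`, and a measure is determined by its restrictions to
a countable cover. -/
theorem eq_vol_of_restrict_eq [CompactSpace M] (g : Metric n M) {μ : Measure M}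
    (h : ∀ c : M, μ.restrict (extChartAt (𝓡 n) c).source = chartVolume g c) : μ = vol g := by
  obtain ⟨t, ht⟩ := exists_finset_sources n M
  refine (Measure.ext_iff_of_biUnion_eq_univ (s := fun c => (extChartAt (𝓡 n) c).source)
    t.countable_toSet ?_).2
    fun c _ => (h c).trans (vol_restrict_source g c).symm
  simpa using ht

theorem lintegral_source (g : Metric n M) (c : M) {f : M → ℝ≥0∞} (hf : Measurable f) :
    ∫⁻ x in (extChartAt (𝓡 n) c).source, f x ∂(vol g) =
      ∫⁻ y in (extChartAt (𝓡 n) c).target, ENNReal.ofReal (dens g c y) * f (param c y) := by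
  rw [vol_restrict_source, lintegral_chartVolume g c hf]

theorem integral_source (g : Metric n M) (c : M) {f : M → ℝ}
    (hf : AEStronglyMeasurable f (vol g)) :
    ∫ x in (extChartAt (𝓡 n) c).source, f x ∂(vol g) =
      ∫ y in (extChartAt (𝓡 n) c).target, dens g c y * f (param c y) := by
  have h := hf.restrict (s := (extChartAt (𝓡 n) c).source)
  rw [vol_restrict_source] at h ⊢
  have h0 : chartVolume g c = ((volume.restrict (extChartAt (𝓡 n) c).target).withDensity
    (fun y => ENNReal.ofReal (dens g c y))).map (param c) := rfl
  rw [h0] at h ⊢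
  rw [integral_map (aemeasurable_param_withDensity g c) h,
    integral_withDensity_eq_integral_toReal_smul₀ (aemeasurable_dens g c).ennreal_ofReal
      (Filter.Eventually.of_forall fun _ => ENNReal.ofReal_lt_top)]
  refine setIntegral_congr_fun (measurableSet_target c) fun y hy => ?_
  simp only [ENNReal.toReal_ofReal (dens_pos g hy).le, smul_eq_mul]

theorem ae_target_of_ae_vol (g : Metric n M) (c : M) {P : M → Prop} (h : ∀ᵐ x ∂(vol g), P x) :
    ∀ᵐ y ∂(volume.restrict (extChartAt (𝓡 n) c).target), P (param c y) := by
  have h1 : ∀ᵐ x ∂(chartVolume g c), P x := by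
    rw [← vol_restrict_source]; exact ae_restrict_of_ae h
  have h2 := ae_of_ae_map (aemeasurable_param_withDensity g c) h1
  rw [ae_withDensity_iff' (aemeasurable_dens g c).ennreal_ofReal] at h2
  filter_upwards [h2, ae_restrict_mem (measurableSet_target c)] with y hy hyt
  exact hy (by simpa using dens_pos g hyt)

theorem measurable_indicator_chart (c : M) :
    Measurable ((extChartAt (𝓡 n) c).source.indicator (extChartAt (𝓡 n) c)) := by
  classical
  rw [← Set.piecewise_eq_indicator]
  exact (continuousOn_extChartAt c).measurable_piecewise continuousOn_const (measurableSet_source c)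

theorem ae_chartVolume_of_ae_target (g : Metric n M) {P : M → Prop} {c : M}
    (h : ∀ᵐ y ∂(volume.restrict (extChartAt (𝓡 n) c).target), P (param c y)) :
    ∀ᵐ x ∂(chartVolume g c), P x := by
  -- The set where `P` fails need not be measurable. It is enlarged in coordinates to a measurable
  -- null set, whose preimage under the chart is then a measurable null set in `M`.
  obtain ⟨B, hB, hBm, hB0⟩ := exists_measurable_superset_of_null (ae_iff.1 h)
  set N : Set M := (extChartAt (𝓡 n) c).source ∩ extChartAt (𝓡 n) c ⁻¹' B with hN
  have hNm : MeasurableSet N := by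
    have h2 : N = (extChartAt (𝓡 n) c).source ∩
        ((extChartAt (𝓡 n) c).source.indicator (extChartAt (𝓡 n) c)) ⁻¹' B := by
      ext x
      refine and_congr_right fun hx => ?_
      rw [Set.mem_preimage, Set.mem_preimage, Set.indicator_of_mem hx]
    rw [h2]
    exact (measurableSet_source c).inter (measurable_indicator_chart c hBm)
  have hN0 : chartVolume g c N = 0 := by
    have hind : AEMeasurable (fun y => N.indicator (1 : M → ℝ≥0∞) (param c y))
        (volume.restrict (extChartAt (𝓡 n) c).target) :=
      (measurable_one.indicator hNm).comp_aemeasurable (aemeasurable_param c)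
    rw [← lintegral_indicator_one hNm, lintegral_chartVolume g c (measurable_one.indicator hNm),
      lintegral_eq_zero_iff' ((aemeasurable_dens g c).ennreal_ofReal.fun_mul hind)]
    have hB' : ∀ᵐ y ∂(volume.restrict (extChartAt (𝓡 n) c).target), y ∉ B := by
      rw [ae_iff]; simpa using hB0
    filter_upwards [hB', ae_restrict_mem (measurableSet_target c)] with y hy hyt
    have : param c y ∉ N := fun h => hy (by
      have := h.2
      rwa [Set.mem_preimage, param, (extChartAt (𝓡 n) c).right_inv hyt] at this)
    simp [this]
  rw [ae_iff]
  refine measure_mono_null (t := N ∪ (extChartAt (𝓡 n) c).sourceᶜ) (fun x hx => ?_)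
    (measure_union_null hN0 (chartVolume_compl_source g c))
  by_cases hs : x ∈ (extChartAt (𝓡 n) c).source
  · refine Or.inl ⟨hs, hB ?_⟩
    have h1 : param c (extChartAt (𝓡 n) c x) = x := (extChartAt (𝓡 n) c).left_inv hs
    change ¬P (param c (extChartAt (𝓡 n) c x))
    rwa [h1]
  · exact Or.inr hs

theorem ae_vol_of_ae_target [CompactSpace M] (g : Metric n M) {P : M → Prop}
    (h : ∀ c : M, ∀ᵐ y ∂(volume.restrict (extChartAt (𝓡 n) c).target), P (param c y)) :
    ∀ᵐ x ∂(vol g), P x := by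
  obtain ⟨t, ht⟩ := exists_finset_sources n M
  rw [← Measure.restrict_univ (μ := vol g), ← ht]
  refine (ae_restrict_biUnion_finset_iff (fun c => (extChartAt (𝓡 n) c).source) t _).2 fun c _ => ?_
  rw [vol_restrict_source]
  exact ae_chartVolume_of_ae_target g (h c)

theorem aestronglyMeasurable_of_param [CompactSpace M] (g : Metric n M) {f : M → ℝ}
    (h : ∀ c : M, AEStronglyMeasurable (fun y => f (param c y))
      (volume.restrict (extChartAt (𝓡 n) c).target)) : AEStronglyMeasurable f (vol g) := by
  obtain ⟨t, ht⟩ := exists_finset_sources n M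
  have ht' : ⋃ c : t, (extChartAt (𝓡 n) (c : M)).source = Set.univ := by
    rw [← ht]; ext x; simp
  rw [← Measure.restrict_univ (μ := vol g), ← ht']
  refine aestronglyMeasurable_iUnion_iff.2 fun ⟨c, _⟩ => ?_
  rw [vol_restrict_source]
  obtain ⟨F, hF, hfF⟩ := h c
  refine ⟨fun x => F ((extChartAt (𝓡 n) c).source.indicator (extChartAt (𝓡 n) c) x),
    hF.comp_measurable (measurable_indicator_chart c), ?_⟩
  refine ae_chartVolume_of_ae_target g ?_
  filter_upwards [hfF, ae_restrict_mem (measurableSet_target c)] with y hy hyt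
  rw [hy, Set.indicator_of_mem (param_mem_source hyt), param, (extChartAt (𝓡 n) c).right_inv hyt]

theorem continuous_of_param {n : ℕ} {M : Type*} [TopologicalSpace M]
    [ChartedSpace (EuclideanSpace ℝ (Fin n)) M] {f : M → ℝ}
    (h : ∀ c : M, ContinuousOn (fun y => f (param c y)) (extChartAt (𝓡 n) c).target) :
    Continuous f := by
  rw [continuous_iff_continuousAt]
  intro x
  have h1 : ContinuousAt (fun z => f (param x (extChartAt (𝓡 n) x z))) x :=
    ContinuousAt.comp (g := fun y => f (param x y)) ((h x).continuousAt
      ((isOpen_target x).mem_nhds (mem_extChartAt_target (I := 𝓡 n) x)))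
      (continuousAt_extChartAt (I := 𝓡 n) x)
  refine h1.congr ?_
  filter_upwards [extChartAt_source_mem_nhds (I := 𝓡 n) x] with z hz
  exact congrArg f ((extChartAt (𝓡 n) x).left_inv hz)

/-- On compact subsets of a chart, Lebesgue measure is controlled by the Riemannian measure. -/
theorem exists_map_restrict_le (g : Metric n M) (c : M) {K : Set (EuclideanSpace ℝ (Fin n))}
    (hK : IsCompact K) (hKt : K ⊆ (extChartAt (𝓡 n) c).target) :
    ∃ C : NNReal, (volume.restrict K).map (param c) ≤ C • vol g := by
  have hpar : AEMeasurable (param c) (volume.restrict K) :=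
    (aemeasurable_param c).mono_measure (Measure.restrict_mono hKt le_rfl)
  obtain ⟨C, hC⟩ : ∃ C : ℝ, ∀ y ∈ K, (dens g c y)⁻¹ ≤ C := by
    have hcont : ContinuousOn (fun y => (dens g c y)⁻¹) K :=
      ((contDiffOn_dens g c).continuousOn.mono hKt).inv₀ fun y hy => (dens_pos g (hKt hy)).ne'
    obtain ⟨C, hC⟩ := (hK.image_of_continuousOn hcont).bddAbove
    exact ⟨C, fun y hy => hC ⟨y, hy, rfl⟩⟩
  refine ⟨C.toNNReal, Measure.le_iff.2 fun A hA => ?_⟩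
  rw [← lintegral_indicator_one hA, lintegral_map' (measurable_one.indicator hA).aemeasurable hpar,
    ← lintegral_indicator_one hA, lintegral_smul_measure]
  calc ∫⁻ y in K, A.indicator 1 (param c y)
      ≤ ∫⁻ y in K, C.toNNReal * (ENNReal.ofReal (dens g c y) * A.indicator 1 (param c y)) := by
        refine setLIntegral_mono' hK.measurableSet fun y hy => ?_
        have hd := dens_pos g (hKt hy)
        have : (1 : ℝ≥0∞) ≤ C.toNNReal * ENNReal.ofReal (dens g c y) := by
          rw [← ENNReal.ofReal, ← ENNReal.ofReal_mul' hd.le, ← ENNReal.ofReal_one]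
          refine ENNReal.ofReal_le_ofReal ?_
          rw [← inv_mul_cancel₀ hd.ne']
          exact mul_le_mul_of_nonneg_right (hC y hy) hd.le
        rw [← mul_assoc]
        exact le_mul_of_one_le_left' this
    _ ≤ ∫⁻ y in (extChartAt (𝓡 n) c).target,
        C.toNNReal * (ENNReal.ofReal (dens g c y) * A.indicator 1 (param c y)) :=
        lintegral_mono_set hKt
    _ = C.toNNReal * ∫⁻ x in (extChartAt (𝓡 n) c).source, A.indicator 1 x ∂(vol g) := by
        rw [lintegral_const_mul' _ _ ENNReal.coe_ne_top,
          lintegral_source g c (measurable_one.indicator hA)]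
    _ ≤ C.toNNReal • ∫⁻ x, A.indicator 1 x ∂(vol g) := by
        rw [ENNReal.smul_def, smul_eq_mul]
        gcongr
        exact Measure.restrict_le_self

/-- Each point has a neighbourhood whose coordinates lie in a compact subset of the chart target,
where the density is bounded. -/
instance isLocallyFiniteMeasure_vol (g : Metric n M) : IsLocallyFiniteMeasure (vol g) := by
  refine ⟨fun x => ?_⟩
  obtain ⟨K, hK, hxK, hKt⟩ := exists_compact_subset (isOpen_target x)
    (mem_extChartAt_target (I := 𝓡 n) x)
  obtain ⟨C, hC⟩ := (hK.image_of_continuousOn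
    ((contDiffOn_dens g x).continuousOn.mono hKt)).bddAbove
  have hopen : IsOpen ((extChartAt (𝓡 n) x).source ∩ extChartAt (𝓡 n) x ⁻¹' interior K) :=
    (continuousOn_extChartAt x).isOpen_inter_preimage (isOpen_extChartAt_source x) isOpen_interior
  refine ⟨_, hopen.mem_nhds ⟨mem_extChartAt_source (I := 𝓡 n) x, hxK⟩, ?_⟩
  set N := (extChartAt (𝓡 n) x).source ∩ extChartAt (𝓡 n) x ⁻¹' interior K
  have h1 : vol g N = chartVolume g x N := by
    rw [← vol_restrict_source, Measure.restrict_eq_self _ Set.inter_subset_left]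
  rw [h1, ← lintegral_indicator_one hopen.measurableSet,
    lintegral_chartVolume g x (measurable_one.indicator hopen.measurableSet)]
  calc _ ≤ ∫⁻ y in (extChartAt (𝓡 n) x).target, K.indicator (fun _ => ENNReal.ofReal C) y := by
        refine setLIntegral_mono' (measurableSet_target x) fun y hy => ?_
        by_cases hyN : param x y ∈ N
        · have hyK : y ∈ K := by
            have := hyN.2
            rw [Set.mem_preimage, param, (extChartAt (𝓡 n) x).right_inv hy] at this
            exact interior_subset this
          rw [Set.indicator_of_mem hyN, Set.indicator_of_mem hyK, Pi.one_apply, mul_one]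
          exact ENNReal.ofReal_le_ofReal (hC ⟨y, hyK, rfl⟩)
        · rw [Set.indicator_of_notMem hyN, mul_zero]
          exact zero_le
    _ ≤ ∫⁻ y, K.indicator (fun _ => ENNReal.ofReal C) y := setLIntegral_le_lintegral _ _
    _ = ENNReal.ofReal C * volume K := lintegral_indicator_const hK.measurableSet _
    _ < (⊤ : ℝ≥0∞) := ENNReal.mul_lt_top ENNReal.ofReal_lt_top hK.measure_lt_top

instance isFiniteMeasure_vol [CompactSpace M] (g : Metric n M) : IsFiniteMeasure (vol g) :=
  inferInstance

end Volume

/-! ### Weak partial derivatives on open subsets of ℝⁿ. -/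

section WeakDerivatives

open Filter Topology

variable {n : ℕ} {Ω : Set (EuclideanSpace ℝ (Fin n))}

/-- A test function on `Ω`. -/
structure IsTest (ψ : EuclideanSpace ℝ (Fin n) → ℝ) (Ω : Set (EuclideanSpace ℝ (Fin n))) :
    Prop where
  contDiff : ContDiff ℝ ∞ ψ
  hasCompactSupport : HasCompactSupport ψ
  tsupport_subset : tsupport ψ ⊆ Ω

theorem pderiv_eq_zero_of_notMem_tsupport {ψ : EuclideanSpace ℝ (Fin n) → ℝ} {i : Fin n}
    {y : EuclideanSpace ℝ (Fin n)} (hy : y ∉ tsupport ψ) : pderiv i ψ y = 0 := by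
  rw [pderiv_congr (notMem_tsupport_iff_eventuallyEq.1 hy)]
  exact pderiv_const i 0 y

theorem tsupport_pderiv_subset (ψ : EuclideanSpace ℝ (Fin n) → ℝ) (i : Fin n) :
    tsupport (pderiv i ψ) ⊆ tsupport ψ :=
  closure_minimal (fun _ hy => by_contra fun h => hy (pderiv_eq_zero_of_notMem_tsupport h))
    (isClosed_tsupport ψ)

namespace IsTest

theorem differentiableAt {ψ : EuclideanSpace ℝ (Fin n) → ℝ} (hψ : IsTest ψ Ω)
    (y : EuclideanSpace ℝ (Fin n)) : DifferentiableAt ℝ ψ y :=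
  hψ.contDiff.contDiffAt.differentiableAt (by simp)

theorem pderiv {ψ : EuclideanSpace ℝ (Fin n) → ℝ} (hψ : IsTest ψ Ω) (i : Fin n) :
    IsTest (pderiv i ψ) Ω where
  contDiff := contDiffOn_univ.1 (contDiffOn_pderiv isOpen_univ hψ.contDiff.contDiffOn)
  hasCompactSupport := hψ.hasCompactSupport.mono' ((subset_tsupport _).trans
    (tsupport_pderiv_subset ψ i))
  tsupport_subset := (tsupport_pderiv_subset ψ i).trans hψ.tsupport_subset

theorem mul {ψ w : EuclideanSpace ℝ (Fin n) → ℝ} (hΩ : IsOpen Ω) (hψ : IsTest ψ Ω)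
    (hw : ContDiffOn ℝ ∞ w Ω) : IsTest (fun y => ψ y * w y) Ω := by
  have hsub : tsupport (fun y => ψ y * w y) ⊆ tsupport ψ := tsupport_mul_subset_left
  refine ⟨contDiff_iff_contDiffAt.2 fun y => ?_, hψ.hasCompactSupport.mul_right,
    hsub.trans hψ.tsupport_subset⟩
  by_cases hy : y ∈ tsupport ψ
  · exact hψ.contDiff.contDiffAt.mul (hw.contDiffAt (hΩ.mem_nhds (hψ.tsupport_subset hy)))
  · refine (contDiffAt_const (c := (0 : ℝ))).congr_of_eventuallyEq ?_
    exact notMem_tsupport_iff_eventuallyEq.1 fun h => hy (hsub h)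

/-- The product rule holds at every point, although `w` may fail to be differentiable outside `Ω`:
off the support of `ψ` all terms vanish. -/
theorem pderiv_mul {ψ w : EuclideanSpace ℝ (Fin n) → ℝ} (hΩ : IsOpen Ω) (hψ : IsTest ψ Ω)
    (hw : ContDiffOn ℝ ∞ w Ω) (i : Fin n) (y : EuclideanSpace ℝ (Fin n)) :
    Yamabe.pderiv i (fun y => ψ y * w y) y =
      Yamabe.pderiv i ψ y * w y + ψ y * Yamabe.pderiv i w y := by
  by_cases hy : y ∈ tsupport ψ
  · exact Yamabe.pderiv_mul (hψ.differentiableAt y)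
      (hw.differentiableAt_of_isOpen hΩ (hψ.tsupport_subset hy))
  · rw [pderiv_eq_zero_of_notMem_tsupport hy, image_eq_zero_of_notMem_tsupport hy,
      pderiv_eq_zero_of_notMem_tsupport fun h => hy (tsupport_mul_subset_left h)]
    ring

theorem integrable_mul {u ψ : EuclideanSpace ℝ (Fin n) → ℝ} (hu : LocallyIntegrableOn u Ω)
    (hψ : IsTest ψ Ω) : Integrable (fun y => u y * ψ y) := by
  have h := (hu.integrableOn_compact_subset hψ.tsupport_subset
    hψ.hasCompactSupport).mul_continuousOn hψ.contDiff.continuous.continuousOn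
      hψ.hasCompactSupport
  refine (integrableOn_iff_integrable_of_support_subset fun y hy => ?_).1 h
  exact subset_tsupport _ (right_ne_zero_of_mul hy)

/-- A cutoff for localization: multiplying by `χ` turns a function on `Ω` into one on all of ℝⁿ
without changing its pairings with `ψ` and the derivatives of `ψ`. -/
theorem exists_eq_one {ψ : EuclideanSpace ℝ (Fin n) → ℝ} (hΩ : IsOpen Ω) (hψ : IsTest ψ Ω) :
    ∃ χ, IsTest χ Ω ∧ ∀ y ∈ tsupport ψ, χ y = 1 ∧ ∀ i, Yamabe.pderiv i χ y = 0 := by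
  obtain ⟨K, hK, hψK, hKΩ⟩ := exists_compact_between hψ.hasCompactSupport hΩ hψ.tsupport_subset
  obtain ⟨χ, h1, h0, -⟩ := exists_contMDiffMap_one_nhds_of_subset_interior (n := (⊤ : ℕ∞))
    (I := 𝓘(ℝ, EuclideanSpace ℝ (Fin n))) (isClosed_tsupport ψ) hψK
  have hsub : tsupport χ ⊆ K := closure_minimal (fun y hy => by_contra fun h => hy (h0 y h))
    hK.isClosed
  refine ⟨χ, ⟨χ.contMDiff.contDiff, hK.of_isClosed_subset (isClosed_tsupport _) hsub,
    hsub.trans hKΩ⟩, fun y hy => ?_⟩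
  have hy1 : ∀ᶠ z in 𝓝 y, χ z = 1 := h1.filter_mono (nhds_le_nhdsSet hy)
  refine ⟨hy1.self_of_nhds, fun i => ?_⟩
  rw [pderiv_congr (g := fun _ => 1) hy1]
  exact pderiv_const i 1 y

end IsTest

/-- `v` is the `i`-th weak partial derivative of `u` on `Ω`. -/
structure IsWeakPDeriv (i : Fin n) (Ω : Set (EuclideanSpace ℝ (Fin n)))
    (u v : EuclideanSpace ℝ (Fin n) → ℝ) : Prop where
  left : LocallyIntegrableOn u Ω
  right : LocallyIntegrableOn v Ω
  integral_eq : ∀ ψ, IsTest ψ Ω → ∫ y, u y * pderiv i ψ y = -∫ y, v y * ψ y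

namespace IsWeakPDeriv

variable {i : Fin n} {u u' v v' w : EuclideanSpace ℝ (Fin n) → ℝ}

theorem add (h : IsWeakPDeriv i Ω u v) (h' : IsWeakPDeriv i Ω u' v') :
    IsWeakPDeriv i Ω (fun y => u y + u' y) (fun y => v y + v' y) where
  left := h.left.add h'.left
  right := h.right.add h'.right
  integral_eq ψ hψ := by
    simp only [add_mul]
    rw [integral_add ((hψ.pderiv i).integrable_mul h.left) ((hψ.pderiv i).integrable_mul h'.left),
      integral_add (hψ.integrable_mul h.right) (hψ.integrable_mul h'.right),
      h.integral_eq ψ hψ, h'.integral_eq ψ hψ]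
    ring

theorem locallyIntegrableOn_mul (hΩ : IsOpen Ω) (hu : LocallyIntegrableOn u Ω)
    (hw : ContinuousOn w Ω) : LocallyIntegrableOn (fun y => w y * u y) Ω :=
  hu.continuousOn_mul hw hΩ.isLocallyClosed

theorem mul_smooth (hΩ : IsOpen Ω) (h : IsWeakPDeriv i Ω u v) (hw : ContDiffOn ℝ ∞ w Ω) :
    IsWeakPDeriv i Ω (fun y => w y * u y) (fun y => w y * v y + pderiv i w y * u y) where
  left := locallyIntegrableOn_mul hΩ h.left hw.continuousOn
  right := (locallyIntegrableOn_mul hΩ h.right hw.continuousOn).add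
    (locallyIntegrableOn_mul hΩ h.left (contDiffOn_pderiv hΩ hw).continuousOn)
  integral_eq ψ hψ := by
    have hψw := hψ.mul hΩ hw
    have hψw' := hψ.mul hΩ (contDiffOn_pderiv (i := i) hΩ hw)
    have h1 : ∀ y, w y * u y * pderiv i ψ y =
        u y * pderiv i (fun y => ψ y * w y) y - u y * (ψ y * pderiv i w y) := fun y => by
      rw [hψ.pderiv_mul hΩ hw]; ring
    have h2 : ∀ y, (w y * v y + pderiv i w y * u y) * ψ y =
        v y * (ψ y * w y) + u y * (ψ y * pderiv i w y) := fun y => by ring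
    simp only [h1, h2]
    rw [integral_sub ((hψw.pderiv i).integrable_mul h.left) (hψw'.integrable_mul h.left),
      integral_add (hψw.integrable_mul h.right) (hψw'.integrable_mul h.left),
      h.integral_eq _ hψw]
    ring

/-- The fundamental lemma of the calculus of variations, applied to `v - v'`. -/
theorem unique (hΩ : IsOpen Ω) (h : IsWeakPDeriv i Ω u v) (h' : IsWeakPDeriv i Ω u v') :
    v =ᵐ[volume.restrict Ω] v' := by
  have := hΩ.ae_eq_zero_of_integral_contDiff_smul_eq_zero (μ := volume) (h.right.sub h'.right)
    fun ψ h1 h2 h3 => by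
      have hψ : IsTest ψ Ω := ⟨h1, h2, h3⟩
      have e : ∀ y, ψ y • (v - v') y = v y * ψ y - v' y * ψ y := fun y => by
        simp only [Pi.sub_apply, smul_eq_mul]; ring
      simp only [e]
      rw [integral_sub (hψ.integrable_mul h.right) (hψ.integrable_mul h'.right)]
      have h4 := h.integral_eq ψ hψ
      have h5 := h'.integral_eq ψ hψ
      linarith
  rw [EventuallyEq, ae_restrict_iff' hΩ.measurableSet]
  filter_upwards [this] with y hy hyΩ
  exact sub_eq_zero.1 (hy hyΩ)

theorem congr_ae (hΩ : IsOpen Ω) (h : IsWeakPDeriv i Ω u v) (hu : u =ᵐ[volume.restrict Ω] u')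
    (hv : v =ᵐ[volume.restrict Ω] v') : IsWeakPDeriv i Ω u' v' := by
  have hloc : ∀ {a b : EuclideanSpace ℝ (Fin n) → ℝ}, LocallyIntegrableOn a Ω →
      a =ᵐ[volume.restrict Ω] b → LocallyIntegrableOn b Ω := fun {a b} ha hab => by
    rw [locallyIntegrableOn_iff hΩ.isLocallyClosed] at ha ⊢
    exact fun K hK hKc => (ha K hK hKc).congr (ae_restrict_of_ae_restrict_of_subset hK hab)
  have hint : ∀ {a b ψ : EuclideanSpace ℝ (Fin n) → ℝ}, IsTest ψ Ω →
      a =ᵐ[volume.restrict Ω] b → ∫ y, a y * ψ y = ∫ y, b y * ψ y := fun {a b ψ} hψ hab => by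
    refine integral_congr_ae ?_
    rw [EventuallyEq, ae_restrict_iff' hΩ.measurableSet] at hab
    filter_upwards [hab] with y hy
    by_cases hyΩ : y ∈ Ω
    · rw [hy hyΩ]
    · rw [image_eq_zero_of_notMem_tsupport fun h => hyΩ (hψ.tsupport_subset h), mul_zero, mul_zero]
  refine ⟨hloc h.left hu, hloc h.right hv, fun ψ hψ => ?_⟩
  rw [← hint (hψ.pderiv i) hu, ← hint hψ hv]
  exact h.integral_eq ψ hψ

end IsWeakPDeriv

/-! ### Mollification -/

/-- A sequence of bump functions that concentrate at the origin. -/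
def bumpSeq (n : ℕ) (k : ℕ) : ContDiffBump (0 : EuclideanSpace ℝ (Fin n)) where
  rIn := 1 / ((k : ℝ) + 1)
  rOut := 2 / ((k : ℝ) + 1)
  rIn_pos := by positivity
  rIn_lt_rOut := by gcongr; norm_num

/-- The mollifications of a function. -/
def mollify (k : ℕ) (f : EuclideanSpace ℝ (Fin n) → ℝ) : EuclideanSpace ℝ (Fin n) → ℝ :=
  convolution ((bumpSeq n k).normed volume) f (ContinuousLinearMap.lsmul ℝ ℝ) volume

theorem ae_tendsto_mollify {f : EuclideanSpace ℝ (Fin n) → ℝ} (hf : LocallyIntegrable f) :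
    ∀ᵐ y, Tendsto (fun k => mollify k f y) atTop (𝓝 (f y)) := by
  -- The outer radius is twice the inner one. The bounded ratio `2` makes the kernels comparable
  -- with averages over balls, so that Lebesgue's differentiation theorem applies.
  refine ContDiffBump.ae_convolution_tendsto_right_of_locallyIntegrable (K := 2) ?_ ?_ hf
  · have := (tendsto_one_div_add_atTop_nhds_zero_nat (𝕜 := ℝ)).const_mul 2
    simpa [bumpSeq, div_eq_mul_inv] using this
  · refine Eventually.of_forall fun k => le_of_eq ?_
    simp only [bumpSeq]; ring

theorem integrable_bump (k : ℕ) : Integrable ((bumpSeq n k).normed volume) :=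
  (bumpSeq n k).integrable_normed

theorem integrable_mollify (k : ℕ) {f : EuclideanSpace ℝ (Fin n) → ℝ} (hf : Integrable f) :
    Integrable (mollify k f) :=
  (integrable_bump k).integrable_convolution _ hf

theorem integral_mollify (k : ℕ) {f : EuclideanSpace ℝ (Fin n) → ℝ} (hf : Integrable f) :
    ∫ y, mollify k f y = ∫ y, f y := by
  rw [mollify, integral_convolution _ (integrable_bump k) hf, (bumpSeq n k).integral_normed]
  simp

theorem mollify_nonneg (k : ℕ) {f : EuclideanSpace ℝ (Fin n) → ℝ} (hf : ∀ y, 0 ≤ f y)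
    (y : EuclideanSpace ℝ (Fin n)) : 0 ≤ mollify k f y :=
  integral_nonneg fun t => mul_nonneg ((bumpSeq n k).nonneg_normed t) (hf _)

theorem mollify_sub (k : ℕ) {f g : EuclideanSpace ℝ (Fin n) → ℝ} (hf : LocallyIntegrable f)
    (hg : LocallyIntegrable g) (y : EuclideanSpace ℝ (Fin n)) :
    mollify k (fun z => f z - g z) y = mollify k f y - mollify k g y := by
  have hc : Continuous ((bumpSeq n k).normed volume) := (bumpSeq n k).continuous_normed
  have hs : HasCompactSupport ((bumpSeq n k).normed volume) := (bumpSeq n k).hasCompactSupport_normed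
  have h1 := hs.convolutionExists_left (ContinuousLinearMap.lsmul ℝ ℝ) hc hf y
  have h2 := hs.convolutionExists_left (ContinuousLinearMap.lsmul ℝ ℝ) hc hg y
  simp only [mollify, convolution]
  rw [← integral_sub h1 h2]
  simp [mul_sub]

/-- A sequence of nonnegative functions that converges almost everywhere with convergence of the
integrals converges in `L¹`. -/
theorem tendsto_integral_abs_sub {α : Type*} [MeasurableSpace α] {μ : Measure α}
    {F : ℕ → α → ℝ} {f : α → ℝ} (hF : ∀ k, Integrable (F k) μ) (hf : Integrable f μ)
    (hF0 : ∀ k x, 0 ≤ F k x) (hf0 : ∀ x, 0 ≤ f x)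
    (hlim : ∀ᵐ x ∂μ, Tendsto (fun k => F k x) atTop (𝓝 (f x)))
    (hint : ∀ k, ∫ x, F k x ∂μ = ∫ x, f x ∂μ) :
    Tendsto (fun k => ∫ x, |F k x - f x| ∂μ) atTop (𝓝 0) := by
  -- Scheffé's argument: `|a - b| = a + b - 2 min a b`, and the minimum is dominated by the limit
  -- `f`.
  have h1 : ∀ k, ∫ x, |F k x - f x| ∂μ = 2 * ∫ x, f x ∂μ - 2 * ∫ x, min (F k x) (f x) ∂μ := by
    intro k
    have e : ∀ x, |F k x - f x| = F k x + f x - 2 * min (F k x) (f x) := fun x => by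
      rcases le_total (F k x) (f x) with h | h
      · rw [min_eq_left h, abs_of_nonpos (by linarith)]; ring
      · rw [min_eq_right h, abs_of_nonneg (by linarith)]; ring
    simp only [e]
    have hm : Integrable (fun x => min (F k x) (f x)) μ := (hF k).inf hf
    have ha : Integrable (fun x => F k x + f x) μ := (hF k).add hf
    rw [integral_sub ha (hm.const_mul 2), integral_add (hF k) hf, hint,
      integral_const_mul]
    ring
  have h2 : Tendsto (fun k => ∫ x, min (F k x) (f x) ∂μ) atTop (𝓝 (∫ x, f x ∂μ)) := by
    refine tendsto_integral_of_dominated_convergence f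
      (fun k => ((hF k).inf hf).aestronglyMeasurable) hf
      (fun k => Eventually.of_forall fun x => ?_) ?_
    · rw [Real.norm_of_nonneg (le_min (hF0 k x) (hf0 x))]
      exact min_le_right _ _
    · filter_upwards [hlim] with x hx
      simpa using hx.min (tendsto_const_nhds (x := f x))
  simp only [h1]
  simpa using (h2.const_mul 2).const_sub (2 * ∫ x, f x ∂μ)

/-- Mollification preserves positivity and the integral, so Scheffé's lemma applies to the positive
and the negative part separately. -/
theorem tendsto_integral_mollify_sub {f : EuclideanSpace ℝ (Fin n) → ℝ} (hf : Integrable f) :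
    Tendsto (fun k => ∫ y, |mollify k f y - f y|) atTop (𝓝 0) := by
  have key : ∀ g : EuclideanSpace ℝ (Fin n) → ℝ, Integrable g → (∀ y, 0 ≤ g y) →
      Tendsto (fun k => ∫ y, |mollify k g y - g y|) atTop (𝓝 0) := fun g hg hg0 =>
    tendsto_integral_abs_sub (fun k => integrable_mollify k hg) hg
      (fun k => mollify_nonneg k hg0) hg0 (ae_tendsto_mollify hg.locallyIntegrable)
      fun k => integral_mollify k hg
  have hp : Integrable (fun y => max (f y) 0) := hf.pos_part
  have hm : Integrable (fun y => max (-f y) 0) := hf.neg_part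
  have hsplit : f = fun y => max (f y) 0 - max (-f y) 0 := by
    ext1 y
    rcases le_total 0 (f y) with h | h
    · rw [max_eq_left h, max_eq_right (by linarith)]; ring
    · rw [max_eq_right h, max_eq_left (by linarith)]; ring
  have hsum := (key _ hp fun y => le_max_right _ _).add (key _ hm fun y => le_max_right _ _)
  rw [add_zero] at hsum
  refine squeeze_zero (fun k => integral_nonneg fun y => abs_nonneg _) (fun k => ?_) hsum
  have i1 : Integrable fun y => |mollify k (fun y => max (f y) 0) y - max (f y) 0| :=
    ((integrable_mollify k hp).sub hp).abs
  have i2 : Integrable fun y => |mollify k (fun y => max (-f y) 0) y - max (-f y) 0| :=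
    ((integrable_mollify k hm).sub hm).abs
  rw [← integral_add i1 i2]
  refine integral_mono ((integrable_mollify k hf).sub hf).abs (i1.add i2) fun y => ?_
  have h1 : mollify k f y = mollify k (fun y => max (f y) 0) y
      - mollify k (fun y => max (-f y) 0) y := by
    rw [← mollify_sub k hp.locallyIntegrable hm.locallyIntegrable, ← hsplit]
  have h2 : f y = max (f y) 0 - max (-f y) 0 := congrFun hsplit y
  calc |mollify k f y - f y| = |(mollify k (fun y => max (f y) 0) y - max (f y) 0)
        - (mollify k (fun y => max (-f y) 0) y - max (-f y) 0)| := by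
        rw [h1]; congr 1; linarith
    _ ≤ _ := abs_sub _ _

theorem contDiff_mollify (k : ℕ) {f : EuclideanSpace ℝ (Fin n) → ℝ} (hf : Integrable f) :
    ContDiff ℝ ∞ (mollify k f) :=
  (bumpSeq n k).hasCompactSupport_normed.contDiff_convolution_left _
    (bumpSeq n k).contDiff_normed hf.locallyIntegrable

theorem mollify_apply (k : ℕ) (f : EuclideanSpace ℝ (Fin n) → ℝ) (x : EuclideanSpace ℝ (Fin n)) :
    mollify k f x = ∫ y, f y * (bumpSeq n k).normed volume (x - y) := by
  rw [mollify, convolution_eq_swap]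
  simp [mul_comm]

/-- The derivative falls on the kernel, and `y ↦ φ(x - y)` is a test function; the definition of the
weak derivative moves it onto `u`, the two minus signs cancelling. -/
theorem pderiv_mollify (k : ℕ) {i : Fin n} {u v : EuclideanSpace ℝ (Fin n) → ℝ}
    (hu : Integrable u) (h : IsWeakPDeriv i Set.univ u v) (x : EuclideanSpace ℝ (Fin n)) :
    pderiv i (mollify k u) x = mollify k v x := by
  set φ := (bumpSeq n k).normed volume with hφ
  have hφs : HasCompactSupport φ := (bumpSeq n k).hasCompactSupport_normed
  have hφc : ContDiff ℝ ∞ φ := (bumpSeq n k).contDiff_normed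
  have hd := hφs.hasFDerivAt_convolution_left (ContinuousLinearMap.lsmul ℝ ℝ)
    (hφc.of_le (by simp)) hu.locallyIntegrable x (μ := volume)
  have hce := (hφs.fderiv (𝕜 := ℝ)).convolutionExists_left
    ((ContinuousLinearMap.lsmul ℝ ℝ).precompL (EuclideanSpace ℝ (Fin n)))
    (hφc.continuous_fderiv (by simp)) hu.locallyIntegrable x
  have htest : IsTest (fun y => φ (x - y)) Set.univ :=
    ⟨hφc.comp (contDiff_const.sub contDiff_id),
      hφs.comp_homeomorph (Homeomorph.subLeft x), Set.subset_univ _⟩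
  have hpd : ∀ y, pderiv i (fun y => φ (x - y)) y = -pderiv i φ (x - y) := fun y => by
    have h1 : HasFDerivAt (fun y => x - y) (-ContinuousLinearMap.id ℝ _) y := by
      simpa using (hasFDerivAt_id (𝕜 := ℝ) y).const_sub x
    have h2 := ((hφc.differentiable (by simp)) (x - y)).hasFDerivAt.comp y h1
    rw [pderiv, show (fun y => φ (x - y)) = φ ∘ fun y => x - y from rfl, h2.fderiv]
    simp [pderiv]
  have h3 := h.integral_eq _ htest
  simp only [hpd, mul_neg, integral_neg, neg_inj] at h3
  rw [mollify_apply k v, ← hφ, ← h3, pderiv, mollify, ← hφ, hd.fderiv]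
  have h4 := (ContinuousLinearMap.apply ℝ ℝ (EuclideanSpace.single i (1 : ℝ))).integral_comp_comm
    hce
  rw [convolution]
  refine Eq.trans h4.symm ?_
  rw [← integral_sub_left_eq_self _ volume x]
  refine integral_congr_ae (Eventually.of_forall fun y => ?_)
  simp [pderiv, mul_comm]

/-! ### The chain rule -/

/-- The cut-off function is integrable on the whole space with an integrable weak derivative there,
as mollification requires. -/
theorem IsWeakPDeriv.mul_test {i : Fin n} {u v χ : EuclideanSpace ℝ (Fin n) → ℝ}
    (h : IsWeakPDeriv i Ω u v) (hΩ : IsOpen Ω) (hχ : IsTest χ Ω) :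
    Integrable (fun y => u y * χ y) ∧ Integrable (fun y => v y * χ y + u y * pderiv i χ y) ∧
    IsWeakPDeriv i Set.univ (fun y => u y * χ y) (fun y => v y * χ y + u y * pderiv i χ y) := by
  have h1 := hχ.integrable_mul h.left
  have h2 := (hχ.integrable_mul h.right).add ((hχ.pderiv i).integrable_mul h.left)
  refine ⟨h1, h2, h1.locallyIntegrable.locallyIntegrableOn _,
    h2.locallyIntegrable.locallyIntegrableOn _, fun ψ hψ => ?_⟩
  have hψ' : ContDiffOn ℝ ∞ ψ Ω := hψ.contDiff.contDiffOn
  have hχψ := hχ.mul hΩ hψ'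
  have hχψ' := (hχ.pderiv i).mul hΩ hψ'
  have e1 : ∀ y, u y * χ y * pderiv i ψ y =
      u y * pderiv i (fun y => χ y * ψ y) y - u y * (pderiv i χ y * ψ y) := fun y => by
    rw [hχ.pderiv_mul hΩ hψ']; ring
  have e2 : ∀ y, (v y * χ y + u y * pderiv i χ y) * ψ y =
      v y * (χ y * ψ y) + u y * (pderiv i χ y * ψ y) := fun y => by ring
  simp only [e1, e2]
  rw [integral_sub ((hχψ.pderiv i).integrable_mul h.left) (hχψ'.integrable_mul h.left),
    integral_add (hχψ.integrable_mul h.right) (hχψ'.integrable_mul h.left),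
    h.integral_eq _ hχψ]
  ring

theorem abs_sub_le_of_deriv_le {F : ℝ → ℝ} {C : ℝ} (hF : Differentiable ℝ F)
    (hC : ∀ t, |deriv F t| ≤ C) (a b : ℝ) : |F a - F b| ≤ C * |a - b| :=
  convex_univ.norm_image_sub_le_of_norm_deriv_le (fun x _ => hF x) (fun x _ => hC x)
    (Set.mem_univ b) (Set.mem_univ a)

theorem IsTest.exists_bound {ψ : EuclideanSpace ℝ (Fin n) → ℝ} (hψ : IsTest ψ Ω) :
    ∃ C, ∀ y, |ψ y| ≤ C := hψ.contDiff.continuous.bounded_above_of_compact_support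
      hψ.hasCompactSupport

theorem tendsto_integral_of_abs {α : Type*} [MeasurableSpace α] {μ : Measure α}
    {F : ℕ → α → ℝ} {f : α → ℝ} (hF : ∀ k, Integrable (F k) μ) (hf : Integrable f μ)
    (h : Tendsto (fun k => ∫ x, |F k x - f x| ∂μ) atTop (𝓝 0)) :
    Tendsto (fun k => ∫ x, F k x ∂μ) atTop (𝓝 (∫ x, f x ∂μ)) := by
  rw [tendsto_iff_dist_tendsto_zero]
  refine squeeze_zero (fun k => dist_nonneg) (fun k => ?_) h
  rw [Real.dist_eq, ← integral_sub (hF k) hf]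
  exact abs_integral_le_integral_abs

/-- The chain rule for weak derivatives. -/
theorem IsWeakPDeriv.comp {i : Fin n} {u v : EuclideanSpace ℝ (Fin n) → ℝ}
    (h : IsWeakPDeriv i Ω u v) (hΩ : IsOpen Ω) {F : ℝ → ℝ} (hF : ContDiff ℝ 1 F) {C : ℝ}
    (hC : ∀ t, |deriv F t| ≤ C) :
    IsWeakPDeriv i Ω (fun y => F (u y)) (fun y => deriv F (u y) * v y) := by
  have hFd : Differentiable ℝ F := hF.differentiable (by simp)
  have hF' : Continuous (deriv F) := hF.continuous_deriv (by simp)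
  have hC0 : 0 ≤ C := (abs_nonneg _).trans (hC 0)
  have hlip := abs_sub_le_of_deriv_le hFd hC
  have hmeas := h.left.aestronglyMeasurable
  have hloc1 : LocallyIntegrableOn (fun y => F (u y)) Ω := by
    rw [locallyIntegrableOn_iff hΩ.isLocallyClosed]
    intro K hK hKc
    have hu := h.left.integrableOn_compact_subset hK hKc
    have hb : IntegrableOn (fun y => |F 0| + C * |u y|) K :=
      (integrableOn_const (hs := hKc.measure_lt_top.ne)).add (hu.abs.const_mul C)
    refine hb.mono' (hF.continuous.comp_aestronglyMeasurable hu.aestronglyMeasurable)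
      (Eventually.of_forall fun y => ?_)
    have := hlip (u y) 0
    rw [sub_zero] at this
    calc |F (u y)| = |F 0 + (F (u y) - F 0)| := by ring_nf
      _ ≤ |F 0| + |F (u y) - F 0| := abs_add_le _ _
      _ ≤ _ := by gcongr
  have hloc2 : LocallyIntegrableOn (fun y => deriv F (u y) * v y) Ω := by
    rw [locallyIntegrableOn_iff hΩ.isLocallyClosed]
    intro K hK hKc
    have hu := h.left.integrableOn_compact_subset hK hKc
    exact (h.right.integrableOn_compact_subset hK hKc).bdd_mul
      (hF'.comp_aestronglyMeasurable hu.aestronglyMeasurable)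
      (Eventually.of_forall fun y => hC (u y))
  refine ⟨hloc1, hloc2, fun ψ hψ => ?_⟩
  obtain ⟨χ, hχ, hχ1⟩ := hψ.exists_eq_one hΩ
  obtain ⟨hU, hV, hUV⟩ := h.mul_test hΩ hχ
  set U := fun y => u y * χ y with hUdef
  set V := fun y => v y * χ y + u y * pderiv i χ y with hVdef
  have eU : ∀ y ∈ tsupport ψ, U y = u y := fun y hy => by simp [U, (hχ1 y hy).1]
  have eV : ∀ y ∈ tsupport ψ, V y = v y := fun y hy => by
    simp [V, (hχ1 y hy).1, (hχ1 y hy).2 i]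
  have e1 : ∀ y, F (u y) * pderiv i ψ y = F (U y) * pderiv i ψ y := fun y => by
    by_cases hy : y ∈ tsupport ψ
    · rw [eU y hy]
    · rw [pderiv_eq_zero_of_notMem_tsupport hy, mul_zero, mul_zero]
  have e2 : ∀ y, deriv F (u y) * v y * ψ y = deriv F (U y) * V y * ψ y := fun y => by
    by_cases hy : y ∈ tsupport ψ
    · rw [eU y hy, eV y hy]
    · rw [image_eq_zero_of_notMem_tsupport hy, mul_zero, mul_zero]
  simp only [e1, e2]
  -- After mollification the chain rule is the classical one, followed by ordinary integration by
  -- parts; it remains to pass to the limit on both sides.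
  have hmol : ∀ k, IsWeakPDeriv i Set.univ (fun y => F (mollify k U y))
      (fun y => deriv F (mollify k U y) * mollify k V y) := fun k => by
    have hc := contDiff_mollify k hU
    have hdiff : Differentiable ℝ (mollify k U) := hc.differentiable (by simp)
    have hpd : ∀ y, pderiv i (fun z => F (mollify k U z)) y =
        deriv F (mollify k U y) * mollify k V y := fun y => by
      rw [pderiv_scalar_comp (hFd _).hasDerivAt (hdiff y), pderiv_mollify k hU hUV]
    have hcont : Continuous fun y => deriv F (mollify k U y) * mollify k V y :=
      (hF'.comp hc.continuous).mul (contDiff_mollify k hV).continuous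
    refine ⟨(hF.continuous.comp hc.continuous).continuousOn.locallyIntegrableOn
      isOpen_univ.measurableSet, hcont.continuousOn.locallyIntegrableOn isOpen_univ.measurableSet,
      fun θ hθ => ?_⟩
    simp only [← hpd]
    have hFc : Differentiable ℝ fun z => F (mollify k U z) := hFd.comp hdiff
    refine integral_mul_fderiv_eq_neg_fderiv_mul_of_integrable ?_ ?_ ?_
      (fun y _ => hFc y) (fun y _ => hθ.differentiableAt y)
    · refine hθ.integrable_mul (u := pderiv i fun z => F (mollify k U z)) ?_
      rw [funext hpd]
      exact hcont.continuousOn.locallyIntegrableOn isOpen_univ.measurableSet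
    · exact (hθ.pderiv i).integrable_mul (hFc.continuous.continuousOn.locallyIntegrableOn
        isOpen_univ.measurableSet)
    · exact hθ.integrable_mul (hFc.continuous.continuousOn.locallyIntegrableOn
        isOpen_univ.measurableSet)
  have hψu : IsTest ψ Set.univ := ⟨hψ.contDiff, hψ.hasCompactSupport, Set.subset_univ _⟩
  obtain ⟨C1, hC1⟩ := (hψ.pderiv i).exists_bound
  obtain ⟨C2, hC2⟩ := hψ.exists_bound
  have hC1' : 0 ≤ C1 := (abs_nonneg _).trans (hC1 0)
  have hC2' : 0 ≤ C2 := (abs_nonneg _).trans (hC2 0)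
  have hIU : Integrable fun y => F (U y) * pderiv i ψ y := by
    simpa only [e1] using (hψ.pderiv i).integrable_mul hloc1
  have hIV : Integrable fun y => deriv F (U y) * V y * ψ y := by
    simpa only [e2] using hψ.integrable_mul hloc2
  have hl1 : Tendsto (fun k => ∫ y, F (mollify k U y) * pderiv i ψ y) atTop
      (𝓝 (∫ y, F (U y) * pderiv i ψ y)) := by
    have hI := fun k => (hψu.pderiv i).integrable_mul (hmol k).left
    refine tendsto_integral_of_abs hI hIU ?_
    have hz := (tendsto_integral_mollify_sub hU).const_mul (C * C1)
    rw [mul_zero] at hz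
    refine squeeze_zero (fun k => integral_nonneg fun y => abs_nonneg _) (fun k => ?_) hz
    rw [← integral_const_mul]
    refine integral_mono ((hI k).sub hIU).abs
      (((integrable_mollify k hU).sub hU).abs.const_mul _) fun y => ?_
    simp only [← sub_mul, abs_mul]
    calc _ ≤ C * |mollify k U y - U y| * C1 := by
          gcongr
          · exact hlip _ _
          · exact hC1 y
      _ = _ := by ring
  -- The product is split in two. One part converges because `mollify k V → V` in L¹ and `deriv F`
  -- is bounded, the other by dominated convergence, since `deriv F` is continuous and bounded and
  -- `mollify k U → U` almost everywhere.
  have hl2 : Tendsto (fun k => ∫ y, deriv F (mollify k U y) * mollify k V y * ψ y) atTop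
      (𝓝 (∫ y, deriv F (U y) * V y * ψ y)) := by
    have hI := fun k => hψu.integrable_mul (hmol k).right
    refine tendsto_integral_of_abs hI hIV ?_
    have hmk : ∀ k, Continuous (mollify k U) := fun k => (contDiff_mollify k hU).continuous
    have hz1 := (tendsto_integral_mollify_sub hV).const_mul (C * C2)
    rw [mul_zero] at hz1
    have hIk : ∀ k, Integrable fun y => |deriv F (mollify k U y) - deriv F (U y)| * (|V y| * C2) :=
      fun k => by
      refine (hV.abs.mul_const C2).bdd_mul (c := 2 * C) ?_ (Eventually.of_forall fun y => ?_)
      · exact ((hF'.comp (hmk k)).aestronglyMeasurable.sub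
          (hF'.comp_aestronglyMeasurable hU.aestronglyMeasurable)).norm
      · rw [Real.norm_eq_abs, abs_abs]
        calc _ ≤ |deriv F (mollify k U y)| + |deriv F (U y)| := abs_sub _ _
          _ ≤ 2 * C := by linarith [hC (mollify k U y), hC (U y)]
    have hz2 : Tendsto (fun k => ∫ y, |deriv F (mollify k U y) - deriv F (U y)| * (|V y| * C2))
        atTop (𝓝 0) := by
      have : (0 : ℝ) = ∫ y : EuclideanSpace ℝ (Fin n), (0 : ℝ) := by simp
      rw [this]
      refine tendsto_integral_of_dominated_convergence (fun y => 2 * C * (|V y| * C2))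
        (fun k => (hIk k).aestronglyMeasurable) ((hV.abs.mul_const C2).const_mul _)
        (fun k => Eventually.of_forall fun y => ?_) ?_
      · rw [Real.norm_of_nonneg (by positivity)]
        gcongr
        calc _ ≤ |deriv F (mollify k U y)| + |deriv F (U y)| := abs_sub _ _
          _ ≤ 2 * C := by linarith [hC (mollify k U y), hC (U y)]
      · filter_upwards [ae_tendsto_mollify hU.locallyIntegrable] with y hy
        have h1 := ((hF'.tendsto (U y)).comp hy).sub_const (deriv F (U y))
        simpa using (h1.abs).mul_const (|V y| * C2)
    have hz := hz1.add hz2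
    rw [add_zero] at hz
    refine squeeze_zero (fun k => integral_nonneg fun y => abs_nonneg _) (fun k => ?_) hz
    have i1 : Integrable fun y => C * C2 * |mollify k V y - V y| :=
      ((integrable_mollify k hV).sub hV).abs.const_mul (C * C2)
    rw [← integral_const_mul, ← integral_add i1 (hIk k)]
    refine integral_mono ((hI k).sub hIV).abs (i1.add (hIk k)) fun y => ?_
    have e : deriv F (mollify k U y) * mollify k V y * ψ y - deriv F (U y) * V y * ψ y =
        deriv F (mollify k U y) * (mollify k V y - V y) * ψ y +
          (deriv F (mollify k U y) - deriv F (U y)) * (V y * ψ y) := by ring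
    simp only [e]
    refine (abs_add_le _ _).trans (add_le_add ?_ ?_)
    · rw [abs_mul, abs_mul]
      calc _ ≤ C * |mollify k V y - V y| * C2 := by
            gcongr
            · exact hC _
            · exact hC2 y
        _ = _ := by ring
    · rw [abs_mul, abs_mul]
      gcongr
      exact hC2 y
  refine tendsto_nhds_unique hl1 ?_
  simp only [fun k => (hmol k).integral_eq ψ hψu]
  exact hl2.neg

/-- This function has bounded derivative for `δ > 0`, so the chain rule covers it, and it tends to
`t²` from below as `δ → 0`. -/
theorem hasDerivAt_truncSq (δ t : ℝ) : HasDerivAt (fun t => t ^ 2 / (1 + (δ * t) ^ 2))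
    (2 * t / (1 + (δ * t) ^ 2) ^ 2) t := by
  have h0 : 1 + (δ * t) ^ 2 ≠ 0 := by positivity
  have h1 : HasDerivAt (fun t : ℝ => t ^ 2) (2 * t) t := by simpa using hasDerivAt_pow 2 t
  have h2 : HasDerivAt (fun t : ℝ => 1 + (δ * t) ^ 2) (2 * (δ * t) * δ) t := by
    simpa using (((hasDerivAt_id t).const_mul δ).pow 2).const_add 1
  convert! h1.div h2 h0 using 1
  field_simp
  ring

theorem contDiff_truncSq (δ : ℝ) : ContDiff ℝ 1 (fun t : ℝ => t ^ 2 / (1 + (δ * t) ^ 2)) :=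
  (contDiff_id.pow 2).div (contDiff_const.add ((contDiff_const.mul contDiff_id).pow 2))
    fun t => by positivity

/-- The square is not Lipschitz, so the chain rule is applied to its truncations and dominated
convergence removes the truncation. Conformal invariance of the energy uses this for `u²` with `u`
in H¹. -/
theorem IsWeakPDeriv.sq {i : Fin n} {u v : EuclideanSpace ℝ (Fin n) → ℝ}
    (h : IsWeakPDeriv i Ω u v) (hΩ : IsOpen Ω) (hu : LocallyIntegrableOn (fun y => u y ^ 2) Ω)
    (huv : LocallyIntegrableOn (fun y => u y * v y) Ω) :
    IsWeakPDeriv i Ω (fun y => u y ^ 2) (fun y => 2 * (u y * v y)) := by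
  have huv2 : LocallyIntegrableOn (fun y => 2 * (u y * v y)) Ω := huv.smul (2 : ℝ)
  refine ⟨hu, huv2, fun ψ hψ => ?_⟩
  set δ : ℕ → ℝ := fun k => 1 / ((k : ℝ) + 1) with hδ
  have hδ0 : ∀ k, 0 < δ k := fun k => by positivity
  have hδlim : Tendsto δ atTop (𝓝 0) := tendsto_one_div_add_atTop_nhds_zero_nat
  have hder : ∀ k t, deriv (fun t : ℝ => t ^ 2 / (1 + (δ k * t) ^ 2)) t =
      2 * t / (1 + (δ k * t) ^ 2) ^ 2 := fun k t => (hasDerivAt_truncSq (δ k) t).deriv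
  have hk : ∀ k, IsWeakPDeriv i Ω (fun y => u y ^ 2 / (1 + (δ k * u y) ^ 2))
      (fun y => 2 * u y / (1 + (δ k * u y) ^ 2) ^ 2 * v y) := fun k => by
    -- The bound `(δ k)⁻¹` comes from `2|δt| ≤ 1 + (δt)²`.
    have := h.comp hΩ (contDiff_truncSq (δ k)) (C := (δ k)⁻¹) fun t => by
      rw [hder, abs_div, abs_of_nonneg (a := (1 + (δ k * t) ^ 2) ^ 2) (by positivity),
        div_le_iff₀ (by positivity)]
      have h1 : |2 * t| ≤ (δ k)⁻¹ * (1 + (δ k * t) ^ 2) := by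
        rw [← div_eq_inv_mul, le_div_iff₀ (hδ0 k), ← abs_of_pos (hδ0 k), ← abs_mul,
          abs_of_pos (hδ0 k)]
        rw [abs_le]
        constructor <;> nlinarith [sq_nonneg (δ k * t - 1), sq_nonneg (δ k * t + 1)]
      refine h1.trans ?_
      have : 1 ≤ 1 + (δ k * t) ^ 2 := by nlinarith [sq_nonneg (δ k * t)]
      have hp : 0 < (δ k)⁻¹ := inv_pos.2 (hδ0 k)
      gcongr
      nlinarith
    simpa only [hder] using this
  have hone : ∀ k t, 1 ≤ 1 + (δ k * t) ^ 2 := fun k t => by nlinarith [sq_nonneg (δ k * t)]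
  have hlim : ∀ t : ℝ, Tendsto (fun k => 1 + (δ k * t) ^ 2) atTop (𝓝 1) := fun t => by
    simpa using ((hδlim.mul_const t).pow 2).const_add 1
  have hl1 : Tendsto (fun k => ∫ y, u y ^ 2 / (1 + (δ k * u y) ^ 2) * pderiv i ψ y) atTop
      (𝓝 (∫ y, u y ^ 2 * pderiv i ψ y)) := by
    refine tendsto_integral_of_dominated_convergence _
      (fun k => ((hψ.pderiv i).integrable_mul (hk k).left).aestronglyMeasurable)
      ((hψ.pderiv i).integrable_mul hu).norm (fun k => Eventually.of_forall fun y => ?_)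
      (Eventually.of_forall fun y => ?_)
    · rw [norm_mul, norm_mul, norm_div]
      gcongr
      refine div_le_self (norm_nonneg _) ?_
      rw [Real.norm_of_nonneg (by positivity)]
      exact hone k _
    · have := (((hlim (u y)).inv₀ one_ne_zero).const_mul (u y ^ 2)).mul_const (pderiv i ψ y)
      simpa [div_eq_mul_inv] using this
  have hl2 : Tendsto (fun k => ∫ y, 2 * u y / (1 + (δ k * u y) ^ 2) ^ 2 * v y * ψ y) atTop
      (𝓝 (∫ y, 2 * (u y * v y) * ψ y)) := by
    refine tendsto_integral_of_dominated_convergence _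
      (fun k => (hψ.integrable_mul (hk k).right).aestronglyMeasurable)
      (hψ.integrable_mul huv2).norm (fun k => Eventually.of_forall fun y => ?_)
      (Eventually.of_forall fun y => ?_)
    · rw [norm_mul, norm_mul, norm_mul _ (ψ y), ← mul_assoc 2 (u y), norm_mul _ (v y), norm_div]
      gcongr
      refine div_le_self (norm_nonneg _) ?_
      rw [Real.norm_of_nonneg (by positivity)]
      exact one_le_pow₀ (hone k _)
    · have := (((((hlim (u y)).pow 2).inv₀ (by norm_num)).const_mul (2 * u y)).mul_const
        (v y)).mul_const (ψ y)
      simpa [div_eq_mul_inv, mul_assoc] using this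
  refine tendsto_nhds_unique hl1 ?_
  simp only [fun k => (hk k).integral_eq ψ hψ]
  exact hl2.neg

end WeakDerivatives

/-! ### Weak gradients on the manifold and algebra of the energy form. -/

section WeakGradients

open Filter Topology

variable {n : ℕ} {M : Type*} [TopologicalSpace M] [CompactSpace M]
  [ChartedSpace (EuclideanSpace ℝ (Fin n)) M] [IsManifold (𝓡 n) ∞ M]
  [MeasurableSpace M] [BorelSpace M] {g : Metric n M}

/-- The `i`-th covariant component of a vector field in the chart at `c`. -/
def covComp (g : Metric n M) (X : ∀ x : M, TangentSpace (𝓡 n) x) (c : M) (i : Fin n)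
    (y : EuclideanSpace ℝ (Fin n)) : ℝ :=
  g.inner (param c y) (X (param c y)) (coordVec c i y)

theorem inner_self_nonneg (g : Metric n M) (x : M) (v : TangentSpace (𝓡 n) x) :
    0 ≤ g.inner x v v := by
  by_cases h : v = 0
  · simp [h]
  · exact (g.pos x v h).le

theorem inner_add_self (g : Metric n M) (x : M) (v w : TangentSpace (𝓡 n) x) :
    g.inner x (v + w) (v + w) = g.inner x v v + 2 * g.inner x v w + g.inner x w w := by
  simp only [map_add, _root_.add_apply, g.symm x w v]
  ring

theorem inner_sub_self (g : Metric n M) (x : M) (v w : TangentSpace (𝓡 n) x) :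
    g.inner x (v - w) (v - w) = g.inner x v v - 2 * g.inner x v w + g.inner x w w := by
  simp only [map_sub, _root_.sub_apply, g.symm x w v]
  ring

theorem inner_smul_self (g : Metric n M) (x : M) (r : ℝ) (v : TangentSpace (𝓡 n) x) :
    g.inner x (r • v) (r • v) = r ^ 2 * g.inner x v v := by
  simp only [map_smul, _root_.smul_apply, smul_eq_mul]
  ring

theorem two_mul_abs_inner_le (g : Metric n M) (x : M) (v w : TangentSpace (𝓡 n) x) :
    2 * |g.inner x v w| ≤ g.inner x v v + g.inner x w w := by
  have h1 := inner_self_nonneg g x (v + w)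
  have h2 := inner_self_nonneg g x (v - w)
  rw [inner_add_self] at h1
  rw [inner_sub_self] at h2
  rcases abs_cases (g.inner x v w) with h | h <;> linarith

theorem locallyIntegrableOn_comp_param (g : Metric n M) {f : M → ℝ} (hf : Integrable f (vol g))
    (c : M) : LocallyIntegrableOn (fun y => f (param c y)) (extChartAt (𝓡 n) c).target := by
  rw [locallyIntegrableOn_iff (isOpen_target c).isLocallyClosed]
  intro K hK hKc
  obtain ⟨C, hC⟩ := exists_map_restrict_le g c hKc hK
  exact (hf.smul_measure_nnreal.mono_measure hC).comp_aemeasurable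
    ((aemeasurable_param c).mono_measure (Measure.restrict_mono hK le_rfl))

/-- On compact subsets of a chart, integrals are controlled by integrals over the manifold. -/
theorem exists_setIntegral_comp_param_le (g : Metric n M) (c : M)
    {K : Set (EuclideanSpace ℝ (Fin n))} (hKc : IsCompact K)
    (hK : K ⊆ (extChartAt (𝓡 n) c).target) :
    ∃ C : ℝ, 0 ≤ C ∧ ∀ f : M → ℝ, Integrable f (vol g) → (∀ x, 0 ≤ f x) →
      ∫ y in K, f (param c y) ≤ C * ∫ x, f x ∂(vol g) := by
  obtain ⟨C, hC⟩ := exists_map_restrict_le g c hKc hK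
  refine ⟨C, C.2, fun f hf hf0 => ?_⟩
  have hpar := (aemeasurable_param c).mono_measure (Measure.restrict_mono hK le_rfl)
  have hfC : Integrable f (C • vol g) := hf.smul_measure_nnreal
  rw [← integral_map (f := f) hpar (hfC.mono_measure hC).aestronglyMeasurable]
  refine (integral_mono_measure hC (Eventually.of_forall hf0) hfC).trans ?_
  rw [integral_smul_nnreal_measure]
  rfl

/-- `X` is a weak gradient of `u`, and both are of class `L²`. -/
structure HasGrad (g : Metric n M) (u : M → ℝ) (X : ∀ x : M, TangentSpace (𝓡 n) x) : Prop where
  memLp : MemLp u 2 (vol g)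
  isWeakGradient : IsWeakGradient g u X
  integrable : Integrable (fun x => g.inner x (X x) (X x)) (vol g)

theorem mem_H1_iff {u : M → ℝ} : u ∈ H1 g ↔ ∃ X, HasGrad g u X :=
  ⟨fun ⟨h1, X, h2, h3⟩ => ⟨X, h1, h2, h3⟩, fun ⟨X, h⟩ => ⟨h.1, X, h.2, h.3⟩⟩

theorem isWeakPDeriv_of_isWeakGradient {u : M → ℝ} {X : ∀ x : M, TangentSpace (𝓡 n) x}
    (hu : MemLp u 2 (vol g)) (h : IsWeakGradient g u X) (c : M) (i : Fin n) :
    IsWeakPDeriv i (extChartAt (𝓡 n) c).target (fun y => u (param c y)) (covComp g X c i) :=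
  ⟨locallyIntegrableOn_comp_param g (hu.integrable (by norm_num)) c, (h c i).1,
    fun ψ hψ => (h c i).2 ψ hψ.1 hψ.2 hψ.3⟩

theorem isWeakGradient_of_isWeakPDeriv {u : M → ℝ} {X : ∀ x : M, TangentSpace (𝓡 n) x}
    (h : ∀ c i, IsWeakPDeriv i (extChartAt (𝓡 n) c).target (fun y => u (param c y))
      (covComp g X c i)) : IsWeakGradient g u X :=
  fun c i => ⟨(h c i).right, fun ψ h1 h2 h3 => (h c i).integral_eq ψ ⟨h1, h2, h3⟩⟩

theorem HasGrad.isWeakPDeriv {u : M → ℝ} {X : ∀ x : M, TangentSpace (𝓡 n) x}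
    (h : HasGrad g u X) (c : M) (i : Fin n) :
    IsWeakPDeriv i (extChartAt (𝓡 n) c).target (fun y => u (param c y)) (covComp g X c i) :=
  isWeakPDeriv_of_isWeakGradient h.memLp h.isWeakGradient c i

theorem isWeakGradient_ae_unique {u : M → ℝ} {X Y : ∀ x : M, TangentSpace (𝓡 n) x}
    (hu : MemLp u 2 (vol g)) (hX : IsWeakGradient g u X) (hY : IsWeakGradient g u Y) :
    ∀ᵐ x ∂(vol g), X x = Y x := by
  refine ae_vol_of_ae_target g fun c => ?_
  have h := fun i => (isWeakPDeriv_of_isWeakGradient hu hX c i).unique (isOpen_target c)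
    (isWeakPDeriv_of_isWeakGradient hu hY c i)
  filter_upwards [eventually_all.2 h, ae_restrict_mem (measurableSet_target c)] with y hy hyt
  exact tangent_ext g hyt hy

theorem aestronglyMeasurable_inner {X Y : ∀ x : M, TangentSpace (𝓡 n) x}
    (hX : ∀ c i, AEStronglyMeasurable (covComp g X c i)
      (volume.restrict (extChartAt (𝓡 n) c).target))
    (hY : ∀ c i, AEStronglyMeasurable (covComp g Y c i)
      (volume.restrict (extChartAt (𝓡 n) c).target)) :
    AEStronglyMeasurable (fun x => g.inner x (X x) (Y x)) (vol g) := by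
  refine aestronglyMeasurable_of_param g fun c => ?_
  have h : AEStronglyMeasurable (fun y => ∑ i, ∑ j, (coeff g c y)⁻¹ i j *
      covComp g X c j y * covComp g Y c i y) (volume.restrict (extChartAt (𝓡 n) c).target) := by
    refine Finset.aestronglyMeasurable_fun_sum _ fun i _ =>
      Finset.aestronglyMeasurable_fun_sum _ fun j _ => ?_
    exact (((((metricField_coeff g c).smooth_inv i j).continuousOn.aestronglyMeasurable
      (measurableSet_target c)).mul (hX c j)).mul (hY c i))
  refine h.congr ?_
  filter_upwards [ae_restrict_mem (measurableSet_target c)] with y hy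
  exact (inner_eq_sum g hy _ _).symm

theorem HasGrad.aestronglyMeasurable_comp {u : M → ℝ} {X : ∀ x : M, TangentSpace (𝓡 n) x}
    (h : HasGrad g u X) (c : M) (i : Fin n) : AEStronglyMeasurable (covComp g X c i)
      (volume.restrict (extChartAt (𝓡 n) c).target) :=
  (h.isWeakPDeriv c i).right.aestronglyMeasurable

theorem HasGrad.integrable_inner {u v : M → ℝ} {X Y : ∀ x : M, TangentSpace (𝓡 n) x}
    (hX : HasGrad g u X) (hY : HasGrad g v Y) :
    Integrable (fun x => g.inner x (X x) (Y x)) (vol g) := by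
  refine (hX.integrable.add hY.integrable).mono'
    (aestronglyMeasurable_inner hX.aestronglyMeasurable_comp hY.aestronglyMeasurable_comp)
    (Eventually.of_forall fun x => ?_)
  rw [Real.norm_eq_abs]
  have := two_mul_abs_inner_le g x (X x) (Y x)
  have h0 := abs_nonneg (g.inner x (X x) (Y x))
  simp only [Pi.add_apply]
  linarith

theorem HasGrad.add {u v : M → ℝ} {X Y : ∀ x : M, TangentSpace (𝓡 n) x}
    (hX : HasGrad g u X) (hY : HasGrad g v Y) :
    HasGrad g (fun x => u x + v x) (fun x => X x + Y x) where
  memLp := hX.memLp.add hY.memLp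
  isWeakGradient := isWeakGradient_of_isWeakPDeriv fun c i => by
    convert! (hX.isWeakPDeriv c i).add (hY.isWeakPDeriv c i) using 1
    ext1 y
    simp [covComp]
  integrable := by
    simp only [inner_add_self]
    exact (hX.integrable.add ((hX.integrable_inner hY).const_mul 2)).add hY.integrable

theorem covComp_smul (g : Metric n M) (r : M → ℝ) (X : ∀ x : M, TangentSpace (𝓡 n) x) (c : M)
    (i : Fin n) (y : EuclideanSpace ℝ (Fin n)) :
    covComp g (fun x => r x • X x) c i y = r (param c y) * covComp g X c i y := by
  simp [covComp]

theorem covComp_add (g : Metric n M) (X Y : ∀ x : M, TangentSpace (𝓡 n) x) (c : M)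
    (i : Fin n) (y : EuclideanSpace ℝ (Fin n)) :
    covComp g (fun x => X x + Y x) c i y = covComp g X c i y + covComp g Y c i y := by
  simp [covComp]

theorem HasGrad.const_mul {u : M → ℝ} {X : ∀ x : M, TangentSpace (𝓡 n) x} (r : ℝ)
    (hX : HasGrad g u X) : HasGrad g (fun x => r * u x) (fun x => r • X x) where
  memLp := hX.memLp.const_mul r
  isWeakGradient := isWeakGradient_of_isWeakPDeriv fun c i => by
    have := (hX.isWeakPDeriv c i).mul_smooth (isOpen_target c) (w := fun _ => r) contDiffOn_const
    convert! this using 1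
    ext1 y
    rw [covComp_smul g (fun _ => r), pderiv_const]
    ring
  integrable := by
    simp only [inner_smul_self]
    exact hX.integrable.const_mul _

theorem HasGrad.sub {u v : M → ℝ} {X Y : ∀ x : M, TangentSpace (𝓡 n) x}
    (hX : HasGrad g u X) (hY : HasGrad g v Y) :
    HasGrad g (fun x => u x - v x) (fun x => X x - Y x) := by
  have := hX.add (hY.const_mul (-1))
  simpa [sub_eq_add_neg] using this

theorem HasGrad.aestronglyMeasurable {u : M → ℝ} {X : ∀ x : M, TangentSpace (𝓡 n) x}
    (hX : HasGrad g u X) : AEStronglyMeasurable u (vol g) := hX.memLp.aestronglyMeasurable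

/-- The chain rule in `H¹`. -/
theorem HasGrad.comp {u : M → ℝ} {X : ∀ x : M, TangentSpace (𝓡 n) x} (hX : HasGrad g u X)
    {F : ℝ → ℝ} (hF : ContDiff ℝ 1 F) {C : ℝ} (hC : ∀ t, |deriv F t| ≤ C) :
    HasGrad g (fun x => F (u x)) (fun x => deriv F (u x) • X x) := by
  have hF' : Continuous (deriv F) := hF.continuous_deriv (by simp)
  have hlip := abs_sub_le_of_deriv_le (hF.differentiable (by simp)) hC
  have hC0 : 0 ≤ C := (abs_nonneg _).trans (hC 0)
  have hmeas := hF'.comp_aestronglyMeasurable hX.aestronglyMeasurable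
  refine ⟨?_, isWeakGradient_of_isWeakPDeriv fun c i => ?_, ?_⟩
  · have h1 : MemLp (fun _ : M => |F 0|) 2 (vol g) := memLp_const _
    have h2 : MemLp (fun x => C * |u x|) 2 (vol g) := hX.memLp.norm.const_mul C
    have hb : MemLp (fun x => |F 0| + C * |u x|) 2 (vol g) := h1.add h2
    refine hb.of_le (hF.continuous.comp_aestronglyMeasurable hX.aestronglyMeasurable)
      (Eventually.of_forall fun x => ?_)
    rw [Real.norm_eq_abs, Real.norm_of_nonneg
      (add_nonneg (abs_nonneg _) (mul_nonneg hC0 (abs_nonneg _)))]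
    have := hlip (u x) 0
    rw [sub_zero] at this
    calc |F (u x)| = |F 0 + (F (u x) - F 0)| := by ring_nf
      _ ≤ |F 0| + |F (u x) - F 0| := abs_add_le _ _
      _ ≤ _ := by gcongr
  · convert! (hX.isWeakPDeriv c i).comp (isOpen_target c) hF hC using 1
    ext1 y
    exact covComp_smul g (fun x => deriv F (u x)) X c i y
  · simp only [inner_smul_self]
    refine hX.integrable.bdd_mul (c := C ^ 2) (hmeas.pow 2) (Eventually.of_forall fun x => ?_)
    rw [norm_pow]
    exact pow_le_pow_left₀ (norm_nonneg _) (hC _) 2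

theorem weakGradient_spec {u : M → ℝ} {X : ∀ x : M, TangentSpace (𝓡 n) x}
    (h : IsWeakGradient g u X) : IsWeakGradient g u (weakGradient g u) :=
  Classical.epsilon_spec ⟨X, h⟩

theorem HasGrad.weakGradient_ae_eq {u : M → ℝ} {X : ∀ x : M, TangentSpace (𝓡 n) x}
    (h : HasGrad g u X) : ∀ᵐ x ∂(vol g), weakGradient g u x = X x :=
  isWeakGradient_ae_unique h.memLp (weakGradient_spec h.isWeakGradient) h.isWeakGradient

/-- The gradient in `form` is an arbitrary choice of weak gradient. By almost everywhere uniqueness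
any other one of class L² computes the same value. -/
theorem form_eq {u v : M → ℝ} {X Y : ∀ x : M, TangentSpace (𝓡 n) x} (hX : HasGrad g u X)
    (hY : HasGrad g v Y) : form g u v = 4 * ((n : ℝ) - 1) / ((n : ℝ) - 2) *
      ∫ x, g.inner x (X x) (Y x) ∂(vol g) + ∫ x, scalarCurvature g x * u x * v x ∂(vol g) := by
  rw [form]
  congr 2
  refine integral_congr_ae ?_
  filter_upwards [hX.weakGradient_ae_eq, hY.weakGradient_ae_eq] with x h1 h2
  rw [h1, h2]

theorem exists_bound_of_continuous {f : M → ℝ} (hf : Continuous f) : ∃ C, 0 ≤ C ∧ ∀ x, |f x| ≤ C := by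
  obtain ⟨C, hC⟩ := (isCompact_range hf.abs).bddAbove
  exact ⟨max C 0, le_max_right _ _, fun x => (hC ⟨x, rfl⟩).trans (le_max_left _ _)⟩

theorem integrable_continuous_mul {f h : M → ℝ} (hf : Continuous f) (hh : Integrable h (vol g)) :
    Integrable (fun x => f x * h x) (vol g) := by
  obtain ⟨C, -, hC⟩ := exists_bound_of_continuous hf
  exact hh.bdd_mul (c := C) hf.measurable.aestronglyMeasurable (Eventually.of_forall hC)

theorem HasGrad.integrable_sq {u : M → ℝ} {X : ∀ x : M, TangentSpace (𝓡 n) x}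
    (hX : HasGrad g u X) : Integrable (fun x => u x ^ 2) (vol g) := hX.memLp.integrable_sq

theorem HasGrad.integrable_mul {u v : M → ℝ} {X Y : ∀ x : M, TangentSpace (𝓡 n) x}
    (hX : HasGrad g u X) (hY : HasGrad g v Y) : Integrable (fun x => u x * v x) (vol g) :=
  hX.memLp.integrable_mul hY.memLp

theorem HasGrad.integrable_scalar {u v : M → ℝ} {X Y : ∀ x : M, TangentSpace (𝓡 n) x}
    (hX : HasGrad g u X) (hY : HasGrad g v Y) :
    Integrable (fun x => scalarCurvature g x * u x * v x) (vol g) := by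
  simp only [mul_assoc]
  exact integrable_continuous_mul (continuous_scalarCurvature g) (hX.integrable_mul hY)

theorem form_add {u v : M → ℝ} {X Y : ∀ x : M, TangentSpace (𝓡 n) x} (hX : HasGrad g u X)
    (hY : HasGrad g v Y) : form g (fun x => u x + v x) (fun x => u x + v x) =
      form g u u + 2 * form g u v + form g v v := by
  rw [form_eq (hX.add hY) (hX.add hY), form_eq hX hX, form_eq hX hY, form_eq hY hY]
  have e1 : ∫ x, g.inner x (X x + Y x) (X x + Y x) ∂(vol g) =
      ∫ x, g.inner x (X x) (X x) ∂(vol g) + 2 * ∫ x, g.inner x (X x) (Y x) ∂(vol g) +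
        ∫ x, g.inner x (Y x) (Y x) ∂(vol g) := by
    simp only [inner_add_self]
    have i1 := (hX.integrable_inner hY).const_mul 2
    have i2 : Integrable (fun x => g.inner x (X x) (X x) + 2 * g.inner x (X x) (Y x)) (vol g) :=
      hX.integrable.add i1
    rw [integral_add i2 hY.integrable, integral_add hX.integrable i1,
      integral_const_mul]
  have e2 : ∫ x, scalarCurvature g x * (u x + v x) * (u x + v x) ∂(vol g) =
      ∫ x, scalarCurvature g x * u x * u x ∂(vol g) +
        2 * ∫ x, scalarCurvature g x * u x * v x ∂(vol g) +
        ∫ x, scalarCurvature g x * v x * v x ∂(vol g) := by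
    have i1 := (hX.integrable_scalar hY).const_mul 2
    have i2 : Integrable (fun x => scalarCurvature g x * u x * u x +
      2 * (scalarCurvature g x * u x * v x)) (vol g) := (hX.integrable_scalar hX).add i1
    rw [← integral_const_mul, ← integral_add (hX.integrable_scalar hX) i1,
      ← integral_add i2 (hY.integrable_scalar hY)]
    exact integral_congr_ae (Eventually.of_forall fun x => by ring)
  rw [e1, e2]
  ring

theorem form_const_mul {u v : M → ℝ} {X Y : ∀ x : M, TangentSpace (𝓡 n) x} (r : ℝ)
    (hX : HasGrad g u X) (hY : HasGrad g v Y) :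
    form g u (fun x => r * v x) = r * form g u v := by
  rw [form_eq hX (hY.const_mul r), form_eq hX hY]
  have e : ∀ x, scalarCurvature g x * u x * (r * v x) = r * (scalarCurvature g x * u x * v x) :=
    fun x => by ring
  simp only [map_smul, smul_eq_mul, integral_const_mul, e]
  ring

theorem form_const_mul_self {u : M → ℝ} {X : ∀ x : M, TangentSpace (𝓡 n) x} (r : ℝ)
    (hX : HasGrad g u X) : form g (fun x => r * u x) (fun x => r * u x) = r ^ 2 * form g u u := by
  rw [form_eq (hX.const_mul r) (hX.const_mul r), form_eq hX hX]
  have e : ∀ x, scalarCurvature g x * (r * u x) * (r * u x) =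
      r ^ 2 * (scalarCurvature g x * u x * u x) := fun x => by ring
  simp only [inner_smul_self, integral_const_mul, e]
  ring

/-- The parallelogram identity for the form of the conformal Laplacian. -/
theorem form_sub_self {u v : M → ℝ} {X Y : ∀ x : M, TangentSpace (𝓡 n) x} (hX : HasGrad g u X)
    (hY : HasGrad g v Y) : form g (fun x => u x - v x) (fun x => u x - v x) =
      2 * form g u u + 2 * form g v v - form g (fun x => u x + v x) (fun x => u x + v x) := by
  have h := form_add hX (hY.const_mul (-1))
  rw [form_const_mul (-1) hX hY, form_const_mul_self (-1) hY] at h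
  simp only [neg_mul, one_mul, ← sub_eq_add_neg] at h
  rw [h, form_add hX hY]
  ring

end WeakGradients

/-! ### Coercivity of the conformal Laplacian. -/

section Coercivity

open Filter Topology

variable {n : ℕ} {M : Type*} [TopologicalSpace M] [CompactSpace M]
  [ChartedSpace (EuclideanSpace ℝ (Fin n)) M] [IsManifold (𝓡 n) ∞ M]
  [MeasurableSpace M] [BorelSpace M] {g : Metric n M}

theorem two_le_critExponent (hn : 3 ≤ n) :
    2 ≤ ENNReal.ofReal (2 * (n : ℝ) / ((n : ℝ) - 2)) := by
  have hn' : (3 : ℝ) ≤ n := by exact_mod_cast hn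
  rw [show (2 : ℝ≥0∞) = ENNReal.ofReal 2 by simp]
  refine ENNReal.ofReal_le_ofReal ?_
  rw [le_div_iff₀ (by linarith)]
  linarith

/-- The real infimum of the empty set is `0`, so positivity of the invariant excludes it. -/
theorem nonempty_of_yamabeInvariant_pos (hY : 0 < yamabeInvariant g) : (H1pos g).Nonempty := by
  by_contra h
  rw [Set.not_nonempty_iff_eq_empty] at h
  simp [yamabeInvariant, h] at hY

/-- The real infimum of a set unbounded below is `0` by convention. -/
theorem bddBelow_of_yamabeInvariant_pos (hY : 0 < yamabeInvariant g) :
    BddBelow (J g '' H1pos g) := by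
  by_contra h
  rw [yamabeInvariant, Real.sInf_of_not_bddBelow h] at hY
  exact lt_irrefl _ hY

/-- If `critNorm` were `0`, whether because the norm vanishes or because it is infinite and `toReal`
sends it to `0`, then the quotient `J` would be `0` by the convention for division and the invariant
could not be positive. This yields membership in `L^{2*}` without the Sobolev inequality. -/
theorem critNorm_pos (hY : 0 < yamabeInvariant g) {u : M → ℝ} (hu : u ∈ H1pos g) :
    0 < critNorm g u := by
  refine lt_of_le_of_ne ENNReal.toReal_nonneg fun h => ?_
  have h1 := csInf_le (bddBelow_of_yamabeInvariant_pos hY) ⟨u, hu, rfl⟩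
  rw [J, ← h] at h1
  simp only [ne_eq, OfNat.ofNat_ne_zero, not_false_eq_true, zero_pow, div_zero] at h1
  exact absurd hY (not_lt.2 h1)

theorem yamabeInvariant_mul_le (hY : 0 < yamabeInvariant g) {u : M → ℝ} (hu : u ∈ H1pos g) :
    yamabeInvariant g * critNorm g u ^ 2 ≤ form g u u := by
  have h1 := csInf_le (bddBelow_of_yamabeInvariant_pos hY) ⟨u, hu, rfl⟩
  rwa [J, le_div_iff₀ (by have := critNorm_pos hY hu; positivity)] at h1

theorem integral_sq_eq {u : M → ℝ} (hu : MemLp u 2 (vol g)) :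
    ∫ x, u x ^ 2 ∂(vol g) = (eLpNorm u 2 (vol g)).toReal ^ 2 := by
  rw [hu.eLpNorm_eq_integral_rpow_norm (by simp) (by simp)]
  have h0 : 0 ≤ ∫ x, u x ^ 2 ∂(vol g) := integral_nonneg fun x => sq_nonneg _
  simp only [ENNReal.toReal_ofNat, Real.rpow_ofNat, Real.norm_eq_abs, sq_abs]
  rw [ENNReal.toReal_ofReal (by positivity), ← Real.rpow_natCast, ← Real.rpow_mul h0]
  norm_num

theorem exists_integral_sq_le_critNorm (hn : 3 ≤ n) (hY : 0 < yamabeInvariant g) :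
    ∃ C, 0 < C ∧ ∀ u ∈ H1pos g, ∫ x, u x ^ 2 ∂(vol g) ≤ C * critNorm g u ^ 2 := by
  set p := ENNReal.ofReal (2 * (n : ℝ) / ((n : ℝ) - 2)) with hp
  set K := (vol g Set.univ ^ (1 / (2 : ℝ≥0∞).toReal - 1 / p.toReal)) with hK
  have hKtop : K ≠ ⊤ := by
    refine (ENNReal.rpow_lt_top_of_nonneg ?_ (measure_ne_top _ _)).ne
    have h2 : 2 ≤ p.toReal := by
      simpa using ENNReal.toReal_mono ENNReal.ofReal_ne_top (two_le_critExponent hn)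
    rw [sub_nonneg]
    simp only [ENNReal.toReal_ofNat]
    gcongr
  -- `K` is the Hölder constant of the finite measure; the `+ 1` makes the constant positive without
  -- knowing that the volume is.
  refine ⟨K.toReal ^ 2 + 1, by positivity, fun u hu => ?_⟩
  have h := eLpNorm_le_eLpNorm_mul_rpow_measure_univ (two_le_critExponent hn)
    hu.1.1.aestronglyMeasurable
  have hfin : eLpNorm u p (vol g) ≠ ⊤ := fun hh => by
    have := critNorm_pos hY hu
    rw [critNorm, ← hp, hh] at this
    simp at this
  have h' := ENNReal.toReal_mono (ENNReal.mul_ne_top hfin hKtop) h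
  rw [ENNReal.toReal_mul] at h'
  rw [integral_sq_eq hu.1.1]
  calc _ ≤ (critNorm g u * K.toReal) ^ 2 := pow_le_pow_left₀ ENNReal.toReal_nonneg h' 2
    _ ≤ _ := by nlinarith [sq_nonneg (critNorm g u)]

theorem exists_integral_sq_le_form_of_pos (hn : 3 ≤ n) (hY : 0 < yamabeInvariant g) :
    ∃ β, 0 < β ∧ ∀ u ∈ H1pos g, β * ∫ x, u x ^ 2 ∂(vol g) ≤ form g u u := by
  obtain ⟨C, hC, h⟩ := exists_integral_sq_le_critNorm hn hY
  refine ⟨yamabeInvariant g / C, by positivity, fun u hu => ?_⟩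
  refine le_trans ?_ (yamabeInvariant_mul_le hY hu)
  rw [div_mul_eq_mul_div, div_le_iff₀ hC, mul_assoc]
  exact mul_le_mul_of_nonneg_left ((h u hu).trans_eq (mul_comm _ _)) hY.le

theorem hasDerivAt_sqrt_sq_add {δ : ℝ} (hδ : 0 < δ) (t : ℝ) :
    HasDerivAt (fun t : ℝ => √(t ^ 2 + δ)) (t / √(t ^ 2 + δ)) t := by
  have h := ((hasDerivAt_pow 2 t).add_const δ).sqrt (by positivity)
  convert! h using 1
  have : √(t ^ 2 + δ) ≠ 0 := by positivity
  field_simp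
  norm_num [mul_comm]

theorem deriv_sqrt_sq_add_sq_le {δ : ℝ} (hδ : 0 < δ) (t : ℝ) :
    (deriv (fun t : ℝ => √(t ^ 2 + δ)) t) ^ 2 ≤ 1 := by
  rw [(hasDerivAt_sqrt_sq_add hδ t).deriv, div_pow, Real.sq_sqrt (by positivity),
    div_le_one (by positivity)]
  linarith

theorem const_pos (hn : 3 ≤ n) : 0 < 4 * ((n : ℝ) - 1) / ((n : ℝ) - 2) := by
  have hn' : (3 : ℝ) ≤ n := by exact_mod_cast hn
  exact div_pos (by linarith) (by linarith)

/-- The Yamabe quotient says something only about positive functions. The positive function `√(u² +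
δ)` has no more gradient energy than `u`, no smaller L² norm, and a curvature term that exceeds that
of `u` by `δ ∫ R`; then `δ → 0`. -/
theorem exists_integral_sq_le_form (hn : 3 ≤ n) (hY : 0 < yamabeInvariant g) :
    ∃ β, 0 < β ∧ ∀ (u : M → ℝ) (X : ∀ x : M, TangentSpace (𝓡 n) x), HasGrad g u X →
      β * ∫ x, u x ^ 2 ∂(vol g) ≤ form g u u := by
  obtain ⟨β, hβ, h⟩ := exists_integral_sq_le_form_of_pos hn hY
  refine ⟨β, hβ, fun u X hX => ?_⟩
  have key : ∀ δ > 0, β * ∫ x, u x ^ 2 ∂(vol g) ≤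
      form g u u + δ * ∫ x, scalarCurvature g x ∂(vol g) := by
    intro δ hδ
    have hF : ContDiff ℝ 1 (fun t : ℝ => √(t ^ 2 + δ)) :=
      ((contDiff_id.pow 2).add contDiff_const).sqrt fun t => by positivity
    have hG := hX.comp hF (C := 1) fun t => by
      have := deriv_sqrt_sq_add_sq_le hδ t
      exact (sq_le_one_iff_abs_le_one _).1 this
    have hpos : (fun x => √(u x ^ 2 + δ)) ∈ H1pos g :=
      ⟨mem_H1_iff.2 ⟨_, hG⟩, Eventually.of_forall fun x => by positivity⟩
    have h1 := h _ hpos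
    have hsq : ∀ x, √(u x ^ 2 + δ) ^ 2 = u x ^ 2 + δ := fun x => Real.sq_sqrt (by positivity)
    simp only [hsq] at h1
    have h2 : ∫ x, u x ^ 2 ∂(vol g) ≤ ∫ x, (u x ^ 2 + δ) ∂(vol g) :=
      integral_mono hX.integrable_sq (hX.integrable_sq.add (integrable_const _))
        fun x => by simp [hδ.le]
    refine (mul_le_mul_of_nonneg_left h2 hβ.le).trans (h1.trans ?_)
    rw [form_eq hG hG, form_eq hX hX]
    have h3 : ∫ x, scalarCurvature g x * √(u x ^ 2 + δ) * √(u x ^ 2 + δ) ∂(vol g) =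
        ∫ x, scalarCurvature g x * u x * u x ∂(vol g) +
          δ * ∫ x, scalarCurvature g x ∂(vol g) := by
      have hR : Integrable (fun x => scalarCurvature g x) (vol g) := by
        simpa using integrable_continuous_mul (continuous_scalarCurvature g)
          (integrable_const (μ := vol g) (1 : ℝ))
      rw [← integral_const_mul, ← integral_add (hX.integrable_scalar hX) (hR.const_mul δ)]
      refine integral_congr_ae (Eventually.of_forall fun x => ?_)
      simp only
      rw [mul_assoc, Real.mul_self_sqrt (by positivity)]
      ring
    rw [h3, ← add_assoc]
    gcongr
    · exact (const_pos hn).le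
    · exact hG.integrable
    · exact hX.integrable
    · intro x
      simp only [inner_smul_self]
      exact mul_le_of_le_one_left (inner_self_nonneg g x _) (deriv_sqrt_sq_add_sq_le hδ _)
  refine le_of_forall_pos_le_add fun ε hε => (key (ε / (|∫ x, scalarCurvature g x ∂(vol g)| + 1))
    (by positivity)).trans ?_
  gcongr
  rw [div_mul_eq_mul_div, div_le_iff₀ (by positivity)]
  gcongr
  exact (le_abs_self _).trans (by linarith)

/-- The integrand of the squared norm of `H¹`. -/
def sob (g : Metric n M) (u : M → ℝ) (X : ∀ x : M, TangentSpace (𝓡 n) x) (x : M) : ℝ :=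
  u x ^ 2 + g.inner x (X x) (X x)

theorem sob_nonneg (g : Metric n M) (u : M → ℝ) (X : ∀ x : M, TangentSpace (𝓡 n) x) (x : M) :
    0 ≤ sob g u X x := add_nonneg (sq_nonneg _) (inner_self_nonneg g x _)

theorem HasGrad.integrable_sob {u : M → ℝ} {X : ∀ x : M, TangentSpace (𝓡 n) x}
    (h : HasGrad g u X) : Integrable (sob g u X) (vol g) := h.integrable_sq.add h.integrable

theorem exists_scalarCurvature_bound (g : Metric n M) : ∃ r, 0 ≤ r ∧ ∀ (u : M → ℝ),
    Integrable (fun x => u x ^ 2) (vol g) →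
    |∫ x, scalarCurvature g x * u x * u x ∂(vol g)| ≤ r * ∫ x, u x ^ 2 ∂(vol g) := by
  obtain ⟨r, hr0, hr⟩ := exists_bound_of_continuous (continuous_scalarCurvature g)
  refine ⟨r, hr0, fun u hu => ?_⟩
  rw [← integral_const_mul]
  refine (norm_integral_le_of_norm_le (μ := vol g)
    (f := fun x => scalarCurvature g x * u x * u x) (hu.const_mul r) (Eventually.of_forall fun x => ?_))
  rw [Real.norm_eq_abs, mul_assoc, abs_mul, ← sq, abs_of_nonneg (sq_nonneg (u x))]
  exact mul_le_mul_of_nonneg_right (hr x) (sq_nonneg _)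

/-- If the Yamabe invariant is positive, the conformal Laplacian is coercive on `H¹`. -/
theorem exists_coercive (hn : 3 ≤ n) (hY : 0 < yamabeInvariant g) :
    ∃ κ, 0 < κ ∧ ∀ (u : M → ℝ) (X : ∀ x : M, TangentSpace (𝓡 n) x), HasGrad g u X →
      κ * ∫ x, sob g u X x ∂(vol g) ≤ form g u u := by
  obtain ⟨β, hβ, h⟩ := exists_integral_sq_le_form hn hY
  obtain ⟨r, hr0, hr⟩ := exists_scalarCurvature_bound g
  have ha := const_pos hn
  set a := 4 * ((n : ℝ) - 1) / ((n : ℝ) - 2) with ha'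
  -- With `|R| ≤ r`, one has `a ∫|∇u|² + ∫u² ≤ ⟨u,u⟩ + (r + 1) ∫u²`, and the last term is at most
  -- `(r + 1)/β` times `⟨u,u⟩`.
  refine ⟨min a 1 / (1 + (r + 1) / β), by positivity, fun u X hX => ?_⟩
  rw [div_mul_eq_mul_div, div_le_iff₀ (by positivity)]
  have h1 := h u X hX
  have h2 := (abs_le.1 (hr u hX.integrable_sq)).1
  have h3 : form g u u = a * _ + _ := form_eq hX hX
  have hL : 0 ≤ ∫ x, u x ^ 2 ∂(vol g) := integral_nonneg fun x => sq_nonneg _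
  have hG : 0 ≤ ∫ x, g.inner x (X x) (X x) ∂(vol g) :=
    integral_nonneg fun x => inner_self_nonneg g x _
  have e : ∫ x, sob g u X x ∂(vol g) = _ := integral_add hX.integrable_sq hX.integrable
  rw [e]
  have h4 : (r + 1) * ∫ x, u x ^ 2 ∂(vol g) ≤ form g u u * ((r + 1) / β) := by
    rw [mul_div_assoc', le_div_iff₀ hβ]
    nlinarith
  have h5 := mul_le_mul_of_nonneg_right (min_le_left a 1) hG
  have h6 := mul_le_mul_of_nonneg_right (min_le_right a 1) hL
  rw [mul_add, mul_add, mul_one]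
  linarith

theorem exists_form_le (hn : 3 ≤ n) (g : Metric n M) :
    ∃ B, 0 < B ∧ ∀ (u : M → ℝ) (X : ∀ x : M, TangentSpace (𝓡 n) x), HasGrad g u X →
      form g u u ≤ B * ∫ x, sob g u X x ∂(vol g) := by
  obtain ⟨r, hr0, hr⟩ := exists_scalarCurvature_bound g
  have ha := const_pos hn
  set a := 4 * ((n : ℝ) - 1) / ((n : ℝ) - 2) with ha'
  refine ⟨a + r, by positivity, fun u X hX => ?_⟩
  have h2 := (abs_le.1 (hr u hX.integrable_sq)).2
  have h3 : form g u u = a * _ + _ := form_eq hX hX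
  have hL : 0 ≤ ∫ x, u x ^ 2 ∂(vol g) := integral_nonneg fun x => sq_nonneg _
  have hG : 0 ≤ ∫ x, g.inner x (X x) (X x) ∂(vol g) :=
    integral_nonneg fun x => inner_self_nonneg g x _
  have e : ∫ x, sob g u X x ∂(vol g) = _ := integral_add hX.integrable_sq hX.integrable
  rw [e, h3]
  nlinarith [mul_nonneg ha.le hL, mul_nonneg hr0 hG]

end Coercivity

/-! ### Limit theorems for geometrically Cauchy sequences. -/

section Limits

open Filter Topology

/-- Fatou's lemma for sequences of functions with bounded integrals. -/
theorem integrable_of_tendsto_of_integral_le {α : Type*} [MeasurableSpace α] {μ : Measure α}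
    {F : ℕ → α → ℝ} {f : α → ℝ} {B : ℝ} (hF : ∀ k, Integrable (F k) μ) (hF0 : ∀ k x, 0 ≤ F k x)
    (hB : ∀ᶠ k in atTop, ∫ x, F k x ∂μ ≤ B)
    (hlim : ∀ᵐ x ∂μ, Tendsto (fun k => F k x) atTop (𝓝 (f x))) :
    Integrable f μ ∧ ∫ x, f x ∂μ ≤ B := by
  have hf0 : 0 ≤ᵐ[μ] f := by
    filter_upwards [hlim] with x hx
    exact ge_of_tendsto' hx fun k => hF0 k x
  have hmeas : AEStronglyMeasurable f μ :=
    aestronglyMeasurable_of_tendsto_ae _ (fun k => (hF k).aestronglyMeasurable) hlim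
  have hB0 : 0 ≤ B := by
    obtain ⟨k, hk⟩ := hB.exists
    exact (integral_nonneg (hF0 k)).trans hk
  have hle : ∫⁻ x, ENNReal.ofReal (f x) ∂μ ≤ ENNReal.ofReal B := by
    calc ∫⁻ x, ENNReal.ofReal (f x) ∂μ
        = ∫⁻ x, liminf (fun k => ENNReal.ofReal (F k x)) atTop ∂μ := by
          refine lintegral_congr_ae ?_
          filter_upwards [hlim] with x hx
          exact ((ENNReal.continuous_ofReal.tendsto _).comp hx).liminf_eq.symm
      _ ≤ liminf (fun k => ∫⁻ x, ENNReal.ofReal (F k x) ∂μ) atTop :=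
          lintegral_liminf_le' fun k => (hF k).aestronglyMeasurable.aemeasurable.ennreal_ofReal
      _ ≤ ENNReal.ofReal B := by
          refine liminf_le_of_frequently_le' (hB.mono fun k hk => ?_).frequently
          rw [← ofReal_integral_eq_lintegral_ofReal (hF k) (Eventually.of_forall (hF0 k))]
          exact ENNReal.ofReal_le_ofReal hk
  have hint : Integrable f μ := by
    refine ⟨hmeas, ?_⟩
    rw [hasFiniteIntegral_iff_ofReal hf0]
    exact hle.trans_lt ENNReal.ofReal_lt_top
  refine ⟨hint, ?_⟩
  rw [integral_eq_lintegral_of_nonneg_ae hf0 hmeas]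
  exact ENNReal.toReal_le_of_le_ofReal hB0 hle

/-- Functions whose integrals decay geometrically decay geometrically almost everywhere. -/
theorem ae_exists_le_geometric {α : Type*} [MeasurableSpace α] {μ : Measure α}
    {d : ℕ → α → ℝ} {C : ℝ} (hd : ∀ k, Integrable (d k) μ) (hd0 : ∀ k x, 0 ≤ d k x)
    (hC : ∀ k, ∫ x, d k x ∂μ ≤ C * (1 / 4) ^ k) :
    ∀ᵐ x ∂μ, ∃ B : ℝ, ∀ k, d k x ≤ B * (1 / 2) ^ k := by
  have hmeas : ∀ k, AEMeasurable (fun x => ENNReal.ofReal (2 ^ k * d k x)) μ := fun k =>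
    ((hd k).const_mul (2 ^ k)).aestronglyMeasurable.aemeasurable.ennreal_ofReal
  have hC0 : 0 ≤ C := by simpa using (integral_nonneg (hd0 0)).trans (hC 0)
  have hfin : ∫⁻ x, ∑' k, ENNReal.ofReal (2 ^ k * d k x) ∂μ ≠ ⊤ := by
    rw [lintegral_tsum hmeas]
    have hs : Summable fun k : ℕ => C * (1 / 2 : ℝ) ^ k :=
      (summable_geometric_of_lt_one (by norm_num) (by norm_num)).mul_left C
    refine ne_top_of_le_ne_top (ENNReal.ofReal_ne_top (r := ∑' k : ℕ, C * (1 / 2 : ℝ) ^ k)) ?_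
    rw [ENNReal.ofReal_tsum_of_nonneg (fun k => by positivity) hs]
    refine ENNReal.tsum_le_tsum fun k => ?_
    rw [← ofReal_integral_eq_lintegral_ofReal ((hd k).const_mul _)
      (Eventually.of_forall fun x => mul_nonneg (by positivity) (hd0 k x)), integral_const_mul]
    refine ENNReal.ofReal_le_ofReal ?_
    calc _ ≤ 2 ^ k * (C * (1 / 4 : ℝ) ^ k) := mul_le_mul_of_nonneg_left (hC k) (by positivity)
      _ = _ := by
        rw [mul_left_comm, ← mul_pow]
        norm_num
  filter_upwards [ae_lt_top' (AEMeasurable.tsum hmeas) hfin] with x hx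
  refine ⟨(∑' k, ENNReal.ofReal (2 ^ k * d k x)).toReal, fun k => ?_⟩
  have h1 : 2 ^ k * d k x ≤ (∑' k, ENNReal.ofReal (2 ^ k * d k x)).toReal :=
    (ENNReal.ofReal_le_iff_le_toReal hx.ne).1 (ENNReal.le_tsum k)
  rw [one_div, inv_pow, ← div_eq_mul_inv, le_div_iff₀ (by positivity), mul_comm]
  exact h1

theorem cauchySeq_of_sq_le_geometric {a : ℕ → ℝ} {B : ℝ}
    (h : ∀ k, (a (k + 1) - a k) ^ 2 ≤ B * (1 / 2) ^ k) : ∃ l, Tendsto a atTop (𝓝 l) := by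
  refine cauchySeq_tendsto_of_complete (cauchySeq_of_le_geometric (√(1 / 2)) (√B) ?_ fun k => ?_)
  · rw [Real.sqrt_lt' one_pos]; norm_num
  · rw [dist_comm, Real.dist_eq]
    refine Real.abs_le_sqrt (h k) |>.trans_eq ?_
    have h2 : (1 / 2 : ℝ) ^ k = (√(1 / 2) ^ k) ^ 2 := by
      rw [← pow_mul, mul_comm, pow_mul, Real.sq_sqrt (by norm_num)]
    rw [Real.sqrt_mul' _ (by positivity), h2, Real.sqrt_sq (by positivity)]

variable {n : ℕ} {M : Type*} [TopologicalSpace M] [CompactSpace M]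
  [ChartedSpace (EuclideanSpace ℝ (Fin n)) M] [IsManifold (𝓡 n) ∞ M]
  [MeasurableSpace M] [BorelSpace M] {g : Metric n M}

theorem exists_eq_param {n : ℕ} {M : Type*} [TopologicalSpace M]
    [ChartedSpace (EuclideanSpace ℝ (Fin n)) M] (x : M) :
    ∃ (c : M) (y : EuclideanSpace ℝ (Fin n)), y ∈ (extChartAt (𝓡 n) c).target ∧ x = param c y :=
  ⟨x, extChartAt (𝓡 n) x x, mem_extChartAt_target x, (extChartAt_to_inv x).symm⟩

/-- Tangent spaces are finite-dimensional: the limits of the products with a coordinate frame are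
the products with a unique vector, by nondegeneracy, and linearity gives all other products. -/
theorem exists_tendsto_inner (g : Metric n M) (x : M) {X : ℕ → TangentSpace (𝓡 n) x}
    (h : ∀ v, ∃ l, Tendsto (fun k => g.inner x (X k) v) atTop (𝓝 l)) :
    ∃ Z, ∀ v, Tendsto (fun k => g.inner x (X k) v) atTop (𝓝 (g.inner x Z v)) := by
  obtain ⟨c, y, hy, rfl⟩ := exists_eq_param (n := n) x
  choose l hl using h
  obtain ⟨Z, hZ⟩ := exists_inner_eq g hy fun i => l (coordVec c i y)
  refine ⟨Z, fun v => ?_⟩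
  obtain ⟨b, rfl⟩ := exists_eq_sum_coordVec hy v
  simp only [map_sum, map_smul]
  refine tendsto_finsetSum _ fun i _ => (Tendsto.const_smul ?_ _)
  rw [hZ]
  exact hl _

theorem tendsto_inner_self (g : Metric n M) (x : M) {X : ℕ → TangentSpace (𝓡 n) x}
    {Z : TangentSpace (𝓡 n) x}
    (h : ∀ v, Tendsto (fun k => g.inner x (X k) v) atTop (𝓝 (g.inner x Z v)))
    (W : TangentSpace (𝓡 n) x) : Tendsto (fun k => g.inner x (W - X k) (W - X k)) atTop
      (𝓝 (g.inner x (W - Z) (W - Z))) := by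
  obtain ⟨c, y, hy, rfl⟩ := exists_eq_param (n := n) x
  have h' : ∀ v, Tendsto (fun k => g.inner (param c y) (W - X k) v) atTop
      (𝓝 (g.inner (param c y) (W - Z) v)) := fun v => by
    simp only [map_sub, _root_.sub_apply]
    exact (h v).const_sub _
  simp only [inner_eq_sum g hy (W - _) (W - _)]
  exact tendsto_finsetSum _ fun i _ => tendsto_finsetSum _ fun j _ =>
    ((h' _).const_mul _).mul (h' _)

theorem inner_sq_le (g : Metric n M) (x : M) (v w : TangentSpace (𝓡 n) x) :
    g.inner x v w ^ 2 ≤ g.inner x v v * g.inner x w w := by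
  by_cases hw : w = 0
  · simp [hw]
  have hpos := g.pos x w hw
  have h := inner_self_nonneg g x (v - (g.inner x v w / g.inner x w w) • w)
  rw [inner_sub_self, inner_smul_self, map_smul, smul_eq_mul] at h
  field_simp at h
  linarith

/-- From `a² ≤ e · H` follows `|a| ≤ 2^k e + 2^{-k} |H|`. As `∫ e` is of order `4^{-k}`, both terms
integrate to order `2^{-k}` on the support of the test function. -/
theorem tendsto_integral_mul_test (g : Metric n M) (c : M)
    {a : ℕ → EuclideanSpace ℝ (Fin n) → ℝ} {e : ℕ → M → ℝ} {H : EuclideanSpace ℝ (Fin n) → ℝ}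
    {C : ℝ} (hH : ContinuousOn H (extChartAt (𝓡 n) c).target)
    (he : ∀ k, Integrable (e k) (vol g)) (he0 : ∀ k x, 0 ≤ e k x)
    (hC : ∀ k, ∫ x, e k x ∂(vol g) ≤ C * (1 / 4) ^ k)
    (ha : ∀ k, ∀ y ∈ (extChartAt (𝓡 n) c).target, a k y ^ 2 ≤ e k (param c y) * H y)
    {ψ : EuclideanSpace ℝ (Fin n) → ℝ} (hψ : IsTest ψ (extChartAt (𝓡 n) c).target) :
    Tendsto (fun k => ∫ y, a k y * ψ y) atTop (𝓝 0) := by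
  obtain ⟨D, hD⟩ := hψ.exists_bound
  have hD0 : 0 ≤ D := (abs_nonneg _).trans (hD 0)
  set K := tsupport ψ with hK
  have hKc : IsCompact K := hψ.hasCompactSupport
  obtain ⟨CK, hCK0, hCK⟩ := exists_setIntegral_comp_param_le g c hKc hψ.tsupport_subset
  have hHK : IntegrableOn (fun y => |H y|) K :=
    ((hH.mono hψ.tsupport_subset).abs).integrableOn_compact hKc
  have heK : ∀ k, IntegrableOn (fun y => e k (param c y)) K := fun k =>
    (locallyIntegrableOn_comp_param g (he k) c).integrableOn_compact_subset hψ.tsupport_subset hKc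
  refine squeeze_zero_norm (a := fun k : ℕ =>
    D * (CK * C + ∫ y in K, |H y|) * (1 / 2) ^ k) (fun k => ?_) ?_
  · rw [← setIntegral_eq_integral_of_forall_compl_eq_zero (s := K) fun y hy => by
      rw [image_eq_zero_of_notMem_tsupport hy, mul_zero]]
    have hint : IntegrableOn (fun y => D * (2 ^ k * e k (param c y) + (1 / 2) ^ k * |H y|)) K :=
      (((heK k).const_mul _).add (hHK.const_mul _)).const_mul D
    refine (norm_integral_le_of_norm_le hint ?_).trans ?_
    · filter_upwards [ae_restrict_mem hKc.measurableSet] with y hy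
      rw [norm_mul, mul_comm]
      refine mul_le_mul (hD y) ?_ (norm_nonneg _) hD0
      have h1 := ha k y (hψ.tsupport_subset hy)
      have h0 := he0 k (param c y)
      refine abs_le_of_sq_le_sq (h1.trans ?_)
        (add_nonneg (mul_nonneg (by positivity) h0) (by positivity))
      have h2 : (2 : ℝ) ^ k * (1 / 2) ^ k = 1 := by rw [← mul_pow]; norm_num
      have h3 := mul_le_mul_of_nonneg_left (le_abs_self (H y)) h0
      have h4 : ((2 : ℝ) ^ k * e k (param c y)) * ((1 / 2) ^ k * |H y|) =
        e k (param c y) * |H y| := by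
        rw [mul_mul_mul_comm, h2, one_mul]
      have h5 : 0 ≤ e k (param c y) * |H y| := mul_nonneg h0 (abs_nonneg _)
      nlinarith [sq_nonneg ((2 : ℝ) ^ k * e k (param c y)), sq_nonneg ((1 / 2 : ℝ) ^ k * |H y|)]
    · rw [integral_const_mul, integral_add ((heK k).const_mul _) (hHK.const_mul _),
        integral_const_mul, integral_const_mul, mul_assoc]
      refine mul_le_mul_of_nonneg_left ?_ hD0
      have h1 := (hCK (e k) (he k) (he0 k)).trans (mul_le_mul_of_nonneg_left (hC k) hCK0)
      have h2 := mul_le_mul_of_nonneg_left h1 (show (0 : ℝ) ≤ 2 ^ k by positivity)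
      have h3 : (2 : ℝ) ^ k * (CK * (C * (1 / 4) ^ k)) = CK * C * (1 / 2) ^ k := by
        rw [show (1 / 2 : ℝ) ^ k = 2 ^ k * (1 / 4) ^ k by rw [← mul_pow]; norm_num]
        ring
      rw [h3] at h2
      linarith
  · rw [show (0 : ℝ) = D * (CK * C + ∫ y in K, |H y|) * 0 by ring]
    exact (tendsto_pow_atTop_nhds_zero_of_lt_one (by norm_num) (by norm_num)).const_mul _

end Limits

/-! ### Completeness of H¹. -/

section Completeness

open Filter Topology

variable {n : ℕ} {M : Type*} [TopologicalSpace M] [CompactSpace M]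
  [ChartedSpace (EuclideanSpace ℝ (Fin n)) M] [IsManifold (𝓡 n) ∞ M]
  [MeasurableSpace M] [BorelSpace M] {g : Metric n M}

/-- A sequence that is geometrically Cauchy in `H¹` converges pointwise almost everywhere, together
with its gradients. -/
theorem exists_ae_limit {u : ℕ → M → ℝ} {X : ℕ → ∀ x : M, TangentSpace (𝓡 n) x} {C : ℝ}
    (h : ∀ k, HasGrad g (u k) (X k))
    (hC : ∀ k l, k ≤ l → ∫ x, sob g (fun x => u k x - u l x) (fun x => X k x - X l x) x ∂(vol g) ≤
      C * (1 / 4) ^ k) :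
    ∃ (v : M → ℝ) (Z : ∀ x : M, TangentSpace (𝓡 n) x), ∀ᵐ x ∂(vol g),
      Tendsto (fun k => u k x) atTop (𝓝 (v x)) ∧
      ∀ w, Tendsto (fun k => g.inner x (X k x) w) atTop (𝓝 (g.inner x (Z x) w)) := by
  have hd := ae_exists_le_geometric
    (d := fun k => sob g (fun x => u k x - u (k + 1) x) (fun x => X k x - X (k + 1) x))
    (fun k => ((h k).sub (h (k + 1))).integrable_sob) (fun k x => sob_nonneg g _ _ x)
    (fun k => hC k (k + 1) k.le_succ)
  -- The implication is stated at every point, with zero values where the decay fails, so that the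
  -- limits can be chosen as a function and a vector field on all of `M`.
  have key : ∀ x, ∃ (l : ℝ) (Z : TangentSpace (𝓡 n) x),
      (∃ B : ℝ, ∀ k, sob g (fun x => u k x - u (k + 1) x) (fun x => X k x - X (k + 1) x) x ≤
        B * (1 / 2) ^ k) → Tendsto (fun k => u k x) atTop (𝓝 l) ∧
      ∀ w, Tendsto (fun k => g.inner x (X k x) w) atTop (𝓝 (g.inner x Z w)) := by
    intro x
    by_cases hB : ∃ B : ℝ, ∀ k, sob g (fun x => u k x - u (k + 1) x)
      (fun x => X k x - X (k + 1) x) x ≤ B * (1 / 2) ^ k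
    · obtain ⟨B, hB⟩ := hB
      simp only [sob] at hB
      obtain ⟨l, hl⟩ := cauchySeq_of_sq_le_geometric (a := fun k => u k x) (B := B) fun k => by
        have h1 := inner_self_nonneg g x (X k x - X (k + 1) x)
        have h2 := hB k
        nlinarith
      obtain ⟨Z, hZ⟩ := exists_tendsto_inner g x (X := fun k => X k x) fun w =>
        cauchySeq_of_sq_le_geometric (a := fun k => g.inner x (X k x) w)
          (B := B * g.inner x w w) fun k => by
        have h1 := inner_sq_le g x (X k x - X (k + 1) x) w
        have h2 := hB k
        have h3 := mul_le_mul_of_nonneg_right ((le_add_of_nonneg_left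
          (sq_nonneg (u k x - u (k + 1) x))).trans h2) (inner_self_nonneg g x w)
        simp only [map_sub, _root_.sub_apply] at h1 h3
        calc _ = ((g.inner x) (X k x) w - (g.inner x) (X (k + 1) x) w) ^ 2 := by ring
          _ ≤ _ := h1.trans h3
          _ = _ := by ring
      exact ⟨l, Z, fun _ => ⟨hl, hZ⟩⟩
    · exact ⟨0, 0, fun h => absurd h hB⟩
  choose v Z hvZ using key
  exact ⟨v, Z, hd.mono fun x hx => hvZ x hx⟩

theorem inner_self_le (g : Metric n M) (x : M) (v w : TangentSpace (𝓡 n) x) :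
    g.inner x w w ≤ 2 * g.inner x v v + 2 * g.inner x (v - w) (v - w) := by
  have h := two_mul_abs_inner_le g x ((2 : ℝ) • v) w
  rw [inner_smul_self] at h
  simp only [map_smul, _root_.smul_apply, smul_eq_mul] at h
  rw [inner_sub_self]
  have := le_abs_self (2 * g.inner x v w)
  linarith

theorem locallyIntegrableOn_covComp {Z : ∀ x : M, TangentSpace (𝓡 n) x} {c : M} {i : Fin n}
    (hZ : Integrable (fun x => g.inner x (Z x) (Z x)) (vol g))
    (hZm : AEStronglyMeasurable (covComp g Z c i)
      (volume.restrict (extChartAt (𝓡 n) c).target)) :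
    LocallyIntegrableOn (covComp g Z c i) (extChartAt (𝓡 n) c).target := by
  rw [locallyIntegrableOn_iff (isOpen_target c).isLocallyClosed]
  intro K hK hKc
  have h1 := (locallyIntegrableOn_comp_param g hZ c).integrableOn_compact_subset hK hKc
  have h2 : IntegrableOn (fun y => coeff g c y i i) K :=
    ((contDiffOn_coeff g c i i).continuousOn.mono hK).integrableOn_compact hKc
  refine (h1.add h2).mono' (hZm.mono_measure (Measure.restrict_mono hK le_rfl))
    (Eventually.of_forall fun y => ?_)
  have h3 := two_mul_abs_inner_le g (param c y) (Z (param c y)) (coordVec c i y)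
  have h4 := abs_nonneg (g.inner (param c y) (Z (param c y)) (coordVec c i y))
  simp only [Pi.add_apply, covComp, coeff_apply, Real.norm_eq_abs]
  linarith

/-- Completeness of `H¹`. -/
theorem exists_limit {u : ℕ → M → ℝ} {X : ℕ → ∀ x : M, TangentSpace (𝓡 n) x} {C : ℝ}
    (h : ∀ k, HasGrad g (u k) (X k))
    (hC : ∀ k l, k ≤ l → ∫ x, sob g (fun x => u k x - u l x) (fun x => X k x - X l x) x ∂(vol g) ≤
      C * (1 / 4) ^ k) :
    ∃ (v : M → ℝ) (Z : ∀ x : M, TangentSpace (𝓡 n) x), HasGrad g v Z ∧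
      (∀ᵐ x ∂(vol g), Tendsto (fun k => u k x) atTop (𝓝 (v x))) ∧
      ∀ k, ∫ x, sob g (fun x => u k x - v x) (fun x => X k x - Z x) x ∂(vol g) ≤
        C * (1 / 4) ^ k := by
  obtain ⟨v, Z, hvZ⟩ := exists_ae_limit h hC
  set e : ℕ → M → ℝ := fun k => sob g (fun x => u k x - v x) (fun x => X k x - Z x) with he_def
  -- Fatou's lemma in the index `l` of the Cauchy estimate.
  have he : ∀ k, Integrable (e k) (vol g) ∧ ∫ x, e k x ∂(vol g) ≤ C * (1 / 4) ^ k := fun k => by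
    refine integrable_of_tendsto_of_integral_le
      (F := fun l => sob g (fun x => u k x - u l x) (fun x => X k x - X l x))
      (fun l => ((h k).sub (h l)).integrable_sob) (fun l x => sob_nonneg g _ _ x)
      (eventually_atTop.2 ⟨k, fun l hl => hC k l hl⟩) ?_
    filter_upwards [hvZ] with x hx
    exact ((hx.1.const_sub _).pow 2).add (tendsto_inner_self g x hx.2 (X k x))
  have he0 : ∀ k x, 0 ≤ e k x := fun k x => sob_nonneg g _ _ x
  have hvm : AEStronglyMeasurable v (vol g) := aestronglyMeasurable_of_tendsto_ae atTop
    (fun k => (h k).aestronglyMeasurable) (hvZ.mono fun x hx => hx.1)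
  have hZm : ∀ c i, AEStronglyMeasurable (covComp g Z c i)
      (volume.restrict (extChartAt (𝓡 n) c).target) := fun c i =>
    aestronglyMeasurable_of_tendsto_ae atTop (fun k => (h k).aestronglyMeasurable_comp c i)
      ((ae_target_of_ae_vol g c (P := fun x => ∀ w, Tendsto (fun k => g.inner x (X k x) w) atTop
        (𝓝 (g.inner x (Z x) w))) (hvZ.mono fun x hx => hx.2)).mono fun y hy => hy _)
  have hv : MemLp v 2 (vol g) := by
    rw [memLp_two_iff_integrable_sq hvm]
    refine (((h 0).integrable_sq.const_mul 2).add ((he 0).1.const_mul 2)).mono' (hvm.pow 2)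
      (Eventually.of_forall fun x => ?_)
    have h1 := inner_self_nonneg g x (X 0 x - Z x)
    simp only [he_def, sob, Pi.add_apply, Real.norm_eq_abs, abs_of_nonneg (sq_nonneg (v x))]
    nlinarith [sq_nonneg (2 * u 0 x - v x)]
  have hZ : Integrable (fun x => g.inner x (Z x) (Z x)) (vol g) := by
    refine (((h 0).integrable.const_mul 2).add ((he 0).1.const_mul 2)).mono'
      (aestronglyMeasurable_inner hZm hZm) (Eventually.of_forall fun x => ?_)
    rw [Real.norm_of_nonneg (inner_self_nonneg g x _)]
    refine (inner_self_le g x (X 0 x) (Z x)).trans ?_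
    simp only [he_def, sob, Pi.add_apply]
    nlinarith [sq_nonneg (u 0 x - v x)]
  refine ⟨v, Z, ⟨hv, isWeakGradient_of_isWeakPDeriv fun c i => ⟨?_, ?_, fun ψ hψ => ?_⟩, hZ⟩,
    hvZ.mono fun x hx => hx.1, fun k => (he k).2⟩
  · exact locallyIntegrableOn_comp_param g (hv.integrable (by norm_num)) c
  · exact locallyIntegrableOn_covComp hZ (hZm c i)
  · have hZl : LocallyIntegrableOn (covComp g Z c i) (extChartAt (𝓡 n) c).target :=
      locallyIntegrableOn_covComp hZ (hZm c i)
    have hvl := locallyIntegrableOn_comp_param g (hv.integrable (by norm_num)) c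
    have t1 := tendsto_integral_mul_test g c (a := fun k y => u k (param c y) - v (param c y))
      (H := fun _ => 1) continuousOn_const (fun k => (he k).1) he0 (fun k => (he k).2)
      (fun k y _ => by
        have h1 := inner_self_nonneg g (param c y) (X k (param c y) - Z (param c y))
        simp only [he_def, sob]
        linarith) (hψ.pderiv i)
    have t2 := tendsto_integral_mul_test g c (a := fun k y => covComp g (X k) c i y - covComp g Z c i y)
      (contDiffOn_coeff g c i i).continuousOn (fun k => (he k).1) he0 (fun k => (he k).2)
      (fun k y _ => by
        have h1 := inner_sq_le g (param c y) (X k (param c y) - Z (param c y)) (coordVec c i y)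
        have h2 := mul_nonneg (sq_nonneg (u k (param c y) - v (param c y)))
          (inner_self_nonneg g (param c y) (coordVec c i y))
        simp only [map_sub, _root_.sub_apply] at h1
        simp only [he_def, sob, coeff_apply, covComp, add_mul, map_sub, _root_.sub_apply]
        linarith) hψ
    -- The last bracket is the defect of the weak derivative identity for `v`. It does not depend on
    -- `k`, and the other two integrals tend to zero by `t1` and `t2`.
    have e : ∀ k, ∫ y, (u k (param c y) - v (param c y)) * pderiv i ψ y =
        -(∫ y, (covComp g (X k) c i y - covComp g Z c i y) * ψ y) +
        (-(∫ y, covComp g Z c i y * ψ y) - ∫ y, v (param c y) * pderiv i ψ y) := fun k => by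
      have hk := (h k).isWeakPDeriv c i
      simp only [sub_mul]
      rw [integral_sub (IsTest.integrable_mul hk.left (hψ.pderiv i)) (IsTest.integrable_mul hvl (hψ.pderiv i)),
        integral_sub (IsTest.integrable_mul hk.right hψ) (IsTest.integrable_mul hZl hψ),
        hk.integral_eq ψ hψ]
      ring
    simp only [e] at t1
    have t3 := t2.neg.add_const
      (-(∫ y, covComp g Z c i y * ψ y) - ∫ y, v (param c y) * pderiv i ψ y)
    have := tendsto_nhds_unique t1 t3
    linarith

end Completeness

/-! ### Existence and uniqueness for the obstacle problem. -/

section Obstacle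

open Filter Topology

variable {n : ℕ} {M : Type*} [TopologicalSpace M] [CompactSpace M]
  [ChartedSpace (EuclideanSpace ℝ (Fin n)) M] [IsManifold (𝓡 n) ∞ M]
  [MeasurableSpace M] [BorelSpace M] {g : Metric n M}

/-- The admissible functions of the obstacle problem. -/
def admissible (g : Metric n M) (u : M → ℝ) : Set (M → ℝ) := {v | v ∈ H1pos g ∧ u ≤ᵐ[vol g] v}

theorem midpoint_mem_admissible {u v v' : M → ℝ} (hv : v ∈ admissible g u)
    (hv' : v' ∈ admissible g u) : (fun x => (1 / 2) * (v x + v' x)) ∈ admissible g u := by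
  obtain ⟨X, hX⟩ := mem_H1_iff.1 hv.1.1
  obtain ⟨Y, hY⟩ := mem_H1_iff.1 hv'.1.1
  refine ⟨⟨mem_H1_iff.2 ⟨_, (hX.add hY).const_mul (1 / 2)⟩, ?_⟩, ?_⟩
  · filter_upwards [hv.1.2, hv'.1.2] with x h1 h2
    positivity
  · filter_upwards [hv.2, hv'.2] with x h1 h2
    linarith

/-- The midpoint of two admissible functions is admissible, so its energy is at least `m`; the
parallelogram identity does the rest. This gives both the Cauchy property of minimizing sequences
and uniqueness. -/
theorem form_sub_self_le {u v v' : M → ℝ} {m : ℝ} (hm : ∀ v ∈ admissible g u, m ≤ form g v v)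
    (hv : v ∈ admissible g u) (hv' : v' ∈ admissible g u) :
    form g (fun x => v x - v' x) (fun x => v x - v' x) ≤
      2 * (form g v v - m) + 2 * (form g v' v' - m) := by
  obtain ⟨X, hX⟩ := mem_H1_iff.1 hv.1.1
  obtain ⟨Y, hY⟩ := mem_H1_iff.1 hv'.1.1
  have h := hm _ (midpoint_mem_admissible hv hv')
  rw [form_const_mul_self (1 / 2) (hX.add hY)] at h
  rw [form_sub_self hX hY]
  linarith

theorem form_nonneg (hn : 3 ≤ n) (hY : 0 < yamabeInvariant g) {u : M → ℝ}
    {X : ∀ x : M, TangentSpace (𝓡 n) x} (hX : HasGrad g u X) : 0 ≤ form g u u := by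
  obtain ⟨κ, hκ, h⟩ := exists_coercive hn hY
  exact le_trans (mul_nonneg hκ.le (integral_nonneg fun x => sob_nonneg g u X x)) (h u X hX)

/-- Young's inequality for a nonnegative form: the cross term is bounded by expanding the energy of
`t u + (u - v)`. It carries the energy bound from a minimizing sequence to its limit. -/
theorem form_le_of_sub (hn : 3 ≤ n) (hY : 0 < yamabeInvariant g) {u v : M → ℝ}
    {X Y : ∀ x : M, TangentSpace (𝓡 n) x} (hX : HasGrad g u X) (hV : HasGrad g v Y) {t : ℝ}
    (ht : 0 < t) : form g v v ≤ (1 + t) * form g u u +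
      (1 + t⁻¹) * form g (fun x => u x - v x) (fun x => u x - v x) := by
  have hW := hX.sub hV
  have h1 := form_add hX (hW.const_mul (-1))
  rw [form_const_mul (-1) hX hW, form_const_mul_self (-1) hW] at h1
  have h2 := form_nonneg hn hY ((hX.const_mul t).add hW)
  rw [form_add (hX.const_mul t) hW, form_const_mul_self t hX] at h2
  have h3 : form g (fun x => t * u x) (fun x => u x - v x) =
      t * form g u (fun x => u x - v x) := by
    rw [form_eq (hX.const_mul t) hW, form_eq hX hW]
    have e : ∀ x, scalarCurvature g x * (t * u x) * (u x - v x) =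
      t * (scalarCurvature g x * u x * (u x - v x)) := fun x => by ring
    simp only [map_smul, _root_.smul_apply, smul_eq_mul, integral_const_mul, e]
    ring
  rw [h3] at h2
  have e : (fun x => u x + -1 * (u x - v x)) = v := by
    ext x
    ring
  rw [e] at h1
  rw [h1]
  set A := form g u u
  set B := form g u (fun x => u x - v x)
  set D := form g (fun x => u x - v x) (fun x => u x - v x)
  have h4 := mul_nonneg (inv_pos.2 ht).le h2
  have h5 : t⁻¹ * (t ^ 2 * A + 2 * (t * B) + D) = t * A + 2 * B + t⁻¹ * D := by
    field_simp
  rw [h5] at h4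
  linarith

/-- The direct method, with strong convergence supplied by coercivity and `form_sub_self_le`. -/
theorem exists_isObstacleSolution (hn : 3 ≤ n) (hY : 0 < yamabeInvariant g) {u : M → ℝ}
    (hu : u ∈ H1pos g) : ∃ v, IsObstacleSolution g u v := by
  set S := (fun v => form g v v) '' admissible g u with hS
  have hne : S.Nonempty := ⟨_, u, ⟨hu, EventuallyLE.rfl⟩, rfl⟩
  have hbdd : BddBelow S := ⟨0, by
    rintro _ ⟨v, hv, rfl⟩
    obtain ⟨X, hX⟩ := mem_H1_iff.1 hv.1.1
    exact form_nonneg hn hY hX⟩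
  set m := sInf S with hm_def
  have hm : ∀ v ∈ admissible g u, m ≤ form g v v := fun v hv => csInf_le hbdd ⟨v, hv, rfl⟩
  have hex : ∀ k : ℕ, ∃ v ∈ admissible g u, form g v v < m + (1 / 4) ^ k := fun k => by
    obtain ⟨_, ⟨v, hv, rfl⟩, h⟩ := exists_lt_of_csInf_lt hne
      (show sInf S < m + (1 / 4) ^ k by simp [← hm_def])
    exact ⟨v, hv, h⟩
  choose v hv hvm using hex
  choose X hX using fun k => mem_H1_iff.1 (hv k).1.1
  obtain ⟨κ, hκ, hcoer⟩ := exists_coercive hn hY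
  obtain ⟨B, hB, hform⟩ := exists_form_le hn g
  -- With energies within `4^{-k}` of the infimum, the difference for `k ≤ l` has energy at most `4
  -- · 4^{-k}`; coercivity divides this by `κ`.
  obtain ⟨w, Z, hZ, hlim, hrate⟩ := exists_limit (C := 4 / κ) hX fun k l hkl => by
    have h1 := hcoer _ _ ((hX k).sub (hX l))
    have h2 := form_sub_self_le hm (hv k) (hv l)
    have h3 : (1 / 4 : ℝ) ^ l ≤ (1 / 4) ^ k :=
      pow_le_pow_of_le_one (by norm_num) (by norm_num) hkl
    rw [div_mul_eq_mul_div, le_div_iff₀ hκ, mul_comm]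
    linarith [hvm k, hvm l]
  have hw : w ∈ admissible g u := by
    have huw : u ≤ᵐ[vol g] w := by
      filter_upwards [hlim, ae_all_iff.2 fun k => (hv k).2] with x hx h
      exact ge_of_tendsto' hx h
    refine ⟨⟨mem_H1_iff.2 ⟨Z, hZ⟩, ?_⟩, huw⟩
    -- A limit of positive functions may vanish; positivity comes from the obstacle, which lies
    -- below.
    filter_upwards [huw, hu.2] with x h1 h2
    exact h2.trans_le h1
  refine ⟨w, hw.1, hw.2, fun v' hv' huv' => le_trans ?_ (hm v' ⟨hv', huv'⟩)⟩
  have key : ∀ k : ℕ, form g w w ≤ (1 + (1 / 2) ^ k) * (m + (1 / 4) ^ k) +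
      ((1 / 4) ^ k + (1 / 2) ^ k) * (B * (4 / κ)) := fun k => by
    -- Taking `t = 2^{-k}` makes both `t` and `t⁻¹ · 4^{-k}` tend to zero.
    have h1 := form_le_of_sub hn hY (hX k) hZ (t := (1 / 2) ^ k) (by positivity)
    have h2 := (hform _ _ ((hX k).sub hZ)).trans (mul_le_mul_of_nonneg_left (hrate k) hB.le)
    refine h1.trans (add_le_add (mul_le_mul_of_nonneg_left (hvm k).le (by positivity)) ?_)
    refine (mul_le_mul_of_nonneg_left h2 (by positivity)).trans_eq ?_
    have e : ((1 / 2 : ℝ) ^ k)⁻¹ * (1 / 4) ^ k = (1 / 2) ^ k := by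
      rw [← inv_pow, ← mul_pow]; norm_num
    calc _ = ((1 / 4) ^ k + ((1 / 2 : ℝ) ^ k)⁻¹ * (1 / 4) ^ k) * (B * (4 / κ)) := by ring
      _ = _ := by rw [e]
  have p2 : Tendsto (fun k : ℕ => (1 / 2 : ℝ) ^ k) atTop (𝓝 0) :=
    tendsto_pow_atTop_nhds_zero_of_lt_one (by norm_num) (by norm_num)
  have p4 : Tendsto (fun k : ℕ => (1 / 4 : ℝ) ^ k) atTop (𝓝 0) :=
    tendsto_pow_atTop_nhds_zero_of_lt_one (by norm_num) (by norm_num)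
  have := ((p2.const_add 1).mul (p4.const_add m)).add ((p4.add p2).mul_const (B * (4 / κ)))
  refine (ge_of_tendsto' this key).trans_eq ?_
  ring

/-- Both energies equal the minimum, so by `form_sub_self_le` the difference has energy at most
zero, and coercivity makes its L² norm vanish. -/
theorem IsObstacleSolution.ae_eq (hn : 3 ≤ n) (hY : 0 < yamabeInvariant g) {u v v' : M → ℝ}
    (hv : IsObstacleSolution g u v) (hv' : IsObstacleSolution g u v') : v =ᵐ[vol g] v' := by
  obtain ⟨X, hX⟩ := mem_H1_iff.1 hv.1.1
  obtain ⟨Y, hX'⟩ := mem_H1_iff.1 hv'.1.1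
  obtain ⟨β, hβ, h⟩ := exists_integral_sq_le_form hn hY
  have h1 := h _ _ (hX.sub hX')
  have h2 := form_sub_self_le (m := form g v v) (fun w hw => hv.2.2 w hw.1 hw.2)
    ⟨hv.1, hv.2.1⟩ ⟨hv'.1, hv'.2.1⟩
  have h3 := hv'.2.2 v hv.1 hv.2.1
  have h0 : ∫ x, (v x - v' x) ^ 2 ∂(vol g) = 0 := by
    refine le_antisymm ?_ (integral_nonneg fun x => sq_nonneg _)
    by_contra hc
    have := mul_pos hβ (not_le.1 hc)
    linarith
  rw [integral_eq_zero_iff_of_nonneg (fun x => sq_nonneg _) (hX.sub hX').integrable_sq] at h0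
  filter_upwards [h0] with x hx
  simpa [sub_eq_zero] using hx

theorem isObstacleSolution_T (hn : 3 ≤ n) (hY : 0 < yamabeInvariant g) {u : M → ℝ}
    (hu : u ∈ H1pos g) : IsObstacleSolution g u (T g u) :=
  Classical.epsilon_spec (exists_isObstacleSolution hn hY hu)

theorem I_nonneg (hn : 3 ≤ n) (hY : 0 < yamabeInvariant g) {u : M → ℝ} (hu : u ∈ H1pos g) :
    0 ≤ I g u := by
  obtain ⟨X, hX⟩ := mem_H1_iff.1 hu.1
  exact div_nonneg (form_nonneg hn hY hX) (sq_nonneg _)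

end Obstacle

/-! ### The divergence form of the Laplacian and the Yamabe equation in coordinates. -/

section Divergence

variable {n : ℕ} {G : EuclideanSpace ℝ (Fin n) → Matrix (Fin n) (Fin n) ℝ}
  {U : Set (EuclideanSpace ℝ (Fin n))} {y : EuclideanSpace ℝ (Fin n)}

theorem contDiff_det : ContDiff ℝ ∞ (fun A : Fin n → Fin n → ℝ => (Matrix.of A).det) := by
  simp only [Matrix.det_apply]
  exact ContDiff.sum fun σ _ => (contDiff_prod fun i _ =>
    (contDiff_apply_apply ℝ ℝ (σ i) i)).const_smul _

/-- Here `det (A + tH) = det A · det (1 + t A⁻¹H)`, and the second factor is a polynomial in `t`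
whose linear coefficient is the trace. -/
theorem fderiv_det_apply (A H : Fin n → Fin n → ℝ) (hA : IsUnit (Matrix.of A).det) :
    fderiv ℝ (fun A : Fin n → Fin n → ℝ => (Matrix.of A).det) A H =
      (Matrix.of A).det * ((Matrix.of A)⁻¹ * Matrix.of H).trace := by
  have h1 : HasDerivAt (fun t : ℝ => (Matrix.of (A + t • H)).det) _ 0 :=
    (((contDiff_det (n := n)).differentiable (by simp)) A).hasFDerivAt.hasLineDerivAt H
  set B := (Matrix.of A)⁻¹ * Matrix.of H with hB
  have e : ∀ t : ℝ, (Matrix.of (A + t • H)).det = (Matrix.of A).det * (1 + B.trace * t +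
      (1 + (Polynomial.X : Polynomial ℝ) • B.map Polynomial.C).det.divX.divX.eval t * t ^ 2) :=
    fun t => by
    rw [← Matrix.det_one_add_smul, ← Matrix.det_mul, mul_add, mul_one, mul_smul_comm, hB,
      Matrix.mul_nonsing_inv_cancel_left _ _ hA]
    rfl
  simp only [e] at h1
  set q := (1 + (Polynomial.X : Polynomial ℝ) • B.map Polynomial.C).det.divX.divX
  have h2 : HasDerivAt (fun t : ℝ => (Matrix.of A).det * (1 + B.trace * t + q.eval t * t ^ 2))
      ((Matrix.of A).det * B.trace) 0 := by
    have := ((((hasDerivAt_id (0 : ℝ)).const_mul B.trace).const_add 1).add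
      ((q.hasDerivAt 0).mul (hasDerivAt_pow 2 (0 : ℝ)))).const_mul (Matrix.of A).det
    simpa using this
  exact h1.unique h2

/-- Jacobi's formula for the logarithmic derivative of the volume density. -/
theorem MetricField.pderiv_sqrt_det (hG : MetricField G U) (hdet : ∀ z ∈ U, 0 < (G z).det)
    (hy : y ∈ U) (i : Fin n) : pderiv i (fun z => √(G z).det) y =
      √(G y).det * (conn G i y).trace := by
  have hd : DifferentiableAt ℝ (fun z => (G z).det) y :=
    (hG.smooth.det).differentiableAt_of_isOpen hG.isOpen hy
  have hG' : DifferentiableAt ℝ (fun z => (fun a b => G z a b : Fin n → Fin n → ℝ)) y :=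
    differentiableAt_pi.2 fun a => differentiableAt_pi.2 fun b =>
      (hG.smooth a b).differentiableAt_of_isOpen hG.isOpen hy
  have h1 : pderiv i (fun z => (G z).det) y = (G y).det * ((G y)⁻¹ * mderiv i G y).trace := by
    have hc := ((((contDiff_det (n := n)).differentiable (by simp)) (G y)).hasFDerivAt.comp y
      hG'.hasFDerivAt).fderiv
    have hm : fderiv ℝ (fun z => (fun a b => G z a b : Fin n → Fin n → ℝ)) y
        (EuclideanSpace.single i 1) = mderiv i G y := by
      ext a b
      have ha := fun a => (differentiableAt_pi.1 hG' a)
      have hb := fun a b => (differentiableAt_pi.1 (ha a) b)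
      rw [fderiv_pi ha]
      simp only [ContinuousLinearMap.pi_apply]
      rw [fderiv_pi (hb a)]
      rfl
    rw [pderiv]
    change fderiv ℝ ((fun A : Fin n → Fin n → ℝ => (Matrix.of A).det) ∘
      fun z => (fun a b => G z a b : Fin n → Fin n → ℝ)) y _ = _
    rw [hc, ContinuousLinearMap.comp_apply, hm]
    exact fderiv_det_apply (G y) (mderiv i G y) (hG.isUnit_det hy)
  -- Compatibility splits the derivative of `G` into two terms, each of which contributes the trace
  -- of the connection matrix.
  have htr : ((G y)⁻¹ * mderiv i G y).trace = 2 * (conn G i y).trace := by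
    rw [hG.mderiv_eq hy, mul_add, Matrix.trace_add, ← mul_assoc (G y)⁻¹ (G y),
      Matrix.nonsing_inv_mul _ (hG.isUnit_det hy), one_mul, Matrix.trace_mul_comm, mul_assoc,
      Matrix.mul_nonsing_inv _ (hG.isUnit_det hy), mul_one, Matrix.trace_transpose]
    ring
  have hs := pderiv_scalar_comp (i := i) (Real.hasDerivAt_sqrt (hdet y hy).ne') hd
  rw [hs, h1, htr]
  have h0 := Real.sqrt_pos.2 (hdet y hy)
  have h2 : (G y).det = √(G y).det * √(G y).det := (Real.mul_self_sqrt (hdet y hy).le).symm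
  rw [one_div, inv_mul_eq_div, div_eq_iff (by positivity)]
  nth_rewrite 1 [h2]
  ring

/-- The divergence form of the Laplacian. -/
theorem MetricField.sum_pderiv_mul_gradComp (hG : MetricField G U)
    (hdet : ∀ z ∈ U, 0 < (G z).det) {w : EuclideanSpace ℝ (Fin n) → ℝ} (hw : ContDiffOn ℝ ∞ w U)
    (hy : y ∈ U) : ∑ k, pderiv k (fun z => √(G z).det * gradComp G w k z) y =
      √(G y).det * lap G w y := by
  have hd : DifferentiableAt ℝ (fun z => √(G z).det) y :=
    ((hG.smooth.det).differentiableAt_of_isOpen hG.isOpen hy).sqrt (hdet y hy).ne'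
  have e : ∀ k, pderiv k (fun z => √(G z).det * gradComp G w k z) y =
      √(G y).det * (pderiv k (gradComp G w k) y + (conn G k y).trace * gradComp G w k y) :=
    fun k => by
    rw [pderiv_mul hd ((hG.contDiffOn_gradComp hw k).differentiableAt_of_isOpen hG.isOpen hy),
      hG.pderiv_sqrt_det hdet hy]
    ring
  simp only [e, ← Finset.mul_sum, Finset.sum_add_distrib, lap, Matrix.trace, Matrix.diag]
  congr 2
  simp only [Finset.sum_mul]
  rw [Finset.sum_comm]
  refine Finset.sum_congr rfl fun i _ => Finset.sum_congr rfl fun p _ => ?_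
  rw [hG.conn_comm hy i p i]

theorem MetricField.contDiffOn_sqrt_det (hG : MetricField G U) (hdet : ∀ z ∈ U, 0 < (G z).det) :
    ContDiffOn ℝ ∞ (fun z => √(G z).det) U :=
  fun z hz => (hG.smooth.det z hz).sqrt (hdet z hz).ne'

/-- Integration by parts against the gradient of a smooth function. -/
theorem MetricField.integral_divergence (hG : MetricField G U) (hdet : ∀ z ∈ U, 0 < (G z).det)
    {w ρ z : EuclideanSpace ℝ (Fin n) → ℝ} {Z : Fin n → EuclideanSpace ℝ (Fin n) → ℝ}
    (hw : ContDiffOn ℝ ∞ w U) (hρ : IsTest ρ U) (hz : ∀ k, IsWeakPDeriv k U z (Z k)) :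
    ∫ y, √(G y).det * (ρ y * (∑ k, gradComp G w k y * Z k y + z y * lap G w y) +
      z y * ∑ k, gradComp G w k y * pderiv k ρ y) = 0 := by
  -- These are the components of `ρ ∇w` with the volume density. They are smooth with compact
  -- support, so they can test the weak derivatives of `z`, and summing over `k` produces the
  -- divergence of `z ρ ∇w`.
  set ψ : Fin n → EuclideanSpace ℝ (Fin n) → ℝ := fun k y => ρ y * (√(G y).det * gradComp G w k y)
    with hψ_def
  have hs : ∀ k, ContDiffOn ℝ ∞ (fun y => √(G y).det * gradComp G w k y) U := fun k =>
    (hG.contDiffOn_sqrt_det hdet).mul (hG.contDiffOn_gradComp hw k)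
  have hψ : ∀ k, IsTest (ψ k) U := fun k => hρ.mul hG.isOpen (hs k)
  have h1 : ∀ k, ∫ y, (z y * pderiv k (ψ k) y + Z k y * ψ k y) = 0 := fun k => by
    rw [integral_add (IsTest.integrable_mul (hz k).left ((hψ k).pderiv k))
      (IsTest.integrable_mul (hz k).right (hψ k)), (hz k).integral_eq _ (hψ k), neg_add_cancel]
  have h2 : ∫ y, ∑ k, (z y * pderiv k (ψ k) y + Z k y * ψ k y) = 0 := by
    have hint : ∀ k, Integrable (fun y => z y * pderiv k (ψ k) y + Z k y * ψ k y) := fun k =>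
      (IsTest.integrable_mul (hz k).left ((hψ k).pderiv k)).add
        (IsTest.integrable_mul (hz k).right (hψ k))
    rw [integral_finsetSum _ fun k _ => hint k]
    exact Finset.sum_eq_zero fun k _ => h1 k
  rw [← h2]
  refine integral_congr_ae (Filter.Eventually.of_forall fun y => ?_)
  have e : ∀ k, z y * pderiv k (ψ k) y + Z k y * ψ k y =
      √(G y).det * z y * (gradComp G w k y * pderiv k ρ y) +
      z y * ρ y * pderiv k (fun z => √(G z).det * gradComp G w k z) y +
      √(G y).det * ρ y * (gradComp G w k y * Z k y) := fun k => by
    rw [hψ_def, hρ.pderiv_mul hG.isOpen (hs k)]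
    ring
  simp only [e, Finset.sum_add_distrib, ← Finset.mul_sum]
  by_cases hy : y ∈ tsupport ρ
  · rw [hG.sum_pderiv_mul_gradComp hdet hw (hρ.tsupport_subset hy)]
    ring
  · rw [image_eq_zero_of_notMem_tsupport hy]
    ring

/-- The equation for the scalar curvature of the metric `w^{4/(n-2)} G`. -/
theorem MetricField.yamabe_equation (hG : MetricField G U) (hn : 3 ≤ n)
    {w : EuclideanSpace ℝ (Fin n) → ℝ} (hw : ContDiffOn ℝ ∞ w U) (hpos : ∀ z ∈ U, 0 < w z)
    (hy : y ∈ U) :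
    w y ^ (4 / ((n : ℝ) - 2)) * scal (fun z => w z ^ (4 / ((n : ℝ) - 2)) • G z) y * w y =
      scal G y * w y - 4 * ((n : ℝ) - 1) / ((n : ℝ) - 2) * lap G w y := by
  have hn' : (3 : ℝ) ≤ n := by exact_mod_cast hn
  have hn2 : (n : ℝ) - 2 ≠ 0 := by linarith
  -- For `f = k log w` one has `e^{2f} = w^{4/(n-2)}`; with this `k` the terms in `|∇w|²` from the
  -- Laplacian of the logarithm and from `gradSq` cancel.
  set k : ℝ := 2 / ((n : ℝ) - 2) with hk
  have hwd : ∀ z ∈ U, DifferentiableAt ℝ w z := fun z hz => hw.differentiableAt_of_isOpen hG.isOpen hz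
  have hf : ContDiffOn ℝ ∞ (fun z => k * Real.log (w z)) U :=
    contDiffOn_const.mul (hw.log fun z hz => (hpos z hz).ne')
  have hlam : ContDiffOn ℝ ∞ (fun z => w z ^ (4 / ((n : ℝ) - 2))) U := fun z hz =>
    (hw z hz).rpow_const_of_ne (hpos z hz).ne'
  have hpf : ∀ z ∈ U, ∀ i, pderiv i (fun z => k * Real.log (w z)) z = k * (w z)⁻¹ * pderiv i w z :=
    fun z hz i => by
    have := pderiv_scalar_comp (i := i) ((Real.hasDerivAt_log (hpos z hz).ne').const_mul k)
      (hwd z hz)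
    exact this
  have hd : ∀ z ∈ U, ∀ i, pderiv i (fun z => w z ^ (4 / ((n : ℝ) - 2))) z =
      2 * w z ^ (4 / ((n : ℝ) - 2)) * pderiv i (fun z => k * Real.log (w z)) z := fun z hz i => by
    have := pderiv_scalar_comp (i := i)
      (Real.hasDerivAt_rpow_const (p := 4 / ((n : ℝ) - 2)) (Or.inl (hpos z hz).ne')) (hwd z hz)
    rw [this, hpf z hz, Real.rpow_sub_one (hpos z hz).ne']
    have := (hpos z hz).ne'
    rw [hk]
    field_simp
    norm_num
  have hgrad : ∀ z ∈ U, ∀ i, gradComp G (fun z => k * Real.log (w z)) i z =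
      k * (w z)⁻¹ * gradComp G w i z := fun z hz i => by
    simp only [gradComp, hpf z hz, Finset.mul_sum]
    exact Finset.sum_congr rfl fun l _ => by ring
  have hwy := (hpos y hy).ne'
  have hlap : lap G (fun z => k * Real.log (w z)) y =
      k * (w y)⁻¹ * lap G w y - k * (w y)⁻¹ ^ 2 * gradSq G w y := by
    have hdinv : DifferentiableAt ℝ (fun z => k * (w z)⁻¹) y :=
      ((hwd y hy).fun_inv hwy).const_mul k
    have hdi : ∀ i, pderiv i (gradComp G (fun z => k * Real.log (w z)) i) y =
        k * (w y)⁻¹ * pderiv i (gradComp G w i) y -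
          k * (w y)⁻¹ ^ 2 * (pderiv i w y * gradComp G w i y) := fun i => by
      rw [pderiv_congr (g := fun z => (k * (w z)⁻¹) * gradComp G w i z)
        (by filter_upwards [hG.isOpen.mem_nhds hy] with z hz using hgrad z hz i),
        pderiv_mul hdinv
          ((hG.contDiffOn_gradComp hw i).differentiableAt_of_isOpen hG.isOpen hy)]
      have := pderiv_scalar_comp (i := i) ((hasDerivAt_inv hwy).const_mul k) (hwd y hy)
      rw [this]
      field_simp
      ring
    simp only [lap, gradSq, hdi, hgrad y hy, Finset.sum_sub_distrib, mul_add, Finset.mul_sum]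
    rw [sub_add_eq_add_sub]
    congr 2
    exact Finset.sum_congr rfl fun i _ => Finset.sum_congr rfl fun p _ => by ring
  have hsq : gradSq G (fun z => k * Real.log (w z)) y = k ^ 2 * (w y)⁻¹ ^ 2 * gradSq G w y := by
    simp only [gradSq, hgrad y hy, hpf y hy, Finset.mul_sum]
    exact Finset.sum_congr rfl fun i _ => by ring
  rw [hG.scal_smul hlam (fun z hz => Real.rpow_pos_of_pos (hpos z hz) _) hf hd hy, hlap, hsq, hk]
  field_simp
  ring

end Divergence

/-! ### Gradients of smooth functions and the divergence theorem on the manifold. -/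

section SmoothFunctions

open Filter Topology

variable {n : ℕ} {M : Type*} [TopologicalSpace M] [CompactSpace M]
  [ChartedSpace (EuclideanSpace ℝ (Fin n)) M] [IsManifold (𝓡 n) ∞ M]
  [MeasurableSpace M] [BorelSpace M] {g : Metric n M}

/-- The gradient of a smooth function. -/
def gradField (g : Metric n M) (w : M → ℝ) (x : M) : TangentSpace (𝓡 n) x :=
  Classical.epsilon fun X => ∀ v, g.inner x X v = (mfderiv (𝓡 n) 𝓘(ℝ, ℝ) w x v : ℝ)

theorem inner_gradField (g : Metric n M) (w : M → ℝ) (x : M) (v : TangentSpace (𝓡 n) x) :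
    g.inner x (gradField g w x) v = (mfderiv (𝓡 n) 𝓘(ℝ, ℝ) w x v : ℝ) := by
  have h : ∃ X : TangentSpace (𝓡 n) x, ∀ v,
      g.inner x X v = (mfderiv (𝓡 n) 𝓘(ℝ, ℝ) w x v : ℝ) := by
    obtain ⟨c, y, hy, rfl⟩ := exists_eq_param (n := n) x
    obtain ⟨Z, hZ⟩ := exists_inner_eq g hy fun i =>
      (mfderiv (𝓡 n) 𝓘(ℝ, ℝ) w (param c y) (coordVec c i y) : ℝ)
    refine ⟨Z, fun v => ?_⟩
    obtain ⟨b, rfl⟩ := exists_eq_sum_coordVec hy v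
    rw [map_sum, map_sum]
    refine Finset.sum_congr rfl fun i _ => ?_
    rw [map_smul, map_smul, hZ]
    rfl
  exact Classical.epsilon_spec h v

theorem contDiffOn_comp_param {w : M → ℝ} (hw : ContMDiff (𝓡 n) 𝓘(ℝ, ℝ) ∞ w) (c : M) :
    ContDiffOn ℝ ∞ (fun y => w (param c y)) (extChartAt (𝓡 n) c).target := fun y hy =>
  (contMDiffAt_iff_contDiffAt.1 ((hw (param c y)).comp y (contMDiffAt_param hy))).contDiffWithinAt

theorem covComp_gradField (g : Metric n M) {w : M → ℝ} (hw : ContMDiff (𝓡 n) 𝓘(ℝ, ℝ) ∞ w) (c : M)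
    (i : Fin n) {y : EuclideanSpace ℝ (Fin n)} (hy : y ∈ (extChartAt (𝓡 n) c).target) :
    covComp g (gradField g w) c i y = pderiv i (fun y => w (param c y)) y := by
  rw [covComp, inner_gradField, coordVec, pderiv, ← mfderiv_eq_fderiv]
  have h := mfderiv_comp y ((hw (param c y)).mdifferentiableAt (by simp))
    ((contMDiffAt_param hy).mdifferentiableAt (by simp))
  change _ = mfderiv (𝓡 n) 𝓘(ℝ, ℝ) (w ∘ param c) y _
  rw [h]
  rfl

theorem inner_gradField_param (g : Metric n M) {w : M → ℝ} (hw : ContMDiff (𝓡 n) 𝓘(ℝ, ℝ) ∞ w)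
    (X : ∀ x : M, TangentSpace (𝓡 n) x) (c : M) {y : EuclideanSpace ℝ (Fin n)}
    (hy : y ∈ (extChartAt (𝓡 n) c).target) :
    g.inner (param c y) (gradField g w (param c y)) (X (param c y)) =
      ∑ k, gradComp (coeff g c) (fun y => w (param c y)) k y * covComp g X c k y := by
  rw [inner_eq_sum g hy]
  refine Finset.sum_congr rfl fun i _ => ?_
  rw [gradComp, Finset.sum_mul]
  refine Finset.sum_congr rfl fun j _ => ?_
  rw [← covComp_gradField g hw c j hy]
  rfl

theorem continuous_inner_gradField (g : Metric n M) {w ρ : M → ℝ}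
    (hw : ContMDiff (𝓡 n) 𝓘(ℝ, ℝ) ∞ w) (hρ : ContMDiff (𝓡 n) 𝓘(ℝ, ℝ) ∞ ρ) :
    Continuous fun x => g.inner x (gradField g w x) (gradField g ρ x) := by
  refine continuous_of_param (n := n) fun c => ?_
  have h : ContinuousOn (fun y => ∑ k, gradComp (coeff g c) (fun y => w (param c y)) k y *
      pderiv k (fun y => ρ (param c y)) y) (extChartAt (𝓡 n) c).target :=
    continuousOn_finsetSum _ fun k _ => ((metricField_coeff g c).contDiffOn_gradComp
      (contDiffOn_comp_param hw c) k).continuousOn.mul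
      (contDiffOn_pderiv (isOpen_target c) (contDiffOn_comp_param hρ c)).continuousOn
  refine h.congr fun y hy => ?_
  rw [inner_gradField_param g hw _ c hy]
  exact Finset.sum_congr rfl fun k _ => by rw [covComp_gradField g hρ c k hy]

theorem inner_add_self_le (g : Metric n M) (x : M) (v w : TangentSpace (𝓡 n) x) :
    g.inner x (v + w) (v + w) ≤ 2 * g.inner x v v + 2 * g.inner x w w := by
  have h := two_mul_abs_inner_le g x v w
  have := le_abs_self (g.inner x v w)
  rw [inner_add_self]
  linarith

/-- The product rule for a product with a smooth function. -/
theorem isWeakPDeriv_mul_smooth {u w : M → ℝ} {X : ∀ x : M, TangentSpace (𝓡 n) x} {c : M}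
    {k : Fin n} (h : IsWeakPDeriv k (extChartAt (𝓡 n) c).target (fun y => u (param c y))
      (covComp g X c k)) (hw : ContMDiff (𝓡 n) 𝓘(ℝ, ℝ) ∞ w) :
    IsWeakPDeriv k (extChartAt (𝓡 n) c).target (fun y => w (param c y) * u (param c y))
      (covComp g (fun x => w x • X x + u x • gradField g w x) c k) := by
  refine (h.mul_smooth (isOpen_target c) (contDiffOn_comp_param hw c)).congr_ae (isOpen_target c)
    EventuallyEq.rfl ?_
  filter_upwards [ae_restrict_mem (measurableSet_target c)] with y hy
  rw [covComp_add, covComp_smul, covComp_smul, covComp_gradField g hw c k hy]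
  ring

theorem HasGrad.mul_smooth {u w : M → ℝ} {X : ∀ x : M, TangentSpace (𝓡 n) x}
    (hX : HasGrad g u X) (hw : ContMDiff (𝓡 n) 𝓘(ℝ, ℝ) ∞ w) :
    HasGrad g (fun x => w x * u x) (fun x => w x • X x + u x • gradField g w x) := by
  have hwc := hw.continuous
  have hweak := fun c k => isWeakPDeriv_mul_smooth (hX.isWeakPDeriv c k) hw
  have hmeas := fun c k => (hweak c k).right.aestronglyMeasurable
  refine ⟨?_, isWeakGradient_of_isWeakPDeriv hweak, ?_⟩
  · have hm : AEStronglyMeasurable (fun x => w x * u x) (vol g) :=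
      hwc.measurable.aestronglyMeasurable.mul hX.aestronglyMeasurable
    rw [memLp_two_iff_integrable_sq hm]
    simp only [mul_pow]
    exact integrable_continuous_mul (hwc.pow 2) hX.integrable_sq
  · have h1 := (integrable_continuous_mul (hwc.pow 2) hX.integrable).const_mul 2
    have h2 := (integrable_continuous_mul (continuous_inner_gradField g hw hw)
      hX.integrable_sq).const_mul 2
    refine (h1.add h2).mono' (aestronglyMeasurable_inner hmeas hmeas)
      (Eventually.of_forall fun x => ?_)
    rw [Real.norm_of_nonneg (inner_self_nonneg g x _)]
    refine (inner_add_self_le g x _ _).trans_eq ?_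
    simp only [inner_smul_self, Pi.add_apply, Pi.pow_apply]
    ring

/-- Smooth functions supported in the domain of a chart are test functions in the chart. -/
theorem isTest_indicator [T2Space M] {ρ : M → ℝ} (hρ : ContMDiff (𝓡 n) 𝓘(ℝ, ℝ) ∞ ρ) {c : M}
    (hs : tsupport ρ ⊆ (extChartAt (𝓡 n) c).source) :
    IsTest ((extChartAt (𝓡 n) c).target.indicator fun y => ρ (param c y))
      (extChartAt (𝓡 n) c).target := by
  set K := extChartAt (𝓡 n) c '' tsupport ρ with hK
  have hKc : IsCompact K :=
    (isClosed_tsupport ρ).isCompact.image_of_continuousOn ((continuousOn_extChartAt c).mono hs)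
  have hKt : K ⊆ (extChartAt (𝓡 n) c).target := by
    rintro _ ⟨x, hx, rfl⟩
    exact (extChartAt (𝓡 n) c).map_source (hs hx)
  have hzero : ∀ y, y ∉ K →
      (extChartAt (𝓡 n) c).target.indicator (fun y => ρ (param c y)) y = 0 := fun y hy => by
    by_cases hyt : y ∈ (extChartAt (𝓡 n) c).target
    · rw [Set.indicator_of_mem hyt]
      by_contra h
      exact hy ⟨param c y, subset_tsupport _ h, (extChartAt (𝓡 n) c).right_inv hyt⟩
    · exact Set.indicator_of_notMem hyt _
  have hsub : tsupport ((extChartAt (𝓡 n) c).target.indicator fun y => ρ (param c y)) ⊆ K :=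
    closure_minimal (fun y hy => by_contra fun h => hy (hzero y h)) hKc.isClosed
  refine ⟨contDiff_iff_contDiffAt.2 fun y => ?_, hKc.of_isClosed_subset (isClosed_tsupport _) hsub,
    hsub.trans hKt⟩
  by_cases hy : y ∈ K
  · have hnhds := (isOpen_target c).mem_nhds (hKt hy)
    refine ((contDiffOn_comp_param hρ c).contDiffAt hnhds).congr_of_eventuallyEq ?_
    filter_upwards [hnhds] with z hz
    exact Set.indicator_of_mem hz _
  · refine (contDiffAt_const (c := (0 : ℝ))).congr_of_eventuallyEq ?_
    filter_upwards [hKc.isClosed.isOpen_compl.mem_nhds hy] with z hz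
    exact hzero z hz

theorem inner_gradField_eq_zero (g : Metric n M) {ρ : M → ℝ} {x : M} (hx : x ∉ tsupport ρ)
    (v : TangentSpace (𝓡 n) x) : g.inner x v (gradField g ρ x) = 0 := by
  rw [g.symm, inner_gradField, (notMem_tsupport_iff_eventuallyEq.1 hx).mfderiv_eq]
  change (mfderiv (𝓡 n) 𝓘(ℝ, ℝ) (fun _ : M => (0 : ℝ)) x) v = _
  rw [mfderiv_const]
  rfl

/-- Integration by parts, localized in a chart. -/
theorem integral_divergence_mul [T2Space M] {w L ρ z : M → ℝ}
    {Z : ∀ x : M, TangentSpace (𝓡 n) x}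
    (hw : ContMDiff (𝓡 n) 𝓘(ℝ, ℝ) ∞ w) (hL : ∀ c, ∀ y ∈ (extChartAt (𝓡 n) c).target,
      L (param c y) = lap (coeff g c) (fun y => w (param c y)) y)
    (hρ : ContMDiff (𝓡 n) 𝓘(ℝ, ℝ) ∞ ρ) {c : M}
    (hs : tsupport ρ ⊆ (extChartAt (𝓡 n) c).source)
    (hz : ∀ k, IsWeakPDeriv k (extChartAt (𝓡 n) c).target (fun y => z (param c y))
      (covComp g Z c k))
    (hm : AEStronglyMeasurable (fun x => ρ x * (g.inner x (gradField g w x) (Z x) + z x * L x) +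
      z x * g.inner x (gradField g w x) (gradField g ρ x)) (vol g)) :
    ∫ x, (ρ x * (g.inner x (gradField g w x) (Z x) + z x * L x) +
      z x * g.inner x (gradField g w x) (gradField g ρ x)) ∂(vol g) = 0 := by
  rw [← setIntegral_eq_integral_of_forall_compl_eq_zero (s := (extChartAt (𝓡 n) c).source)
    fun x hx => by
      have hx' : x ∉ tsupport ρ := fun h => hx (hs h)
      rw [inner_gradField_eq_zero g hx', image_eq_zero_of_notMem_tsupport hx']
      ring, integral_source g c hm]
  have hG := metricField_coeff g c
  have h := hG.integral_divergence (fun y hy => (coeff_posDef g hy).det_pos)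
    (contDiffOn_comp_param hw c) (isTest_indicator hρ hs) hz
  have h' := (setIntegral_eq_integral_of_forall_compl_eq_zero
    (s := (extChartAt (𝓡 n) c).target) fun y hy => by
      have hy' := fun h => hy ((isTest_indicator hρ hs).tsupport_subset h)
      simp only [image_eq_zero_of_notMem_tsupport hy', pderiv_eq_zero_of_notMem_tsupport hy']
      simp).trans h
  rw [← h']
  refine setIntegral_congr_fun (measurableSet_target c) fun y hy => ?_
  have hp : ∀ k, pderiv k ((extChartAt (𝓡 n) c).target.indicator fun y => ρ (param c y)) y =
      pderiv k (fun y => ρ (param c y)) y := fun k => pderiv_congr (by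
    filter_upwards [(isOpen_target c).mem_nhds hy] with z hz
    exact Set.indicator_of_mem hz _)
  simp only [hp, Set.indicator_of_mem hy, inner_gradField_param g hw _ c hy, hL c y hy,
    covComp_gradField g hρ c _ hy]
  rfl

/-- The divergence theorem for the product of a weakly differentiable function and the gradient
of a smooth function. -/
theorem integral_divergence [T2Space M] {w L z : M → ℝ} {Z : ∀ x : M, TangentSpace (𝓡 n) x}
    (hw : ContMDiff (𝓡 n) 𝓘(ℝ, ℝ) ∞ w) (hL : ∀ c, ∀ y ∈ (extChartAt (𝓡 n) c).target,
      L (param c y) = lap (coeff g c) (fun y => w (param c y)) y)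
    (hz : ∀ c k, IsWeakPDeriv k (extChartAt (𝓡 n) c).target (fun y => z (param c y))
      (covComp g Z c k)) (hint : Integrable z (vol g))
    (hF : Integrable (fun x => g.inner x (gradField g w x) (Z x) + z x * L x) (vol g)) :
    ∫ x, (g.inner x (gradField g w x) (Z x) + z x * L x) ∂(vol g) = 0 := by
  obtain ⟨t, ht⟩ := exists_finset_sources n M
  obtain ⟨f, hf⟩ := SmoothPartitionOfUnity.exists_isSubordinate (𝓡 n) (isClosed_univ (X := M))
    (fun c : t => (extChartAt (𝓡 n) (c : M)).source) (fun c => isOpen_extChartAt_source _)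
    (by rw [← ht]; exact Set.iUnion₂_subset fun c hc => Set.subset_iUnion_of_subset ⟨c, hc⟩ le_rfl)
  have hsum : ∀ x, ∑ j, f j x = 1 := fun x => by
    rw [← finsum_eq_sum_of_fintype]
    exact f.sum_eq_one (Set.mem_univ x)
  -- The localized integrands are the divergences of `f_j z ∇w`, which contain the extra terms `z
  -- ⟨∇w, ∇f_j⟩`. These add up to zero because the partition sums to a constant.
  have hgrad : ∀ x, ∑ j, g.inner x (gradField g w x) (gradField g (f j) x) = 0 := fun x => by
    obtain ⟨c, y, hy, rfl⟩ := exists_eq_param (n := n) x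
    simp only [inner_gradField_param g hw _ c hy]
    rw [Finset.sum_comm]
    refine Finset.sum_eq_zero fun k _ => ?_
    rw [← Finset.mul_sum]
    simp only [covComp_gradField g (f _).contMDiff c k hy]
    rw [← pderiv_sum fun j _ => (contDiffOn_comp_param (f j).contMDiff c).differentiableAt_of_isOpen
      (isOpen_target c) hy]
    simp only [hsum, pderiv_const, mul_zero]
  have hi : ∀ j, Integrable (fun x => f j x * (g.inner x (gradField g w x) (Z x) + z x * L x) +
      z x * g.inner x (gradField g w x) (gradField g (f j) x)) (vol g) := fun j => by
    refine (integrable_continuous_mul (f j).contMDiff.continuous hF).add ?_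
    simp only [mul_comm (z _)]
    exact integrable_continuous_mul (continuous_inner_gradField g hw (f j).contMDiff) hint
  calc _ = ∫ x, ∑ j, (f j x * (g.inner x (gradField g w x) (Z x) + z x * L x) +
      z x * g.inner x (gradField g w x) (gradField g (f j) x)) ∂(vol g) := by
        refine integral_congr_ae (Eventually.of_forall fun x => ?_)
        simp only [Finset.sum_add_distrib, ← Finset.sum_mul, ← Finset.mul_sum, hsum, hgrad]
        ring
    _ = _ := by
        rw [integral_finsetSum _ fun j _ => hi j]
        exact Finset.sum_eq_zero fun j _ => integral_divergence_mul hw hL (f j).contMDiff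
          (hf j) (hz j) (hi j).aestronglyMeasurable

end SmoothFunctions

/-! ### Measure, Sobolev space and critical norm of a conformal metric. -/

section Conformal

open Filter Topology

variable {n : ℕ} {M : Type*} [TopologicalSpace M] [CompactSpace M]
  [ChartedSpace (EuclideanSpace ℝ (Fin n)) M] [IsManifold (𝓡 n) ∞ M]
  [MeasurableSpace M] [BorelSpace M] {g : Metric n M} {w : M → ℝ}
  (hw : ContMDiff (𝓡 n) 𝓘(ℝ, ℝ) ∞ w) (hpos : ∀ x, 0 < w x)

theorem inner_conformal (x : M) (X Y : TangentSpace (𝓡 n) x) :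
    (conformal g w hw hpos).inner x X Y = w x ^ (4 / ((n : ℝ) - 2)) * g.inner x X Y := rfl

theorem coeff_conformal (c : M) : coeff (conformal g w hw hpos) c =
    fun y => w (param c y) ^ (4 / ((n : ℝ) - 2)) • coeff g c y := rfl

theorem continuous_rpow_of_pos {w : M → ℝ} (hw : Continuous w) (hpos : ∀ x, 0 < w x) (r : ℝ) :
    Continuous fun x => w x ^ r := hw.rpow_const fun x => Or.inl (hpos x).ne'

/-- Scaling an `n × n` matrix multiplies its determinant by the `n`-th power of the factor, and half
of `n · 4/(n-2)` is the critical exponent. -/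
theorem dens_conformal (hn : 3 ≤ n) (c : M) (y : EuclideanSpace ℝ (Fin n)) :
    dens (conformal g w hw hpos) c y =
      w (param c y) ^ (2 * (n : ℝ) / ((n : ℝ) - 2)) * dens g c y := by
  have hn' : (3 : ℝ) ≤ n := by exact_mod_cast hn
  have hn2 : (n : ℝ) - 2 ≠ 0 := by linarith
  have h0 := (hpos (param c y)).le
  rw [dens, dens, coeff_conformal, Matrix.det_smul, Fintype.card_fin, Real.sqrt_mul (by positivity),
    Real.sqrt_eq_rpow (_ ^ n), ← Real.rpow_natCast, ← Real.rpow_mul h0, ← Real.rpow_mul h0]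
  congr 2
  field_simp
  norm_num

theorem vol_conformal (hn : 3 ≤ n) : vol (conformal g w hw hpos) =
    (vol g).withDensity fun x => ENNReal.ofReal (w x ^ (2 * (n : ℝ) / ((n : ℝ) - 2))) := by
  have hwc := continuous_rpow_of_pos hw.continuous hpos (2 * (n : ℝ) / ((n : ℝ) - 2))
  have hm : Measurable fun x => ENNReal.ofReal (w x ^ (2 * (n : ℝ) / ((n : ℝ) - 2))) :=
    hwc.measurable.ennreal_ofReal
  refine (eq_vol_of_restrict_eq _ fun c => ?_).symm
  ext A hA
  rw [restrict_withDensity (measurableSet_source c), vol_restrict_source, withDensity_apply _ hA,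
    ← lintegral_indicator hA, lintegral_chartVolume g c (hm.indicator hA),
    ← lintegral_indicator_one hA, lintegral_chartVolume _ c (measurable_one.indicator hA)]
  refine lintegral_congr fun y => ?_
  rw [dens_conformal hw hpos hn]
  by_cases hy : param c y ∈ A
  · simp only [Set.indicator_of_mem hy, Pi.one_apply, mul_one]
    rw [mul_comm, ENNReal.ofReal_mul (Real.rpow_nonneg (hpos _).le _)]
  · simp [Set.indicator_of_notMem hy]

theorem ae_vol_conformal (hn : 3 ≤ n) : ae (vol (conformal g w hw hpos)) = ae (vol g) := by
  have hm : Measurable fun x => ENNReal.ofReal (w x ^ (2 * (n : ℝ) / ((n : ℝ) - 2))) :=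
    (continuous_rpow_of_pos hw.continuous hpos _).measurable.ennreal_ofReal
  rw [vol_conformal hw hpos hn]
  exact le_antisymm (withDensity_absolutelyContinuous _ _).ae_le
    (withDensity_absolutelyContinuous' hm.aemeasurable (Eventually.of_forall fun x => by
      simpa using Real.rpow_pos_of_pos (hpos x) _)).ae_le

theorem integrable_conformal_iff (hn : 3 ≤ n) {f : M → ℝ} :
    Integrable f (vol (conformal g w hw hpos)) ↔
      Integrable (fun x => w x ^ (2 * (n : ℝ) / ((n : ℝ) - 2)) * f x) (vol g) := by
  rw [vol_conformal hw hpos hn, integrable_withDensity_iff_integrable_smul'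
    (continuous_rpow_of_pos hw.continuous hpos _).measurable.ennreal_ofReal
    (Eventually.of_forall fun x => ENNReal.ofReal_lt_top)]
  simp only [ENNReal.toReal_ofReal (Real.rpow_nonneg (hpos _).le _), smul_eq_mul]

theorem integral_conformal (hn : 3 ≤ n) (f : M → ℝ) :
    ∫ x, f x ∂(vol (conformal g w hw hpos)) =
      ∫ x, w x ^ (2 * (n : ℝ) / ((n : ℝ) - 2)) * f x ∂(vol g) := by
  rw [vol_conformal hw hpos hn, integral_withDensity_eq_integral_toReal_smul
    (continuous_rpow_of_pos hw.continuous hpos _).measurable.ennreal_ofReal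
    (Eventually.of_forall fun x => ENNReal.ofReal_lt_top)]
  simp only [ENNReal.toReal_ofReal (Real.rpow_nonneg (hpos _).le _), smul_eq_mul]

theorem integrable_continuous_pos_mul_iff {f h : M → ℝ} (hf : Continuous f) (hf0 : ∀ x, 0 < f x) :
    Integrable (fun x => f x * h x) (vol g) ↔ Integrable h (vol g) := by
  refine ⟨fun hi => ?_, integrable_continuous_mul hf⟩
  have := integrable_continuous_mul (hf.inv₀ fun x => (hf0 x).ne') hi
  refine this.congr (Eventually.of_forall fun x => ?_)
  exact inv_mul_cancel_left₀ (hf0 x).ne' _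

/-- A weak gradient enters only through its products with the coordinate fields, and the conformal
factor in these products can be moved onto the vector field. -/
theorem isWeakGradient_conformal_iff {u : M → ℝ} {X : ∀ x : M, TangentSpace (𝓡 n) x} :
    IsWeakGradient (conformal g w hw hpos) u X ↔
      IsWeakGradient g u fun x => w x ^ (4 / ((n : ℝ) - 2)) • X x := by
  simp only [IsWeakGradient, inner_conformal, map_smul, _root_.smul_apply, smul_eq_mul]

theorem memLp_conformal_iff (hn : 3 ≤ n) {u : M → ℝ} :
    MemLp u 2 (vol (conformal g w hw hpos)) ↔ MemLp u 2 (vol g) := by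
  have hae := ae_vol_conformal (g := g) hw hpos hn
  have key : AEStronglyMeasurable u (vol g) →
      AEStronglyMeasurable u (vol (conformal g w hw hpos)) →
      (MemLp u 2 (vol (conformal g w hw hpos)) ↔ MemLp u 2 (vol g)) := fun h1 h2 => by
    rw [memLp_two_iff_integrable_sq h1, memLp_two_iff_integrable_sq h2,
      integrable_conformal_iff hw hpos hn, integrable_continuous_pos_mul_iff
        (continuous_rpow_of_pos hw.continuous hpos _) fun x => Real.rpow_pos_of_pos (hpos x) _]
  have hac1 : vol g ≪ vol (conformal g w hw hpos) := Measure.ae_le_iff_absolutelyContinuous.1 hae.ge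
  have hac2 : vol (conformal g w hw hpos) ≪ vol g := Measure.ae_le_iff_absolutelyContinuous.1 hae.le
  exact ⟨fun h => (key (h.aestronglyMeasurable.mono_ac hac1) h.aestronglyMeasurable).1 h,
    fun h => (key h.aestronglyMeasurable (h.aestronglyMeasurable.mono_ac hac2)).2 h⟩

theorem hasGrad_conformal_iff (hn : 3 ≤ n) {u : M → ℝ} {X : ∀ x : M, TangentSpace (𝓡 n) x} :
    HasGrad (conformal g w hw hpos) u X ↔
      HasGrad g u fun x => w x ^ (4 / ((n : ℝ) - 2)) • X x := by
  have h : Integrable (fun x => (conformal g w hw hpos).inner x (X x) (X x))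
      (vol (conformal g w hw hpos)) ↔ Integrable (fun x => g.inner x
        (w x ^ (4 / ((n : ℝ) - 2)) • X x) (w x ^ (4 / ((n : ℝ) - 2)) • X x)) (vol g) := by
    rw [integrable_conformal_iff hw hpos hn]
    simp only [inner_smul_self, inner_conformal, ← mul_assoc]
    have hc := fun r => continuous_rpow_of_pos hw.continuous hpos r
    have hp := fun r x => Real.rpow_pos_of_pos (hpos x) r
    have h1 : Continuous fun x => w x ^ (2 * (n : ℝ) / ((n : ℝ) - 2)) * w x ^ (4 / ((n : ℝ) - 2)) :=
      (hc _).mul (hc _)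
    have h2 : Continuous fun x => (w x ^ (4 / ((n : ℝ) - 2))) ^ 2 := (hc _).pow 2
    rw [integrable_continuous_pos_mul_iff h1 fun x => mul_pos (hp _ x) (hp _ x),
      integrable_continuous_pos_mul_iff h2 fun x => pow_pos (hp _ x) 2]
  exact ⟨fun ⟨h1, h2, h3⟩ => ⟨(memLp_conformal_iff hw hpos hn).1 h1,
    (isWeakGradient_conformal_iff hw hpos).1 h2, h.1 h3⟩,
    fun ⟨h1, h2, h3⟩ => ⟨(memLp_conformal_iff hw hpos hn).2 h1,
    (isWeakGradient_conformal_iff hw hpos).2 h2, h.2 h3⟩⟩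

theorem mem_H1_conformal_iff (hn : 3 ≤ n) {u : M → ℝ} :
    u ∈ H1 (conformal g w hw hpos) ↔ u ∈ H1 g := by
  rw [mem_H1_iff, mem_H1_iff]
  refine ⟨fun ⟨X, hX⟩ => ⟨_, (hasGrad_conformal_iff hw hpos hn).1 hX⟩, fun ⟨X, hX⟩ =>
    ⟨fun x => (w x ^ (4 / ((n : ℝ) - 2)))⁻¹ • X x, (hasGrad_conformal_iff hw hpos hn).2 ?_⟩⟩
  simpa only [smul_inv_smul₀ (Real.rpow_pos_of_pos (hpos _) _).ne'] using hX

theorem mul_mem_H1_iff (hw : ContMDiff (𝓡 n) 𝓘(ℝ, ℝ) ∞ w) (hpos : ∀ x, 0 < w x) {u : M → ℝ} : w * u ∈ H1 g ↔ u ∈ H1 g := by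
  have hinv : ContMDiff (𝓡 n) 𝓘(ℝ, ℝ) ∞ fun x => (w x)⁻¹ := fun x =>
    ((contDiffAt_inv ℝ (hpos x).ne').contMDiffAt.comp x (hw x))
  have hmul : ∀ {w u : M → ℝ}, ContMDiff (𝓡 n) 𝓘(ℝ, ℝ) ∞ w → u ∈ H1 g → w * u ∈ H1 g :=
    fun hw hu => by
      obtain ⟨X, hX⟩ := mem_H1_iff.1 hu
      exact mem_H1_iff.2 ⟨_, hX.mul_smooth hw⟩
  refine ⟨fun h => ?_, hmul hw⟩
  have e : (fun x => (w x)⁻¹) * (w * u) = u := by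
    ext x
    exact inv_mul_cancel_left₀ (hpos x).ne' _
  rw [← e]
  exact hmul hinv h

theorem mem_H1pos_conformal_iff (hn : 3 ≤ n) {u : M → ℝ} :
    u ∈ H1pos (conformal g w hw hpos) ↔ w * u ∈ H1pos g := by
  rw [H1pos, H1pos, Set.mem_ofPred_eq, Set.mem_ofPred_eq, mem_H1_conformal_iff hw hpos hn,
    mul_mem_H1_iff hw hpos, ae_vol_conformal hw hpos hn]
  simp only [Pi.mul_apply, mul_pos_iff_of_pos_left (hpos _)]

/-- The volume density is `w` to the power `2*`, which is absorbed into `|u|^{2*}`; this is why the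
exponent is critical. -/
theorem critNorm_conformal (hn : 3 ≤ n) (u : M → ℝ) :
    critNorm (conformal g w hw hpos) u = critNorm g (w * u) := by
  have hp0 : ENNReal.ofReal (2 * (n : ℝ) / ((n : ℝ) - 2)) ≠ 0 :=
    (lt_of_lt_of_le (by simp) (two_le_critExponent hn)).ne'
  have hn' : (3 : ℝ) ≤ n := by exact_mod_cast hn
  have hq : 0 ≤ 2 * (n : ℝ) / ((n : ℝ) - 2) := div_nonneg (by linarith) (by linarith)
  rw [critNorm, critNorm, eLpNorm_eq_lintegral_rpow_enorm_toReal hp0 ENNReal.ofReal_ne_top,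
    eLpNorm_eq_lintegral_rpow_enorm_toReal hp0 ENNReal.ofReal_ne_top, vol_conformal hw hpos hn,
    lintegral_withDensity_eq_lintegral_mul_non_measurable _
      (continuous_rpow_of_pos hw.continuous hpos _).measurable.ennreal_ofReal
      (Eventually.of_forall fun x => ENNReal.ofReal_lt_top)]
  congr 2
  refine lintegral_congr fun x => ?_
  simp only [Pi.mul_apply, enorm_mul, ENNReal.toReal_ofReal hq,
    ENNReal.mul_rpow_of_nonneg _ _ hq]
  rw [Real.enorm_of_nonneg (hpos x).le, ENNReal.ofReal_rpow_of_pos (hpos x)]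

end Conformal

/-! ### Conformal invariance of the energy, the obstacle map and the functional. -/

section ConformalInvariance

open Filter Topology

variable {n : ℕ} {M : Type*} [TopologicalSpace M] [T2Space M] [CompactSpace M]
  [ChartedSpace (EuclideanSpace ℝ (Fin n)) M] [IsManifold (𝓡 n) ∞ M]
  [MeasurableSpace M] [BorelSpace M] {g : Metric n M} {w : M → ℝ}
  (hw : ContMDiff (𝓡 n) 𝓘(ℝ, ℝ) ∞ w) (hpos : ∀ x, 0 < w x)

/-- The equation for the scalar curvature of a conformal metric. -/
theorem scalarCurvature_conformal_param (hn : 3 ≤ n) (c : M) {y : EuclideanSpace ℝ (Fin n)}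
    (hy : y ∈ (extChartAt (𝓡 n) c).target) :
    w (param c y) ^ (4 / ((n : ℝ) - 2)) *
        scalarCurvature (conformal g w hw hpos) (param c y) * w (param c y) =
      scalarCurvature g (param c y) * w (param c y) -
        4 * ((n : ℝ) - 1) / ((n : ℝ) - 2) * lap (coeff g c) (fun y => w (param c y)) y := by
  rw [scalarCurvature_param _ hy, scalarCurvature_param _ hy, coeff_conformal]
  exact (metricField_coeff g c).yamabe_equation hn (contDiffOn_comp_param hw c)
    (fun z _ => hpos _) hy

/-- The Laplacian of a smooth function is the restriction of a global continuous function. -/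
theorem exists_laplacian (hn : 3 ≤ n) : ∃ L : M → ℝ, Continuous L ∧
    (∀ c, ∀ y ∈ (extChartAt (𝓡 n) c).target,
      L (param c y) = lap (coeff g c) (fun y => w (param c y)) y) ∧
    ∀ x, scalarCurvature g x * w x = w x ^ (4 / ((n : ℝ) - 2)) *
      scalarCurvature (conformal g w hw hpos) x * w x + 4 * ((n : ℝ) - 1) / ((n : ℝ) - 2) * L x := by
  have ha := (const_pos hn).ne'
  -- `L` is defined by solving the curvature equation for the Laplacian, so that it is global and
  -- continuous because the scalar curvatures are; the equation in charts identifies it with `lap`.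
  refine ⟨fun x => (4 * ((n : ℝ) - 1) / ((n : ℝ) - 2))⁻¹ * (scalarCurvature g x * w x -
    w x ^ (4 / ((n : ℝ) - 2)) * scalarCurvature (conformal g w hw hpos) x * w x), ?_, ?_, ?_⟩
  · have h1 := continuous_scalarCurvature g
    have h2 := continuous_scalarCurvature (conformal g w hw hpos)
    have h3 := hw.continuous
    have h4 := continuous_rpow_of_pos h3 hpos (4 / ((n : ℝ) - 2))
    fun_prop
  · intro c y hy
    simp only
    rw [scalarCurvature_conformal_param hw hpos hn c hy, sub_sub_cancel, inv_mul_cancel_left₀ ha]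
  · intro x
    rw [mul_inv_cancel_left₀ ha]
    ring

/-- The point is that `u ∂ₖu` is locally integrable: by Cauchy–Schwarz it is dominated by `u² + g_kk
|∇u|²`. -/
theorem isWeakPDeriv_sq {u : M → ℝ} {X : ∀ x : M, TangentSpace (𝓡 n) x} (hX : HasGrad g u X)
    (c : M) (k : Fin n) : IsWeakPDeriv k (extChartAt (𝓡 n) c).target
      (fun y => u (param c y) ^ 2) (covComp g (fun x => (2 * u x) • X x) c k) := by
  have h := hX.isWeakPDeriv c k
  have hsq := locallyIntegrableOn_comp_param g hX.integrable_sq c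
  have huX : LocallyIntegrableOn (fun y => u (param c y) * covComp g X c k y)
      (extChartAt (𝓡 n) c).target := by
    rw [locallyIntegrableOn_iff (isOpen_target c).isLocallyClosed]
    intro K hK hKc
    have h1 := hsq.integrableOn_compact_subset hK hKc
    have h2 := (IsWeakPDeriv.locallyIntegrableOn_mul (isOpen_target c)
      (locallyIntegrableOn_comp_param g hX.integrable c)
      (contDiffOn_coeff g c k k).continuousOn).integrableOn_compact_subset hK hKc
    refine (h1.add h2).mono' ((h.left.integrableOn_compact_subset hK hKc).aestronglyMeasurable.mul
      (h.right.integrableOn_compact_subset hK hKc).aestronglyMeasurable)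
      (Eventually.of_forall fun y => ?_)
    have h3 := inner_sq_le g (param c y) (X (param c y)) (coordVec c k y)
    have h4 := two_mul_le_add_sq |u (param c y)| |covComp g X c k y|
    have h5 := abs_nonneg (u (param c y) * covComp g X c k y)
    rw [sq_abs, sq_abs, mul_assoc, ← abs_mul] at h4
    rw [Real.norm_eq_abs]
    simp only [Pi.add_apply, coeff_apply]
    change covComp g X c k y ^ 2 ≤ _ at h3
    linarith
  convert! h.sq (isOpen_target c) hsq huX using 1
  ext y
  rw [covComp_smul g fun x => 2 * u x]
  ring

/-- The conformal invariance of the form of the conformal Laplacian. -/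
theorem form_conformal (hn : 3 ≤ n) {u : M → ℝ} (hu : u ∈ H1 g) :
    form (conformal g w hw hpos) u u = form g (w * u) (w * u) := by
  obtain ⟨X', hX'⟩ := mem_H1_iff.1 ((mem_H1_conformal_iff hw hpos hn).2 hu)
  have hX := (hasGrad_conformal_iff hw hpos hn).1 hX'
  set X : ∀ x : M, TangentSpace (𝓡 n) x := fun x => w x ^ (4 / ((n : ℝ) - 2)) • X' x with hX_def
  have hV : HasGrad g (w * u) (fun x => w x • X x + u x • gradField g w x) := hX.mul_smooth hw
  obtain ⟨L, hLc, hL, hLeq⟩ := exists_laplacian (g := g) hw hpos hn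
  have hn' : (3 : ℝ) ≤ n := by exact_mod_cast hn
  have hn2 : (n : ℝ) - 2 ≠ 0 := by linarith
  have hexp : ∀ x, w x ^ (2 * (n : ℝ) / ((n : ℝ) - 2)) =
      w x ^ (4 / ((n : ℝ) - 2)) * w x ^ 2 := fun x => by
    rw [← Real.rpow_natCast, ← Real.rpow_add (hpos x)]
    congr 1
    field_simp
    push_cast
    ring
  -- `Z` is the weak gradient of `w u²`, in terms of which `|∇(wu)|² = w²|∇u|² + ⟨∇w, Z⟩` holds
  -- pointwise.
  set Z : ∀ x : M, TangentSpace (𝓡 n) x := fun x => w x • ((2 * u x) • X x) +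
    (u x ^ 2) • gradField g w x with hZ_def
  have hgV : ∀ x, g.inner x (w x • X x + u x • gradField g w x)
      (w x • X x + u x • gradField g w x) =
      w x ^ (2 * (n : ℝ) / ((n : ℝ) - 2)) * (conformal g w hw hpos).inner x (X' x) (X' x) +
      g.inner x (gradField g w x) (Z x) := fun x => by
    have hXX : g.inner x (X x) (X x) = (w x ^ (4 / ((n : ℝ) - 2))) ^ 2 *
      g.inner x (X' x) (X' x) := inner_smul_self g x _ _
    rw [inner_add_self, inner_smul_self g x (w x), inner_smul_self g x (u x), hexp,
      inner_conformal, hXX, hZ_def]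
    simp only [map_add, map_smul, _root_.smul_apply, smul_eq_mul, g.symm x (gradField g w x) (X x)]
    ring
  have hRV : ∀ x, scalarCurvature g x * (w * u) x * (w * u) x =
      w x ^ (2 * (n : ℝ) / ((n : ℝ) - 2)) *
        (scalarCurvature (conformal g w hw hpos) x * u x * u x) +
      4 * ((n : ℝ) - 1) / ((n : ℝ) - 2) * ((w x * u x ^ 2) * L x) := fun x => by
    rw [Pi.mul_apply, hexp]
    linear_combination (w x * u x ^ 2) * hLeq x
  have i1 : Integrable (fun x => w x ^ (2 * (n : ℝ) / ((n : ℝ) - 2)) *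
      (conformal g w hw hpos).inner x (X' x) (X' x)) (vol g) :=
    (integrable_conformal_iff hw hpos hn).1 hX'.integrable
  -- The function `w u²` need not have a gradient of class L², so integrability is read off from the
  -- pointwise identity, as a difference of integrable functions.
  have i2 : Integrable (fun x => g.inner x (gradField g w x) (Z x)) (vol g) := by
    refine (hV.integrable.sub i1).congr (Eventually.of_forall fun x => ?_)
    simp only [Pi.sub_apply]
    rw [hgV, add_sub_cancel_left]
  have i3 : Integrable (fun x => w x ^ (2 * (n : ℝ) / ((n : ℝ) - 2)) *
      (scalarCurvature (conformal g w hw hpos) x * u x * u x)) (vol g) :=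
    (integrable_conformal_iff hw hpos hn).1 (hX'.integrable_scalar hX')
  have i4 : Integrable (fun x => w x * u x ^ 2) (vol g) :=
    integrable_continuous_mul hw.continuous hX.integrable_sq
  have i5 : Integrable (fun x => (w x * u x ^ 2) * L x) (vol g) := by
    simp only [mul_comm _ (L _)]
    exact integrable_continuous_mul hLc i4
  -- The integrand is the divergence of `w u² ∇w`; up to the constant of the conformal Laplacian it
  -- is the difference of the two energy densities.
  have hdiv : ∫ x, (g.inner x (gradField g w x) (Z x) + (w x * u x ^ 2) * L x) ∂(vol g) = 0 :=
    integral_divergence hw hL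
      (fun c k => isWeakPDeriv_mul_smooth (u := fun x => u x ^ 2) (isWeakPDeriv_sq hX c k) hw) i4
      (i2.add i5)
  rw [integral_add i2 i5] at hdiv
  rw [form_eq hX' hX', form_eq hV hV, integral_conformal hw hpos hn, integral_conformal hw hpos hn]
  simp only [hgV, hRV]
  rw [integral_add i1 i2, integral_add i3 (i5.const_mul _), integral_const_mul,
    eq_neg_of_add_eq_zero_left hdiv]
  ring

theorem mul_le_ae_conformal_iff (hn : 3 ≤ n) {u v : M → ℝ} :
    u ≤ᵐ[vol (conformal g w hw hpos)] v ↔ w * u ≤ᵐ[vol g] w * v := by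
  rw [EventuallyLE, EventuallyLE, ae_vol_conformal hw hpos hn]
  simp only [Pi.mul_apply, mul_le_mul_iff_of_pos_left (hpos _)]

theorem mul_inv_mul_self (hpos : ∀ x, 0 < w x) (v : M → ℝ) : w * (w⁻¹ * v) = v := by
  ext x
  exact mul_inv_cancel_left₀ (hpos x).ne' _

theorem form_conformal_of_mem (hn : 3 ≤ n) {u : M → ℝ}
    (hu : u ∈ H1pos (conformal g w hw hpos)) :
    form (conformal g w hw hpos) u u = form g (w * u) (w * u) :=
  form_conformal hw hpos hn ((mem_H1_conformal_iff hw hpos hn).1 hu.1)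

/-- Multiplication by `w` is an order-preserving bijection between the competitors and preserves
their energies, so it preserves minimizers. -/
theorem isObstacleSolution_conformal_iff (hn : 3 ≤ n) {u v : M → ℝ} :
    IsObstacleSolution (conformal g w hw hpos) u v ↔ IsObstacleSolution g (w * u) (w * v) := by
  refine ⟨fun ⟨h1, h2, h3⟩ => ⟨(mem_H1pos_conformal_iff hw hpos hn).1 h1,
    (mul_le_ae_conformal_iff hw hpos hn).1 h2, fun v' hv' huv' => ?_⟩,
    fun ⟨h1, h2, h3⟩ => ⟨(mem_H1pos_conformal_iff hw hpos hn).2 h1,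
    (mul_le_ae_conformal_iff hw hpos hn).2 h2, fun v' hv' huv' => ?_⟩⟩
  · rw [← mul_inv_mul_self hpos v'] at hv' huv' ⊢
    have hv'' := (mem_H1pos_conformal_iff hw hpos hn).2 hv'
    rw [← form_conformal_of_mem hw hpos hn h1, ← form_conformal_of_mem hw hpos hn hv'']
    exact h3 _ hv'' ((mul_le_ae_conformal_iff hw hpos hn).2 huv')
  · rw [form_conformal_of_mem hw hpos hn ((mem_H1pos_conformal_iff hw hpos hn).2 h1),
      form_conformal_of_mem hw hpos hn hv']
    exact h3 _ ((mem_H1pos_conformal_iff hw hpos hn).1 hv')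
      ((mul_le_ae_conformal_iff hw hpos hn).1 huv')

/-- Existence for `g_w` is transported from `g`; positivity of the invariant is needed for `g` only.
-/
theorem isObstacleSolution_T_conformal (hn : 3 ≤ n) (hY : 0 < yamabeInvariant g) {u : M → ℝ}
    (hu : u ∈ H1pos (conformal g w hw hpos)) :
    IsObstacleSolution (conformal g w hw hpos) u (T (conformal g w hw hpos) u) := by
  refine Classical.epsilon_spec (p := IsObstacleSolution (conformal g w hw hpos) u)
    ⟨w⁻¹ * T g (w * u), ?_⟩
  rw [isObstacleSolution_conformal_iff hw hpos hn, mul_inv_mul_self hpos]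
  exact isObstacleSolution_T hn hY ((mem_H1pos_conformal_iff hw hpos hn).1 hu)

/-- The two sides come from independent choices of solutions, so only uniqueness almost everywhere
can relate them. -/
theorem mul_T_conformal_ae_eq (hn : 3 ≤ n) (hY : 0 < yamabeInvariant g) {u : M → ℝ}
    (hu : u ∈ H1pos (conformal g w hw hpos)) :
    w * T (conformal g w hw hpos) u =ᵐ[vol g] T g (w * u) :=
  ((isObstacleSolution_conformal_iff hw hpos hn).1
    (isObstacleSolution_T_conformal hw hpos hn hY hu)).ae_eq hn hY
    (isObstacleSolution_T hn hY ((mem_H1pos_conformal_iff hw hpos hn).1 hu))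

theorem I_conformal (hn : 3 ≤ n) (hY : 0 < yamabeInvariant g) {u : M → ℝ}
    (hu : u ∈ H1pos (conformal g w hw hpos)) :
    I (conformal g w hw hpos) u = I g (w * u) := by
  rw [I, I, form_conformal_of_mem hw hpos hn hu, critNorm_conformal hw hpos hn, critNorm,
    eLpNorm_congr_ae (mul_T_conformal_ae_eq hw hpos hn hY hu), ← critNorm]

/-- The functionals take the same set of values, which is stronger than equality of the infima. -/
theorem image_I_conformal (hn : 3 ≤ n) (hY : 0 < yamabeInvariant g) :
    I (conformal g w hw hpos) '' H1pos (conformal g w hw hpos) = I g '' H1pos g := by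
  ext r
  constructor
  · rintro ⟨u, hu, rfl⟩
    exact ⟨w * u, (mem_H1pos_conformal_iff hw hpos hn).1 hu, (I_conformal hw hpos hn hY hu).symm⟩
  · rintro ⟨v, hv, rfl⟩
    rw [← mul_inv_mul_self hpos v] at hv ⊢
    have hu := (mem_H1pos_conformal_iff hw hpos hn).2 hv
    exact ⟨_, hu, I_conformal hw hpos hn hY hu⟩

end ConformalInvariance

end Yamabe

end

/-! ### The main theorem. -/

theorem corollary4p4 {n : ℕ} (hn : 3 ≤ n)
    {M : Type*} [TopologicalSpace M] [T2Space M] [CompactSpace M]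
    [ChartedSpace (EuclideanSpace ℝ (Fin n)) M] [IsManifold (𝓡 n) ∞ M]
    [MeasurableSpace M] [BorelSpace M]
    (g : Yamabe.Metric n M) (hY : 0 < Yamabe.yamabeInvariant g) :
    -- the obstacle map is well defined, and so is the quotient that defines `I^h`
    (∀ h ∈ Yamabe.conformalClass g, ∀ u ∈ Yamabe.H1pos h,
      Yamabe.IsObstacleSolution h u (Yamabe.T h u) ∧
      (∀ v, Yamabe.IsObstacleSolution h u v → v =ᵐ[Yamabe.vol h] Yamabe.T h u) ∧
      0 < Yamabe.critNorm h (Yamabe.T h u)) ∧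
    -- the transformation rules of the obstacle map and of the functional
    (∀ (w : M → ℝ) (hw : ContMDiff (𝓡 n) 𝓘(ℝ, ℝ) ∞ w) (hpos : ∀ x, 0 < w x),
      ∀ u ∈ Yamabe.H1pos (Yamabe.conformal g w hw hpos),
        w * u ∈ Yamabe.H1pos g ∧
        Yamabe.T (Yamabe.conformal g w hw hpos) u
          =ᵐ[Yamabe.vol (Yamabe.conformal g w hw hpos)] w⁻¹ * Yamabe.T g (w * u) ∧
        Yamabe.I (Yamabe.conformal g w hw hpos) u = Yamabe.I g (w * u)) ∧
    -- conformal invariance of the infimum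
    (∀ h ∈ Yamabe.conformalClass g,
      IsGLB (Yamabe.I h '' Yamabe.H1pos h) (Yamabe.Yoc h) ∧ Yamabe.Yoc h = Yamabe.Yoc g) := by
  refine ⟨?_, fun w hw hpos u hu => ⟨?_, ?_, ?_⟩, ?_⟩
  · rintro h ⟨w, hw, hpos, rfl⟩ u hu
    have hT := Yamabe.isObstacleSolution_T_conformal hw hpos hn hY hu
    -- The norm of the solution is positive because `w` times it lies in `H1pos g` and has the same
    -- critical norm for `g`.
    have hcrit := Yamabe.critNorm_pos hY ((Yamabe.mem_H1pos_conformal_iff hw hpos hn).1 hT.1)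
    refine ⟨hT, fun v hv => ?_, by rwa [Yamabe.critNorm_conformal hw hpos hn]⟩
    have h := ((Yamabe.isObstacleSolution_conformal_iff hw hpos hn).1 hv).ae_eq hn hY
      ((Yamabe.isObstacleSolution_conformal_iff hw hpos hn).1 hT)
    rw [Filter.EventuallyEq, Yamabe.ae_vol_conformal hw hpos hn]
    filter_upwards [h] with x hx
    exact mul_left_cancel₀ (hpos x).ne' hx
  · exact (Yamabe.mem_H1pos_conformal_iff hw hpos hn).1 hu
  · rw [Filter.EventuallyEq, Yamabe.ae_vol_conformal hw hpos hn]
    filter_upwards [Yamabe.mul_T_conformal_ae_eq hw hpos hn hY hu] with x hx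
    rw [Pi.mul_apply, Pi.inv_apply, ← hx, Pi.mul_apply, inv_mul_cancel_left₀ (hpos x).ne']
  · exact Yamabe.I_conformal hw hpos hn hY hu
  · rintro h ⟨w, hw, hpos, rfl⟩
    rw [Yamabe.Yoc, Yamabe.Yoc, Yamabe.image_I_conformal hw hpos hn hY]
    -- Nonemptiness and the lower bound `0` make the real `sInf` a genuine infimum rather than a
    -- default value.
    refine ⟨isGLB_csInf ((Yamabe.nonempty_of_yamabeInvariant_pos hY).image _) ⟨0, ?_⟩, rfl⟩
    rintro _ ⟨u, hu, rfl⟩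
    exact Yamabe.I_nonneg hn hY hu
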